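/- **Conventions.** Fix two Grothendieck universes $\mathcal U_1\in\mathcal U_2$; sets in $\mathcal U_1$ are *small*, sets in $\mathcal U_2$ are *large*. "2-category", "2-functor", "2-natural transformation" and "2-adjoint" are meant strictly. Let $\mathbf{VDBL}$ be the 2-category of large virtual double categories, virtual double functors and vertical transformations, and $2\text{-}\mathbf{CAT}$ the 2-category of large 2-categories, 2-functors and 2-natural transformations. **Enriched categories.** Let $\mathbb A$ be a virtual double category. - A small $\mathbb A$-category $\mathcal C$ consists of a small set $\mathrm{ob}(\mathcal C)$, an object $|c|$ of $\mathbb A$ for each $c\in\mathcal C$, a horizontal morphism $\mathcal C(c,c')$ from $|c|$ to $|c'|$ for all $c,c'$, and multicells $\eta_c\colon()\to\mathcal C(c,c)$ and $\mu_{c_0,c_1,c_2}\colon(\mathcal C(c_0,c_1),\mathcal C(c_1,c_2))\to\mathcal C(c_0,c_2)$ with identity vertical boundaries, satisfying the unit and associativity laws. - An $\mathbb A$-functor $f\colon\mathcal C\to\mathcal D$ consists of a function $c\mapsto fc$ on objects, vertical morphisms $f_c\colon|c|\to|fc|$, and cells $\omega^f_{c,c'}\colon\mathcal C(c,c')\to\mathcal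 D(fc,fc')$ with vertical boundaries $f_c,f_{c'}$, compatible with the multicells $\eta$ and $\mu$. - An $\mathbb A$-natural transformation $\alpha\colon f\to f'$ consists of multicells $\alpha_c\colon()\to\mathcal D(fc,f'c)$ with vertical boundaries $f_c,f'_c$ such that $\mu\circ(\alpha_c,\omega^{f'}_{c,c'})=\mu\circ(\omega^f_{c,c'},\alpha_{c'})$ for all $c,c'$. These form a 2-category $\mathrm{Enr}(\mathbb A)$. A virtual double functor $F\colon\mathbb A\to\mathbb B$ induces a 2-functor $\mathrm{Enr}(F)\colon\mathrm{Enr}(\mathbb A)\to\mathrm{Enr}(\mathbb B)$ by applying $F$ to all of the data. A vertical transformation $F\to G$ induces a 2-natural transformation $\mathrm{Enr}(F)\to\mathrm{Enr}(G)$, whose component at $\mathcal C$ is the identity on objects and is given by the components of the transformation at $|c|$ and at $\mathcal C(c,c')$. This defines a 2-functor $\mathrm{Enr}\colon\mathbf{VDBL}\to2\text{-}\mathbf{CAT}$. **Familial 2-functors.** Let $\mathcal K$ be a 2-category with terminal object $1$, let $R\colon\mathcal K\to\mathcal L$ be a 2-functor, and let $R_1\colon\mathcal K\to\mathcal L/R1$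 be the 2-functor to the strict slice 2-category sending $A$ to $R(!)\colon RA\to R1$. One calls $R$ a *parametric right 2-adjoint* if $R_1$ has a left 2-adjoint. A *split fibration* in $\mathcal L$ is a morphism $p\colon E\to B$ together with the structure of a split fibration of categories on $\mathcal L(X,p)\colon\mathcal L(X,E)\to\mathcal L(X,B)$ for each object $X$, such that $\mathcal L(f,E)$ preserves the chosen cartesian lifts for each $f\colon Y\to X$. Let $\mathrm{Spl}(B)$ be the 2-category whose objects are the split fibrations over $B$, whose morphisms are the morphisms over $B$ preserving the chosen cartesian lifts, and whose 2-cells are those of $\mathcal L/B$; let $U_B\colon\mathrm{Spl}(B)\to\mathcal L/B$ be the forgetful 2-functor. One calls $R$ *familial* if it is a parametric right 2-adjoint and $R_1=U_{R1}\circ\overline R_1$ for some 2-functor $\overline R_1\colon\mathcal K\to\mathrm{Spl}(R1)$. **Theorem.** The 2-functor $\mathrm{Enr}\colon\mathbf{VDBL}\to2\text{-}\mathbf{CAT}$ is familial. In particular, it is a parametric right 2-adjoint. -/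

import Mathlib

open CategoryTheory
set_option linter.unusedVariables false
set_option linter.checkUnivs false

namespace VEnr

/-! ### 2-categories

A 2-category is a Mathlib `Bicategory` which is `Bicategory.Strict`, and a 2-functor is a
`StrictPseudofunctor`. -/

section TwoCat

universe w v u w₁ v₁ u₁ w₂ v₂ u₂ w₃ v₃ u₃

open Bicategory

/-- The operations and axioms of a 2-category on given 1-cells and hom-categories, phrased with
strict associativity and unit laws; equalities of 2-cells whose boundaries are only
propositionally equal are heterogeneous. -/
structure TwoCatCore (B : Type u) [CategoryStruct.{v} B] [∀ a b : B, Category.{w} (a ⟶ b)] where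
  id_comp : ∀ {a b : B} (f : a ⟶ b), 𝟙 a ≫ f = f
  comp_id : ∀ {a b : B} (f : a ⟶ b), f ≫ 𝟙 b = f
  assoc : ∀ {a b c d : B} (f : a ⟶ b) (g : b ⟶ c) (h : c ⟶ d), (f ≫ g) ≫ h = f ≫ g ≫ h
  wl : ∀ {a b c : B} (f : a ⟶ b) {g h : b ⟶ c}, (g ⟶ h) → (f ≫ g ⟶ f ≫ h)
  wr : ∀ {a b c : B} {f g : a ⟶ b}, (f ⟶ g) → ∀ h : b ⟶ c, f ≫ h ⟶ g ≫ h
  wl_id : ∀ {a b c : B} (f : a ⟶ b) (g : b ⟶ c), wl f (𝟙 g) = 𝟙 (f ≫ g)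
  wl_comp : ∀ {a b c : B} (f : a ⟶ b) {g h i : b ⟶ c} (η : g ⟶ h) (θ : h ⟶ i),
    wl f (η ≫ θ) = wl f η ≫ wl f θ
  id_wr : ∀ {a b c : B} (f : a ⟶ b) (g : b ⟶ c), wr (𝟙 f) g = 𝟙 (f ≫ g)
  comp_wr : ∀ {a b c : B} {f g h : a ⟶ b} (η : f ⟶ g) (θ : g ⟶ h) (i : b ⟶ c),
    wr (η ≫ θ) i = wr η i ≫ wr θ i
  exchange : ∀ {a b c : B} {f g : a ⟶ b} {h i : b ⟶ c} (η : f ⟶ g) (θ : h ⟶ i),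
    wl f θ ≫ wr η i = wr η h ≫ wl g θ
  id_wl : ∀ {a b : B} {f g : a ⟶ b} (η : f ⟶ g), wl (𝟙 a) η ≍ η
  wr_id : ∀ {a b : B} {f g : a ⟶ b} (η : f ⟶ g), wr η (𝟙 b) ≍ η
  comp_wl : ∀ {a b c d : B} (f : a ⟶ b) (g : b ⟶ c) {h h' : c ⟶ d} (η : h ⟶ h'),
    wl (f ≫ g) η ≍ wl f (wl g η)
  wr_comp : ∀ {a b c d : B} {f f' : a ⟶ b} (η : f ⟶ f') (g : b ⟶ c) (h : c ⟶ d),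
    wr η (g ≫ h) ≍ wr (wr η g) h
  wl_wr : ∀ {a b c d : B} (f : a ⟶ b) {g g' : b ⟶ c} (η : g ⟶ g') (h : c ⟶ d),
    wr (wl f η) h ≍ wl f (wr η h)

namespace TwoCatCore

variable {B : Type u} [CategoryStruct.{v} B] [∀ a b : B, Category.{w} (a ⟶ b)]

theorem wl_eqToHom (S : TwoCatCore B) {a b c : B} (f : a ⟶ b) {g h : b ⟶ c} (e : g = h) :
    S.wl f (eqToHom e) = eqToHom (by rw [e]) := by
  subst e; simp [S.wl_id]

theorem eqToHom_wr (S : TwoCatCore B) {a b c : B} {f g : a ⟶ b} (e : f = g) (h : b ⟶ c) :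
    S.wr (eqToHom e) h = eqToHom (by rw [e]) := by
  subst e; simp [S.id_wr]

/-- The bicategory with the given operations whose associators and unitors are identities. -/
@[reducible]
def bicategory (S : TwoCatCore B) : Bicategory.{w, v} B where
  homCategory := inferInstance
  whiskerLeft f _ _ η := S.wl f η
  whiskerRight η h := S.wr η h
  associator f g h := eqToIso (S.assoc f g h)
  leftUnitor f := eqToIso (S.id_comp f)
  rightUnitor f := eqToIso (S.comp_id f)
  whiskerLeft_id := S.wl_id
  whiskerLeft_comp := S.wl_comp
  id_whiskerRight := S.id_wr
  comp_whiskerRight := S.comp_wr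
  whisker_exchange := S.exchange
  id_whiskerLeft η := by simp [← heq_eq_eq, S.id_wl]
  whiskerRight_id η := by simp [← heq_eq_eq, S.wr_id]
  comp_whiskerLeft f g _ _ η := by simp [← heq_eq_eq, S.comp_wl]
  whiskerRight_comp η g h := by simp [← heq_eq_eq, S.wr_comp]
  whisker_assoc f _ _ η h := by simp [← heq_eq_eq, S.wl_wr]
  pentagon f g h i := by simp [S.wl_eqToHom, S.eqToHom_wr]
  triangle f g := by simp [S.wl_eqToHom, S.eqToHom_wr]

theorem strict (S : TwoCatCore B) : @Bicategory.Strict B S.bicategory :=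
  letI := S.bicategory
  { id_comp := S.id_comp
    comp_id := S.comp_id
    assoc := S.assoc
    leftUnitor_eqToIso := fun _ => rfl
    rightUnitor_eqToIso := fun _ => rfl
    associator_eqToIso := fun _ _ _ => rfl }

end TwoCatCore

variable {B : Type u} [Bicategory.{w, v} B] {C : Type u₁} [Bicategory.{w₁, v₁} C]
  {D : Type u₂} [Bicategory.{w₂, v₂} D] {E : Type u₃} [Bicategory.{w₃, v₃} E]

/-- 2-functors are equal if they agree on objects, 1-cells and 2-cells. -/
theorem twoFunctor_ext {F G : StrictPseudofunctor B C} (h₀ : ∀ a, F.obj a = G.obj a)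
    (h₁ : ∀ {a b : B} (f : a ⟶ b), F.map f ≍ G.map f)
    (h₂ : ∀ {a b : B} {f g : a ⟶ b} (η : f ⟶ g), F.map₂ η ≍ G.map₂ η) : F = G := by
  obtain ⟨⟨⟨⟨⟨⟨Fo, Fm⟩, Fm2⟩, _, _⟩, Fid, Fc, _, _, _, _, _⟩, Fi, Fi'⟩, Fc', Fc''⟩ := F
  obtain ⟨⟨⟨⟨⟨⟨Go, Gm⟩, Gm2⟩, _, _⟩, Gid, Gc, _, _, _, _, _⟩, Gi, Gi'⟩, Gc', Gc''⟩ := G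
  obtain rfl : Fo = Go := funext h₀
  obtain rfl : @Fm = @Gm := by
    funext a b f; exact eq_of_heq (h₁ f)
  obtain rfl : @Fm2 = @Gm2 := by
    funext a b f g η; exact eq_of_heq (h₂ η)
  obtain rfl : Fid = Gid := by
    funext a; exact (Fi' a).trans (Gi' a).symm
  obtain rfl : @Fc = @Gc := by
    funext a b c f g; exact (Fc'' f g).trans (Gc'' f g).symm
  rfl

/-- A 2-natural transformation between 2-functors. -/
structure TwoNatTrans (F G : StrictPseudofunctor B C) where
  app (a : B) : F.obj a ⟶ G.obj a
  naturality {a b : B} (f : a ⟶ b) : F.map f ≫ app b = app a ≫ G.map f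
  naturality₂ {a b : B} {f g : a ⟶ b} (η : f ⟶ g) :
    F.map₂ η ▷ app b ≫ eqToHom (naturality g) = eqToHom (naturality f) ≫ app a ◁ G.map₂ η

end TwoCat
end VEnr
namespace VEnr
section TwoCat2
universe w v u w₁ v₁ u₁ w₂ v₂ u₂ w₃ v₃ u₃

open Bicategory
variable {B : Type u} [Bicategory.{w, v} B] {C : Type u₁} [Bicategory.{w₁, v₁} C]
  {D : Type u₂} [Bicategory.{w₂, v₂} D] {E : Type u₃} [Bicategory.{w₃, v₃} E]

theorem wl_heq {a b c : B} {f f' : a ⟶ b} (e : f = f') {g h g' h' : b ⟶ c} (eg : g = g')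
    (eh : h = h') {η : g ⟶ h} {η' : g' ⟶ h'} (e' : η ≍ η') : f ◁ η ≍ f' ◁ η' := by
  subst e eg eh e'; rfl

theorem wr_heq {a b c : B} {f f' : b ⟶ c} (e : f = f') {g h g' h' : a ⟶ b} (eg : g = g')
    (eh : h = h') {η : g ⟶ h} {η' : g' ⟶ h'} (e' : η ≍ η') : η ▷ f ≍ η' ▷ f' := by
  subst e eg eh e'; rfl

section strict
variable [Strict B]

theorem id_wl_heq {a b : B} {f g : a ⟶ b} (η : f ⟶ g) : 𝟙 a ◁ η ≍ η := by
  rw [id_whiskerLeft, Strict.leftUnitor_eqToIso, Strict.leftUnitor_eqToIso]; simp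

theorem wr_id_heq {a b : B} {f g : a ⟶ b} (η : f ⟶ g) : η ▷ 𝟙 b ≍ η := by
  rw [whiskerRight_id, Strict.rightUnitor_eqToIso, Strict.rightUnitor_eqToIso]; simp

theorem comp_wl_heq {a b c d : B} (f : a ⟶ b) (g : b ⟶ c) {h h' : c ⟶ d} (η : h ⟶ h') :
    (f ≫ g) ◁ η ≍ f ◁ g ◁ η := by
  rw [comp_whiskerLeft, Strict.associator_eqToIso, Strict.associator_eqToIso]; simp

theorem wr_comp_heq {a b c d : B} {f f' : a ⟶ b} (η : f ⟶ f') (g : b ⟶ c) (h : c ⟶ d) :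
    η ▷ (g ≫ h) ≍ η ▷ g ▷ h := by
  rw [whiskerRight_comp, Strict.associator_eqToIso, Strict.associator_eqToIso]; simp

theorem wl_wr_heq {a b c d : B} (f : a ⟶ b) {g g' : b ⟶ c} (η : g ⟶ g') (h : c ⟶ d) :
    (f ◁ η) ▷ h ≍ f ◁ (η ▷ h) := by
  rw [whisker_assoc, Strict.associator_eqToIso, Strict.associator_eqToIso]; simp

end strict

theorem map₂_wl_heq (F : StrictPseudofunctor B C) {a b c : B} (f : a ⟶ b) {g h : b ⟶ c}
    (η : g ⟶ h) : F.map₂ (f ◁ η) ≍ F.map f ◁ F.map₂ η := by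
  rw [F.map₂_whisker_left, F.mapComp_eq_eqToIso, F.mapComp_eq_eqToIso]; simp

theorem map₂_wr_heq (F : StrictPseudofunctor B C) {a b c : B} {f g : a ⟶ b}
    (η : f ⟶ g) (h : b ⟶ c) : F.map₂ (η ▷ h) ≍ F.map₂ η ▷ F.map h := by
  rw [F.map₂_whisker_right, F.mapComp_eq_eqToIso, F.mapComp_eq_eqToIso]; simp

theorem map₂_heq (F : StrictPseudofunctor B C) {a b : B} {f g f' g' : a ⟶ b} (hf : f = f')
    (hg : g = g') {η : f ⟶ g} {η' : f' ⟶ g'} (h : η ≍ η') : F.map₂ η ≍ F.map₂ η' := by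
  subst hf hg h; rfl

namespace TwoNatTrans

@[ext]
theorem ext {F G : StrictPseudofunctor B C} {α β : TwoNatTrans F G}
    (h : ∀ a, α.app a = β.app a) : α = β := by
  obtain ⟨a, _, _⟩ := α
  obtain ⟨b, _, _⟩ := β
  obtain rfl : a = b := funext h
  rfl

theorem heq {F G F' G' : StrictPseudofunctor B C} (hF : F = F') (hG : G = G')
    {α : TwoNatTrans F G} {β : TwoNatTrans F' G'} (h : ∀ a, α.app a ≍ β.app a) : α ≍ β := by
  subst hF hG
  exact heq_of_eq (ext fun a => eq_of_heq (h a))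

/-- Naturality on 2-cells as a heterogeneous equality. -/
theorem naturality₂_heq {F G : StrictPseudofunctor B C} (α : TwoNatTrans F G) {a b : B}
    {f g : a ⟶ b} (η : f ⟶ g) : F.map₂ η ▷ α.app b ≍ α.app a ◁ G.map₂ η := by
  exact (comp_eqToHom_heq _ _).symm.trans
    ((heq_of_eq (α.naturality₂ η)).trans (eqToHom_comp_heq _ _))

/-- Construct a 2-natural transformation from a heterogeneous naturality condition. -/
@[reducible]
def mk' {F G : StrictPseudofunctor B C} (app : ∀ a, F.obj a ⟶ G.obj a)
    (nat : ∀ {a b : B} (f : a ⟶ b), F.map f ≫ app b = app a ≫ G.map f)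
    (nat₂ : ∀ {a b : B} {f g : a ⟶ b} (η : f ⟶ g), F.map₂ η ▷ app b ≍ app a ◁ G.map₂ η) :
    TwoNatTrans F G where
  app := app
  naturality := nat
  naturality₂ η := by simpa [← heq_eq_eq] using nat₂ η

/-- The identity 2-natural transformation. -/
@[simps!]
def id [Strict C] (F : StrictPseudofunctor B C) : TwoNatTrans F F :=
  mk' (fun a => 𝟙 (F.obj a)) (fun f => by rw [Strict.id_comp, Strict.comp_id])
    (fun η => (wr_id_heq _).trans (id_wl_heq _).symm)

/-- Vertical composition of 2-natural transformations. -/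
@[simps!]
def vcomp [Strict C] {F G H : StrictPseudofunctor B C} (α : TwoNatTrans F G)
    (β : TwoNatTrans G H) : TwoNatTrans F H :=
  mk' (fun a => α.app a ≫ β.app a)
    (fun f => by
      rw [← Strict.assoc, α.naturality, Strict.assoc, β.naturality, Strict.assoc])
    (fun {a b f g} η =>
      (wr_comp_heq _ _ _).trans <|
      (wr_heq rfl (α.naturality f) (α.naturality g) (α.naturality₂_heq η)).trans <|
      (wl_wr_heq _ _ _).trans <|
      (wl_heq rfl (β.naturality f) (β.naturality g) (β.naturality₂_heq η)).trans
      (comp_wl_heq _ _ _).symm)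

/-- Whiskering of a 2-natural transformation by a 2-functor on the source side. -/
@[simps!]
def whiskerL (F : StrictPseudofunctor B C) {G H : StrictPseudofunctor C D}
    (α : TwoNatTrans G H) : TwoNatTrans (F.comp G) (F.comp H) :=
  mk' (fun a => α.app (F.obj a)) (fun f => α.naturality (F.map f))
    (fun η => α.naturality₂_heq (F.map₂ η))

/-- Whiskering of a 2-natural transformation by a 2-functor on the target side. -/
@[simps!]
def whiskerR {F G : StrictPseudofunctor B C} (α : TwoNatTrans F G)
    (H : StrictPseudofunctor C D) : TwoNatTrans (F.comp H) (G.comp H) :=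
  mk' (fun a => H.map (α.app a))
    (fun f => by
      change H.map _ ≫ _ = _ ≫ H.map _
      rw [← H.map_comp, α.naturality, H.map_comp])
    (fun {a b f g} η =>
      (map₂_wr_heq H (F.map₂ η) (α.app b)).symm.trans <|
      (map₂_heq H (α.naturality f) (α.naturality g) (α.naturality₂_heq η)).trans
      (map₂_wl_heq H (α.app a) (G.map₂ η)))

end TwoNatTrans

/-- A (large) 2-category, with objects, 1-cells and 2-cells in the universe `Type w`. -/
structure TwoCAT : Type (w + 1) where
  carrier : Type w
  [bicat : Bicategory.{w, w} carrier]
  [strict : Strict carrier]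

namespace TwoCAT

instance : CoeSort TwoCAT.{w} (Type w) := ⟨carrier⟩

instance (K : TwoCAT.{w}) : Bicategory.{w, w} K := K.bicat

instance (K : TwoCAT.{w}) : Strict K := K.strict

instance : CategoryStruct TwoCAT.{w} where
  Hom K L := StrictPseudofunctor K L
  id K := StrictPseudofunctor.id K
  comp F G := StrictPseudofunctor.comp F G

instance (K L : TwoCAT.{w}) : Category (K ⟶ L) where
  Hom F G := TwoNatTrans F G
  id F := TwoNatTrans.id F
  comp α β := TwoNatTrans.vcomp α β
  id_comp _ := TwoNatTrans.ext fun _ => Strict.id_comp _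
  comp_id _ := TwoNatTrans.ext fun _ => Strict.comp_id _
  assoc _ _ _ := TwoNatTrans.ext fun _ => Strict.assoc _ _ _

theorem id_comp' {K L : TwoCAT.{w}} (F : K ⟶ L) : 𝟙 K ≫ F = F :=
  twoFunctor_ext (fun _ => rfl) (fun _ => HEq.rfl) (fun _ => HEq.rfl)

theorem comp_id' {K L : TwoCAT.{w}} (F : K ⟶ L) : F ≫ 𝟙 L = F :=
  twoFunctor_ext (fun _ => rfl) (fun _ => HEq.rfl) (fun _ => HEq.rfl)

theorem assoc' {K L M N : TwoCAT.{w}} (F : K ⟶ L) (G : L ⟶ M) (H : M ⟶ N) :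
    (F ≫ G) ≫ H = F ≫ G ≫ H :=
  twoFunctor_ext (fun _ => rfl) (fun _ => HEq.rfl) (fun _ => HEq.rfl)

/-- The 2-category of large 2-categories, 2-functors and 2-natural transformations. -/
@[reducible]
def core : TwoCatCore TwoCAT.{w} where
  id_comp := id_comp'
  comp_id := comp_id'
  assoc := assoc'
  wl F _ _ α := TwoNatTrans.whiskerL F α
  wr α H := TwoNatTrans.whiskerR α H
  wl_id _ _ := rfl
  wl_comp _ _ _ _ _ _ := rfl
  id_wr F G := TwoNatTrans.ext fun a => G.map_id _
  comp_wr _ _ H := TwoNatTrans.ext fun a => H.map_comp _ _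
  exchange {K L M F G H I} α β := TwoNatTrans.ext fun a => (β.naturality (α.app a)).symm
  id_wl {K L F G} α := TwoNatTrans.heq (id_comp' F) (id_comp' G) fun a => HEq.rfl
  wr_id {K L F G} α := TwoNatTrans.heq (comp_id' F) (comp_id' G) fun a => HEq.rfl
  comp_wl F G _ _ η := TwoNatTrans.heq (assoc' F G _) (assoc' F G _) fun a => HEq.rfl
  wr_comp _ G H := TwoNatTrans.heq (assoc' _ G H).symm (assoc' _ G H).symm fun a => HEq.rfl
  wl_wr F _ _ _ H := TwoNatTrans.heq (assoc' F _ H) (assoc' F _ H) fun a => HEq.rfl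

instance : Bicategory.{w, w} TwoCAT.{w} := core.bicategory

instance : Strict TwoCAT.{w} := core.strict

end TwoCAT

end TwoCat2
end VEnr
namespace VEnr
section Familial
universe w v u w₁ v₁ u₁ w₂ v₂ u₂

open Bicategory

theorem eqToHom_heq_eqToHom {C : Type u} [Category.{v} C] {a b a' b' : C} (h : a = b)
    (h' : a' = b') (e : a = a') : eqToHom h ≍ eqToHom h' := by
  subst h h' e; rfl

/-! ### 2-adjunctions, slices and parametric right 2-adjoints -/

section Adj

variable {K : Type u} [Bicategory.{w, v} K] {L : Type u₁} [Bicategory.{w₁, v₁} L]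

/-- A 2-adjunction `F ⊣ G`: 2-natural unit and counit satisfying the triangle identities. -/
structure TwoAdjunction (F : StrictPseudofunctor L K) (G : StrictPseudofunctor K L) where
  unit : TwoNatTrans (StrictPseudofunctor.id L) (F.comp G)
  counit : TwoNatTrans (G.comp F) (StrictPseudofunctor.id K)
  left_triangle (X : L) : F.map (unit.app X) ≫ counit.app (F.obj X) = 𝟙 (F.obj X)
  right_triangle (A : K) : unit.app (G.obj A) ≫ G.map (counit.app A) = 𝟙 (G.obj A)

/-- The 2-functor `G` has a left 2-adjoint. -/
def IsRightTwoAdjoint (G : StrictPseudofunctor K L) : Prop :=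
  ∃ F : StrictPseudofunctor L K, Nonempty (TwoAdjunction F G)

/-- `T` is a terminal object of the 2-category `K`: each hom-category `K(A, T)` is isomorphic to
the terminal category. -/
structure IsTwoTerminal (T : K) where
  from_ (A : K) : A ⟶ T
  hom_ext {A : K} (f g : A ⟶ T) : f = g
  hom₂_ext {A : K} {f g : A ⟶ T} (α β : f ⟶ g) : α = β

/-- An object of the strict slice 2-category `K / X`. -/
structure Slice (X : K) where
  obj : K
  hom : obj ⟶ X

namespace Slice

variable {X : K}

/-- A 1-cell of the strict slice: a strictly commuting triangle. -/
@[ext]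
structure Hom (P Q : Slice X) where
  left : P.obj ⟶ Q.obj
  w : left ≫ Q.hom = P.hom

variable [Strict K]

instance : CategoryStruct (Slice X) where
  Hom := Hom
  id P := ⟨𝟙 P.obj, Strict.id_comp _⟩
  comp f g := ⟨f.left ≫ g.left, by rw [Strict.assoc, g.w, f.w]⟩

/-- A 2-cell of the strict slice: a 2-cell whose whiskering with the projection to `X` is an
identity. -/
@[ext]
structure Hom₂ {P Q : Slice X} (f g : P ⟶ Q) where
  left : f.left ⟶ g.left
  w : left ▷ Q.hom = eqToHom (f.w.trans g.w.symm)

instance (P Q : Slice X) : Category (P ⟶ Q) where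
  Hom f g := Hom₂ f g
  id f := ⟨𝟙 f.left, by simp⟩
  comp α β := ⟨α.left ≫ β.left, by simp [α.w, β.w]⟩

@[simp] theorem id_left (P : Slice X) : (𝟙 P : P ⟶ P).left = 𝟙 P.obj := rfl
@[simp] theorem comp_left {P Q R : Slice X} (f : P ⟶ Q) (g : Q ⟶ R) :
    (f ≫ g).left = f.left ≫ g.left := rfl
@[simp] theorem id_left₂ {P Q : Slice X} (f : P ⟶ Q) : (𝟙 f : f ⟶ f).left = 𝟙 f.left := rfl
@[simp] theorem comp_left₂ {P Q : Slice X} {f g h : P ⟶ Q} (α : f ⟶ g) (β : g ⟶ h) :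
    (α ≫ β).left = α.left ≫ β.left := rfl

@[ext] theorem hom_ext {P Q : Slice X} {f g : P ⟶ Q} (h : f.left = g.left) : f = g := Hom.ext h
@[ext] theorem hom₂_ext {P Q : Slice X} {f g : P ⟶ Q} {α β : f ⟶ g} (h : α.left = β.left) :
    α = β := Hom₂.ext h

theorem hom₂_heq {P Q : Slice X} {f g f' g' : P ⟶ Q} (hf : f = f') (hg : g = g')
    {α : f ⟶ g} {β : f' ⟶ g'} (h : α.left ≍ β.left) : α ≍ β := by
  subst hf hg
  exact heq_of_eq (hom₂_ext (eq_of_heq h))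

theorem id_comp' {P Q : Slice X} (f : P ⟶ Q) : 𝟙 P ≫ f = f := hom_ext (Strict.id_comp _)
theorem comp_id' {P Q : Slice X} (f : P ⟶ Q) : f ≫ 𝟙 Q = f := hom_ext (Strict.comp_id _)
theorem assoc' {P Q R S : Slice X} (f : P ⟶ Q) (g : Q ⟶ R) (h : R ⟶ S) :
    (f ≫ g) ≫ h = f ≫ g ≫ h := hom_ext (Strict.assoc _ _ _)

/-- The strict slice 2-category. -/
@[reducible]
def core : TwoCatCore (Slice X) where
  id_comp := id_comp'
  comp_id := comp_id'
  assoc := assoc'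
  wl {P Q R} f g h η := ⟨f.left ◁ η.left, by
    apply eq_of_heq
    refine (wl_wr_heq _ _ _).trans ?_
    rw [η.w, whiskerLeft_eqToHom]
    exact eqToHom_heq_eqToHom _ _ (Strict.assoc _ _ _).symm⟩
  wr {P Q R f g} η h := ⟨η.left ▷ h.left, by
    apply eq_of_heq
    refine (wr_comp_heq _ _ _).symm.trans ?_
    refine (wr_heq h.w rfl rfl HEq.rfl).trans ?_
    rw [η.w]
    exact eqToHom_heq_eqToHom _ _ (f.w.trans (f ≫ h).w.symm)⟩
  wl_id _ _ := hom₂_ext (by simp)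
  wl_comp _ _ _ _ _ _ := hom₂_ext (by simp)
  id_wr _ _ := hom₂_ext (by simp)
  comp_wr _ _ _ := hom₂_ext (by simp)
  exchange _ _ := hom₂_ext (whisker_exchange _ _)
  id_wl _ := hom₂_heq (id_comp' _) (id_comp' _) (id_wl_heq _)
  wr_id _ := hom₂_heq (comp_id' _) (comp_id' _) (wr_id_heq _)
  comp_wl _ _ _ _ _ := hom₂_heq (assoc' _ _ _) (assoc' _ _ _) (comp_wl_heq _ _ _)
  wr_comp _ _ _ := hom₂_heq (assoc' _ _ _).symm (assoc' _ _ _).symm (wr_comp_heq _ _ _)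
  wl_wr _ _ _ _ _ := hom₂_heq (assoc' _ _ _) (assoc' _ _ _) (wl_wr_heq _ _ _)

instance : Bicategory (Slice X) := core.bicategory

instance : Strict (Slice X) := core.strict

end Slice

variable [Strict K] [Strict L]

/-- Construct a 2-functor from heterogeneous preservation of whiskering. -/
@[reducible]
def mkTwoFunctor (obj : K → L) (map : ∀ {a b : K}, (a ⟶ b) → (obj a ⟶ obj b))
    (map₂ : ∀ {a b : K} {f g : a ⟶ b}, (f ⟶ g) → (map f ⟶ map g))
    (map_id : ∀ a, map (𝟙 a) = 𝟙 (obj a))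
    (map_comp : ∀ {a b c : K} (f : a ⟶ b) (g : b ⟶ c), map (f ≫ g) = map f ≫ map g)
    (map₂_id : ∀ {a b : K} (f : a ⟶ b), map₂ (𝟙 f) = 𝟙 (map f))
    (map₂_comp : ∀ {a b : K} {f g h : a ⟶ b} (η : f ⟶ g) (θ : g ⟶ h),
      map₂ (η ≫ θ) = map₂ η ≫ map₂ θ)
    (map₂_wl : ∀ {a b c : K} (f : a ⟶ b) {g h : b ⟶ c} (η : g ⟶ h),
      map₂ (f ◁ η) ≍ map f ◁ map₂ η)
    (map₂_wr : ∀ {a b c : K} {f g : a ⟶ b} (η : f ⟶ g) (h : b ⟶ c),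
      map₂ (η ▷ h) ≍ map₂ η ▷ map h) : StrictPseudofunctor K L :=
  StrictPseudofunctor.mk''
    { obj := obj
      map := map
      map₂ := map₂
      map₂_id := map₂_id
      map₂_comp := map₂_comp
      map_id := map_id
      map_comp := map_comp
      map₂_whisker_left := fun f _ _ η => by simpa [← heq_eq_eq] using map₂_wl f η
      map₂_whisker_right := fun η h => by simpa [← heq_eq_eq] using map₂_wr η h }

/-- For `R : K → L` and a terminal object `T` of `K`, the 2-functor `R₁ : K → L / R T` sending `A`
to `R A → R T`. -/
def toSlice {T : K} (hT : IsTwoTerminal T) (R : StrictPseudofunctor K L) :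
    StrictPseudofunctor K (Slice (R.obj T)) :=
  mkTwoFunctor (fun A => ⟨R.obj A, R.map (hT.from_ A)⟩)
    (fun {A B} f => ⟨R.map f, by rw [← R.map_comp, hT.hom_ext (f ≫ hT.from_ B)]⟩)
    (fun {A B f g} α => ⟨R.map₂ α, by
      apply eq_of_heq
      refine (map₂_wr_heq R α (hT.from_ B)).symm.trans ?_
      rw [hT.hom₂_ext (α ▷ hT.from_ B) (eqToHom (hT.hom_ext _ _)),
        PrelaxFunctor.map₂_eqToHom]
      exact eqToHom_heq_eqToHom _ _ (R.map_comp _ _)⟩)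
    (fun a => Slice.hom_ext (R.map_id a))
    (fun f g => Slice.hom_ext (R.map_comp f g))
    (fun f => Slice.hom₂_ext (R.map₂_id f))
    (fun η θ => Slice.hom₂_ext (R.map₂_comp η θ))
    (fun f _ _ η => Slice.hom₂_heq (Slice.hom_ext (R.map_comp _ _))
      (Slice.hom_ext (R.map_comp _ _)) (map₂_wl_heq R f η))
    (fun η h => Slice.hom₂_heq (Slice.hom_ext (R.map_comp _ _))
      (Slice.hom_ext (R.map_comp _ _)) (map₂_wr_heq R η h))

/-- `R` is a parametric right 2-adjoint: `R₁ : K → L / R T` has a left 2-adjoint. -/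
def IsParametricRightTwoAdjoint {T : K} (hT : IsTwoTerminal T) (R : StrictPseudofunctor K L) :
    Prop :=
  IsRightTwoAdjoint (toSlice hT R)

end Adj

/-! ### Split fibrations and familial 2-functors -/

/-- A split fibration of categories: a functorial choice of cartesian lifts. -/
structure SplitFibration {𝒳 : Type u} [Category.{v} 𝒳] {𝒮 : Type u₁} [Category.{v₁} 𝒮]
    (p : 𝒳 ⥤ 𝒮) where
  obj {e : 𝒳} {b : 𝒮} (β : b ⟶ p.obj e) : 𝒳
  hom {e : 𝒳} {b : 𝒮} (β : b ⟶ p.obj e) : obj β ⟶ e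
  cartesian {e : 𝒳} {b : 𝒮} (β : b ⟶ p.obj e) : p.IsStronglyCartesian β (hom β)
  obj_id (e : 𝒳) : obj (𝟙 (p.obj e)) = e
  hom_id (e : 𝒳) : hom (𝟙 (p.obj e)) = eqToHom (obj_id e)
  obj_comp {e : 𝒳} {b c : 𝒮} (β : b ⟶ p.obj e) (γ : c ⟶ b) :
    obj (γ ≫ β) =
      obj (γ ≫ eqToHom (haveI := cartesian β; IsHomLift.domain_eq p β (hom β)).symm)
  hom_comp {e : 𝒳} {b c : 𝒮} (β : b ⟶ p.obj e) (γ : c ⟶ b) :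
    hom (γ ≫ β) = eqToHom (obj_comp β γ) ≫
      hom (γ ≫ eqToHom (haveI := cartesian β; IsHomLift.domain_eq p β (hom β)).symm) ≫ hom β

section Preserve

variable {𝒳 : Type u} [Category.{v} 𝒳] {𝒮 : Type u₁} [Category.{v₁} 𝒮]
  {𝒳' : Type u₂} [Category.{v₂} 𝒳'] {𝒯 : Type w} [Category.{w₁} 𝒯]

/-- The functor `H` over `G` preserves the chosen cartesian lifts. -/
def PreservesLifts {p : 𝒳 ⥤ 𝒮} (S : SplitFibration p) {p' : 𝒳' ⥤ 𝒯} (S' : SplitFibration p')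
    (H : 𝒳 ⥤ 𝒳') (G : 𝒮 ⥤ 𝒯) (hc : ∀ e, G.obj (p.obj e) = p'.obj (H.obj e)) : Prop :=
  ∀ {e : 𝒳} {b : 𝒮} (β : b ⟶ p.obj e),
    S'.obj (G.map β ≫ eqToHom (hc e)) = H.obj (S.obj β) ∧
    S'.hom (G.map β ≫ eqToHom (hc e)) ≍ H.map (S.hom β)

theorem SplitFibration.congr {p : 𝒳 ⥤ 𝒮} (S : SplitFibration p) {e e' : 𝒳} {b : 𝒮}
    {β : b ⟶ p.obj e} {β' : b ⟶ p.obj e'} (he : e = e') (h : β ≍ β') :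
    S.obj β = S.obj β' ∧ S.hom β ≍ S.hom β' := by
  subst he h; exact ⟨rfl, HEq.rfl⟩

theorem functor_map_heq (H : 𝒳 ⥤ 𝒳') {a b a' b' : 𝒳} (ha : a = a') (hb : b = b') {φ : a ⟶ b}
    {φ' : a' ⟶ b'} (h : φ ≍ φ') : H.map φ ≍ H.map φ' := by
  subst ha hb h; rfl

theorem PreservesLifts.of_id {p : 𝒳 ⥤ 𝒮} {S : SplitFibration p} {H : 𝒳 ⥤ 𝒳}
    (hc : ∀ e, (𝟭 𝒮).obj (p.obj e) = p.obj (H.obj e)) (h₀ : ∀ e, H.obj e = e)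
    (h₁ : ∀ {e e' : 𝒳} (φ : e ⟶ e'), H.map φ ≍ φ) : PreservesLifts S S H (𝟭 𝒮) hc := by
  intro e b β
  obtain ⟨h, h'⟩ := S.congr (β := (𝟭 𝒮).map β ≫ eqToHom (hc e)) (β' := β) (h₀ e)
    (comp_eqToHom_heq β (hc e))
  exact ⟨h.trans (h₀ _).symm, h'.trans (h₁ _).symm⟩

theorem PreservesLifts.comp {𝒳'' : Type u₂} [Category.{v₂} 𝒳''] {p : 𝒳 ⥤ 𝒮} {p' : 𝒳' ⥤ 𝒮}
    {p'' : 𝒳'' ⥤ 𝒮} {S : SplitFibration p} {S' : SplitFibration p'} {S'' : SplitFibration p''}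
    {H : 𝒳 ⥤ 𝒳'} {H' : 𝒳' ⥤ 𝒳''} {H'' : 𝒳 ⥤ 𝒳''} {hc hc'}
    (h : PreservesLifts S S' H (𝟭 𝒮) hc) (h' : PreservesLifts S' S'' H' (𝟭 𝒮) hc')
    (hc'' : ∀ e, (𝟭 𝒮).obj (p.obj e) = p''.obj (H''.obj e))
    (h₀ : ∀ e, H''.obj e = H'.obj (H.obj e))
    (h₁ : ∀ {e e' : 𝒳} (φ : e ⟶ e'), H''.map φ ≍ H'.map (H.map φ)) :
    PreservesLifts S S'' H'' (𝟭 𝒮) hc'' := by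
  intro e b β
  obtain ⟨a, a'⟩ := h β
  obtain ⟨c, c'⟩ := h' ((𝟭 𝒮).map β ≫ eqToHom (hc e))
  obtain ⟨d, d'⟩ := S''.congr (β := (𝟭 𝒮).map β ≫ eqToHom (hc'' e))
    (β' := (𝟭 𝒮).map ((𝟭 𝒮).map β ≫ eqToHom (hc e)) ≫ eqToHom (hc' _)) (h₀ e) (by
      simp only [Functor.id_map, Functor.id_obj, Category.assoc, eqToHom_trans]
      exact (comp_eqToHom_heq _ _).trans (comp_eqToHom_heq _ _).symm)
  exact ⟨d.trans (c.trans ((congrArg H'.obj a).trans (h₀ _).symm)),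
    d'.trans (c'.trans ((functor_map_heq H' a rfl a').trans (h₁ _).symm))⟩

end Preserve

section Spl

variable {K : Type u} [Bicategory.{w, v} K] [Strict K]

/-- The structure of a split fibration on a 1-cell `p : E ⟶ B` of a 2-category: each functor
`K(X, p)` is a split fibration, and precomposition with any `f : Y ⟶ X` preserves the chosen
cartesian lifts. -/
structure SplitFib {E B : K} (p : E ⟶ B) where
  fib (X : K) : SplitFibration (postcomp X p)
  stable {X Y : K} (f : Y ⟶ X) :
    PreservesLifts (fib X) (fib Y) (precomp E f) (precomp B f) (fun e => (Strict.assoc f e p).symm)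

/-- An object of `Spl(B)`: a split fibration with codomain `B`. -/
structure Spl (B : K) where
  slice : Slice B
  split : SplitFib slice.hom

namespace Spl

variable {B : K}

/-- The 1-cell `f` of the slice preserves the chosen cartesian lifts. -/
def Preserves (P Q : Spl B) (f : P.slice ⟶ Q.slice) : Prop :=
  ∀ X : K, PreservesLifts (P.split.fib X) (Q.split.fib X) (postcomp X f.left) (𝟭 (X ⟶ B))
    (fun e => show e ≫ P.slice.hom = (e ≫ f.left) ≫ Q.slice.hom by rw [Strict.assoc, f.w])

/-- A 1-cell of `Spl(B)`: a 1-cell over `B` preserving the chosen cartesian lifts. -/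
@[ext]
structure Hom (P Q : Spl B) where
  hom : P.slice ⟶ Q.slice
  preserves : Preserves P Q hom

instance : CategoryStruct (Spl B) where
  Hom := Hom
  id P := ⟨𝟙 P.slice, fun X => PreservesLifts.of_id _ (fun e => Strict.comp_id e)
    (fun φ => wr_id_heq φ)⟩
  comp {P Q R} f g := ⟨f.hom ≫ g.hom, fun X => PreservesLifts.comp (f.preserves X) (g.preserves X) _
    (fun e => (Strict.assoc e f.hom.left g.hom.left).symm)
    (fun φ => wr_comp_heq φ f.hom.left g.hom.left)⟩

instance (P Q : Spl B) : Category (P ⟶ Q) where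
  Hom f g := f.hom ⟶ g.hom
  id f := 𝟙 f.hom
  comp α β := α ≫ β
  id_comp {f g} α := Category.id_comp (X := f.hom) (Y := g.hom) α
  comp_id {f g} α := Category.comp_id (X := f.hom) (Y := g.hom) α
  assoc {f g h i} α β γ := Category.assoc (W := f.hom) (X := g.hom) (Y := h.hom) (Z := i.hom) α β γ

/-- The 2-category `Spl(B)` of split fibrations over `B`, with 2-cells as in the slice. -/
@[reducible]
def core : TwoCatCore (Spl B) where
  id_comp {P Q} f := Hom.ext (Strict.id_comp (Hom.hom f))
  comp_id {P Q} f := Hom.ext (Strict.comp_id (Hom.hom f))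
  assoc {P Q R S} f g h := Hom.ext (Strict.assoc (Hom.hom f) (Hom.hom g) (Hom.hom h))
  wl {P Q R} f g h η := whiskerLeft (Hom.hom f) (g := Hom.hom g) (h := Hom.hom h) η
  wr {P Q R f g} η h := whiskerRight (f := Hom.hom f) (g := Hom.hom g) η (Hom.hom h)
  wl_id {P Q R} f g := whiskerLeft_id (Hom.hom f) (Hom.hom g)
  wl_comp {P Q R} f {g h i} η θ :=
    whiskerLeft_comp (Hom.hom f) (g := Hom.hom g) (h := Hom.hom h) (i := Hom.hom i) η θ
  id_wr {P Q R} f g := id_whiskerRight (Hom.hom f) (Hom.hom g)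
  comp_wr {P Q R} {f g h} η θ i :=
    comp_whiskerRight (f := Hom.hom f) (g := Hom.hom g) (h := Hom.hom h) η θ (Hom.hom i)
  exchange {P Q R} {f g h i} η θ :=
    whisker_exchange (f := Hom.hom f) (g := Hom.hom g) (h := Hom.hom h) (i := Hom.hom i) η θ
  id_wl {P Q f g} η := id_wl_heq (f := Hom.hom f) (g := Hom.hom g) η
  wr_id {P Q f g} η := wr_id_heq (f := Hom.hom f) (g := Hom.hom g) η
  comp_wl {P Q R S} f g {h h'} η :=
    comp_wl_heq (Hom.hom f) (Hom.hom g) (h := Hom.hom h) (h' := Hom.hom h') η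
  wr_comp {P Q R S} {f f'} η g h :=
    wr_comp_heq (f := Hom.hom f) (f' := Hom.hom f') η (Hom.hom g) (Hom.hom h)
  wl_wr {P Q R S} f {g g'} η h :=
    wl_wr_heq (Hom.hom f) (g := Hom.hom g) (g' := Hom.hom g') η (Hom.hom h)

instance : Bicategory (Spl B) := core.bicategory

instance : Strict (Spl B) := core.strict

/-- The forgetful 2-functor `U_B : Spl(B) → K / B`. -/
def forget (B : K) : StrictPseudofunctor (Spl B) (Slice B) :=
  mkTwoFunctor (fun P => P.slice) (fun f => f.hom) (fun η => η) (fun _ => rfl) (fun _ _ => rfl)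
    (fun _ => rfl) (fun _ _ => rfl) (fun _ _ _ _ => HEq.rfl) (fun _ _ => HEq.rfl)

end Spl

variable {L : Type u₁} [Bicategory.{w₁, v₁} L] [Strict L]

/-- A 2-functor `R : K → L` out of a 2-category with a terminal object `T` is familial if it is a
parametric right 2-adjoint and `R₁ : K → L / R T` factorizes through the forgetful 2-functor
`Spl(R T) → L / R T`. -/
def IsFamilial {T : K} (hT : IsTwoTerminal T) (R : StrictPseudofunctor K L) : Prop :=
  IsParametricRightTwoAdjoint hT R ∧
    ∃ Rbar : StrictPseudofunctor K (Spl (R.obj T)),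
      Rbar.comp (Spl.forget (R.obj T)) = toSlice hT R

end Spl

end Familial
end VEnr
namespace VEnr
section VDC
universe w
open Bicategory

/-! ### Virtual double categories -/

/-- Finite composable strings of horizontal morphisms. -/
inductive HPath {O : Type w} (H : O → O → Type w) : O → O → Type w
  | nil (a : O) : HPath H a a
  | cons {a b c : O} (p : HPath H a b) (Γ : H b c) : HPath H a c

namespace HPath

variable {O : Type w} {H : O → O → Type w}

/-- Concatenation of strings. -/
def comp {a b : O} (p : HPath H a b) : ∀ {c : O}, HPath H b c → HPath H a c
  | _, nil _ => p
  | _, cons q Γ => cons (comp p q) Γ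

/-- The string consisting of one horizontal morphism. -/
abbrev single {a b : O} (Γ : H a b) : HPath H a b := cons (nil a) Γ

theorem nil_comp {a b : O} (p : HPath H a b) : (nil a).comp p = p := by
  induction p with
  | nil => rfl
  | cons p Γ ih => simp [comp, ih]

theorem comp_assoc {a b c d : O} (p : HPath H a b) (q : HPath H b c) (r : HPath H c d) :
    (p.comp q).comp r = p.comp (q.comp r) := by
  induction r with
  | nil => rfl
  | cons r Γ ih => simp [comp, ih]

end HPath

/-- The underlying data of a virtual double category: the vertical category, the horizontal
morphisms, and the multicells with a given boundary. All of them lie in `Type w`. -/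
structure VDGraph : Type (w + 1) where
  Obj : Type w
  [cat : Category.{w} Obj]
  HMor : Obj → Obj → Type w
  Cell : ∀ {a a' b b' : Obj}, HPath HMor a a' → (a ⟶ b) → (a' ⟶ b') → HMor b b' → Type w

attribute [instance] VDGraph.cat

namespace VDGraph

/-- Horizontally composable strings of multicells `θ₁, …, θₘ`. The upper boundary is the
concatenation of the upper boundaries of the `θᵢ` and the lower boundary consists of their lower
boundaries. For `m = 0` such a string is a vertical morphism. -/
inductive CellPath (A : VDGraph.{w}) : ∀ {a a' b b' : A.Obj},
    HPath A.HMor a a' → (a ⟶ b) → (a' ⟶ b') → HPath A.HMor b b' → Type w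
  | nil {a b : A.Obj} (u : a ⟶ b) : CellPath A (.nil a) u u (.nil b)
  | cons {a a' a'' b b' b'' : A.Obj} {p : HPath A.HMor a a'} {u : a ⟶ b} {u' : a' ⟶ b'}
      {q : HPath A.HMor b b'} (Θ : CellPath A p u u' q) {r : HPath A.HMor a' a''}
      {u'' : a'' ⟶ b''} {Ω : A.HMor b' b''} (θ : A.Cell r u' u'' Ω)
      {P : HPath A.HMor a a''} (h : p.comp r = P) : CellPath A P u u'' (q.cons Ω)

variable {A : VDGraph.{w}}

namespace CellPath

/-- Horizontal concatenation of strings of multicells. -/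
def append {a a' b b' : A.Obj} {p : HPath A.HMor a a'} {u : a ⟶ b} {u' : a' ⟶ b'}
    {q : HPath A.HMor b b'} (Θ : A.CellPath p u u' q) :
    ∀ {a'' b'' : A.Obj} {p' : HPath A.HMor a' a''} {u'' : a'' ⟶ b''} {q' : HPath A.HMor b' b''},
      A.CellPath p' u' u'' q' → A.CellPath (p.comp p') u u'' (q.comp q')
  | _, _, _, _, _, nil _ => Θ
  | _, _, _, _, _, cons Θ' θ h => cons (append Θ Θ') θ (by rw [← h, HPath.comp_assoc])

/-- The string consisting of one multicell. -/
abbrev single {a a' b b' : A.Obj} {p : HPath A.HMor a a'} {u : a ⟶ b} {u' : a' ⟶ b'}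
    {Ω : A.HMor b b'} (θ : A.Cell p u u' Ω) : A.CellPath p u u' (.single Ω) :=
  cons (nil u) θ (HPath.nil_comp p)

/-- The string consisting of two multicells. -/
abbrev pair {a a' a'' b b' b'' : A.Obj} {p : HPath A.HMor a a'} {u : a ⟶ b} {u' : a' ⟶ b'}
    {Ω : A.HMor b b'} (θ : A.Cell p u u' Ω) {p' : HPath A.HMor a' a''} {u'' : a'' ⟶ b''}
    {Ω' : A.HMor b' b''} (θ' : A.Cell p' u' u'' Ω') {P : HPath A.HMor a a''}
    (h : p.comp p' = P) : A.CellPath P u u'' ((HPath.single Ω).cons Ω') :=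
  cons (single θ) θ' h

end CellPath

/-- Transport of a multicell along equalities of the upper and vertical boundaries. -/
def castC {a a' b b' : A.Obj} {p p₁ : HPath A.HMor a a'} {u u₁ : a ⟶ b} {u' u₁' : a' ⟶ b'}
    {Ω : A.HMor b b'} (hp : p = p₁) (hu : u = u₁) (hu' : u' = u₁') (θ : A.Cell p u u' Ω) :
    A.Cell p₁ u₁ u₁' Ω :=
  cast (by rw [hp, hu, hu']) θ

theorem castC_heq {a a' b b' : A.Obj} {p p₁ : HPath A.HMor a a'} {u u₁ : a ⟶ b}
    {u' u₁' : a' ⟶ b'} {Ω : A.HMor b b'} (hp : p = p₁) (hu : u = u₁) (hu' : u' = u₁')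
    (θ : A.Cell p u u' Ω) : castC hp hu hu' θ ≍ θ :=
  cast_heq _ _

theorem CellPath.cons_heq {a a' a'' b b' b'' : A.Obj} {p p₁ : HPath A.HMor a a'} {u u₁ : a ⟶ b}
    {u' u₁' : a' ⟶ b'} {q q₁ : HPath A.HMor b b'} {Θ : A.CellPath p u u' q}
    {Θ₁ : A.CellPath p₁ u₁ u₁' q₁} {r r₁ : HPath A.HMor a' a''} {u'' u₁'' : a'' ⟶ b''}
    {Ω Ω₁ : A.HMor b' b''} {θ : A.Cell r u' u'' Ω} {θ₁ : A.Cell r₁ u₁' u₁'' Ω₁}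
    {P P₁ : HPath A.HMor a a''} (h : p.comp r = P) (h₁ : p₁.comp r₁ = P₁)
    (ep : p = p₁) (eu : u = u₁) (eu' : u' = u₁') (eq : q = q₁) (er : r = r₁) (eu'' : u'' = u₁'')
    (eΩ : Ω = Ω₁) (eΘ : Θ ≍ Θ₁) (eθ : θ ≍ θ₁) : cons Θ θ h ≍ cons Θ₁ θ₁ h₁ := by
  subst ep eu eu' eq er eu'' eΩ eΘ eθ h h₁; rfl

theorem CellPath.single_heq {a a' b b' : A.Obj} {p p₁ : HPath A.HMor a a'} {u u₁ : a ⟶ b}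
    {u' u₁' : a' ⟶ b'} {Ω Ω₁ : A.HMor b b'} {θ : A.Cell p u u' Ω} {θ₁ : A.Cell p₁ u₁ u₁' Ω₁}
    (ep : p = p₁) (eu : u = u₁) (eu' : u' = u₁') (eΩ : Ω = Ω₁) (eθ : θ ≍ θ₁) :
    single θ ≍ single θ₁ := by
  subst ep eu eu' eΩ eθ; rfl

theorem CellPath.nil_append {a b : A.Obj} (u : a ⟶ b) {a' b' : A.Obj} {p : HPath A.HMor a a'}
    {u' : a' ⟶ b'} {q : HPath A.HMor b b'} (Θ : A.CellPath p u u' q) :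
    (nil u).append Θ ≍ Θ := by
  induction Θ with
  | nil u => rfl
  | cons Θ θ h ih =>
    exact cons_heq _ h (HPath.nil_comp _) rfl rfl (HPath.nil_comp _) rfl rfl rfl ih HEq.rfl

end VDGraph

/-- Identity multicells and composition of multicells on a `VDGraph`. The composite
`κ ∘ (θ₁, …, θₘ)` has vertical boundary `u ≫ v` and `u' ≫ v'`; the vertical morphisms `x`, `x'`
equal to these are extra arguments of `comp`, so that the axioms need no transport. -/
structure VDPre : Type (w + 1) extends VDGraph.{w} where
  idCell {a b : Obj} (Γ : HMor a b) : Cell (.single Γ) (𝟙 a) (𝟙 b) Γ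
  comp {a a' b b' c c' : Obj} {p : HPath HMor a a'} {u : a ⟶ b} {u' : a' ⟶ b'}
    {q : HPath HMor b b'} {v : b ⟶ c} {v' : b' ⟶ c'} {Λ : HMor c c'} {x : a ⟶ c} {x' : a' ⟶ c'}
    (κ : Cell q v v' Λ) (Θ : toVDGraph.CellPath p u u' q) (hx : u ≫ v = x) (hx' : u' ≫ v' = x') :
    Cell p x x' Λ

namespace VDPre

/-- The string of identity multicells on a string of horizontal morphisms. -/
def idPath (A : VDPre.{w}) {a : A.Obj} :
    ∀ {b : A.Obj} (q : HPath A.HMor a b), A.CellPath q (𝟙 a) (𝟙 b) q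
  | _, .nil _ => .nil (𝟙 a)
  | _, .cons q Γ => .cons (idPath A q) (A.idCell Γ) rfl

/-- `CompRel Θ Φ Ψ` says that, when `Θ` is the string `(θ₁, …, θₘ)` and `Φ` is the concatenation
of strings `Φ₁, …, Φₘ` such that `θᵢ ∘ Φᵢ` is defined, `Ψ` is the string
`(θ₁ ∘ Φ₁, …, θₘ ∘ Φₘ)`. -/
inductive CompRel (A : VDPre.{w}) : ∀ {a a' b b' c c' : A.Obj} {p : HPath A.HMor a a'}
    {u : a ⟶ b} {u' : a' ⟶ b'} {q : HPath A.HMor b b'} {v : b ⟶ c} {v' : b' ⟶ c'}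
    {s : HPath A.HMor c c'} {x : a ⟶ c} {x' : a' ⟶ c'},
    A.CellPath q v v' s → A.CellPath p u u' q → A.CellPath p x x' s → Prop
  | nil {a b c : A.Obj} (u : a ⟶ b) (v : b ⟶ c) :
      CompRel A (.nil v) (.nil u) (.nil (u ≫ v))
  | cons {a a' a'' b b' b'' c c' c'' : A.Obj} {p : HPath A.HMor a a'} {u : a ⟶ b} {u' : a' ⟶ b'}
      {q : HPath A.HMor b b'} {v : b ⟶ c} {v' : b' ⟶ c'} {s : HPath A.HMor c c'}
      {x : a ⟶ c} {x' : a' ⟶ c'} {Θ : A.CellPath q v v' s} {Φ : A.CellPath p u u' q}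
      {Ψ : A.CellPath p x x' s} (H : CompRel A Θ Φ Ψ)
      {r : HPath A.HMor b' b''} {v'' : b'' ⟶ c''} {Ω : A.HMor c' c''} (θ : A.Cell r v' v'' Ω)
      {t : HPath A.HMor a' a''} {u'' : a'' ⟶ b''} (Φ' : A.CellPath t u' u'' r)
      {x'' : a'' ⟶ c''} (hx' : u' ≫ v' = x') (hx'' : u'' ≫ v'' = x'') :
      CompRel A (.cons Θ θ rfl) (Φ.append Φ') (.cons Ψ (A.comp θ Φ' hx' hx'') rfl)

end VDPre

/-- A virtual double category. -/
structure VDC : Type (w + 1) extends VDPre.{w} where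
  id_comp' {a a' b b' : Obj} {p : HPath HMor a a'} {u : a ⟶ b} {u' : a' ⟶ b'} {Ω : HMor b b'}
    (θ : Cell p u u' Ω) :
    comp (idCell Ω) (.single θ) (Category.comp_id u) (Category.comp_id u') = θ
  comp_id' {b b' c c' : Obj} {q : HPath HMor b b'} {v : b ⟶ c} {v' : b' ⟶ c'} {Λ : HMor c c'}
    (κ : Cell q v v' Λ) :
    comp κ (toVDPre.idPath q) (Category.id_comp v) (Category.id_comp v') = κ
  assoc' {a a' b b' c c' d d' : Obj} {p : HPath HMor a a'} {u : a ⟶ b} {u' : a' ⟶ b'}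
    {q : HPath HMor b b'} {v : b ⟶ c} {v' : b' ⟶ c'} {s : HPath HMor c c'} {x : a ⟶ c}
    {x' : a' ⟶ c'} {k : c ⟶ d} {k' : c' ⟶ d'} {Λ : HMor d d'} {y : b ⟶ d} {y' : b' ⟶ d'}
    {z : a ⟶ d} {z' : a' ⟶ d'}
    (κ : Cell s k k' Λ) {Θ : toVDGraph.CellPath q v v' s} {Φ : toVDGraph.CellPath p u u' q}
    {Ψ : toVDGraph.CellPath p x x' s} (H : toVDPre.CompRel Θ Φ Ψ)
    (hy : v ≫ k = y) (hy' : v' ≫ k' = y') (hz : u ≫ y = z) (hz' : u' ≫ y' = z')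
    (hx : x ≫ k = z) (hx' : x' ≫ k' = z') :
    comp (comp κ Θ hy hy') Φ hz hz' = comp κ Ψ hx hx'

namespace VDC

theorem comp_heq (A : VDC.{w}) {a a' b b' c c' : A.Obj} {p p₁ : HPath A.HMor a a'}
    {u u₁ : a ⟶ b} {u' u₁' : a' ⟶ b'} {q q₁ : HPath A.HMor b b'} {v v₁ : b ⟶ c} {v' v₁' : b' ⟶ c'}
    {Λ Λ₁ : A.HMor c c'} {x x₁ : a ⟶ c} {x' x₁' : a' ⟶ c'} {κ : A.Cell q v v' Λ}
    {κ₁ : A.Cell q₁ v₁ v₁' Λ₁} {Θ : A.CellPath p u u' q} {Θ₁ : A.CellPath p₁ u₁ u₁' q₁}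
    (hx : u ≫ v = x) (hx' : u' ≫ v' = x') (hx₁ : u₁ ≫ v₁ = x₁) (hx₁' : u₁' ≫ v₁' = x₁')
    (ep : p = p₁) (eu : u = u₁) (eu' : u' = u₁') (eq : q = q₁) (ev : v = v₁) (ev' : v' = v₁')
    (eΛ : Λ = Λ₁) (eκ : κ ≍ κ₁) (eΘ : Θ ≍ Θ₁) :
    A.comp κ Θ hx hx' ≍ A.comp κ₁ Θ₁ hx₁ hx₁' := by
  subst ep eu eu' eq ev ev' eΛ eκ eΘ hx hx' hx₁ hx₁'; rfl

theorem idCell_heq (A : VDC.{w}) {a b : A.Obj} {Γ Γ₁ : A.HMor a b} (h : Γ = Γ₁) :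
    A.idCell Γ ≍ A.idCell Γ₁ := by subst h; rfl

/-- Associativity in the case of a string of length one in the middle. -/
theorem comp_comp_single (A : VDC.{w}) {a a' b b' c c' d d' : A.Obj} {p : HPath A.HMor a a'}
    {u : a ⟶ b} {u' : a' ⟶ b'} {q : HPath A.HMor b b'} {v : b ⟶ c} {v' : b' ⟶ c'}
    {Ω : A.HMor c c'} {k : c ⟶ d} {k' : c' ⟶ d'} {Λ : A.HMor d d'} {x : a ⟶ c} {x' : a' ⟶ c'}
    {y : b ⟶ d} {y' : b' ⟶ d'} {z : a ⟶ d} {z' : a' ⟶ d'}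
    (κ : A.Cell (.single Ω) k k' Λ) (θ : A.Cell q v v' Ω) (Φ : A.CellPath p u u' q)
    (hy : v ≫ k = y) (hy' : v' ≫ k' = y') (hz : u ≫ y = z) (hz' : u' ≫ y' = z')
    (hx : u ≫ v = x) (hx' : u' ≫ v' = x') (hxk : x ≫ k = z) (hxk' : x' ≫ k' = z') :
    A.comp (A.comp κ (.single θ) hy hy') Φ hz hz' =
      A.comp κ (.single (A.comp θ Φ hx hx')) hxk hxk' := by
  subst hx
  have h := A.assoc' κ (.cons (.nil u v) θ Φ rfl hx') hy hy' hz hz' hxk hxk'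
  refine eq_of_heq (HEq.trans ?_ ((heq_of_eq h).trans ?_))
  · refine A.comp_heq _ _ _ _ (HPath.nil_comp _).symm rfl rfl (HPath.nil_comp _).symm rfl rfl rfl
      (A.comp_heq _ _ _ _ (HPath.nil_comp _).symm rfl rfl rfl rfl rfl rfl HEq.rfl ?_)
      (VDGraph.CellPath.nil_append u Φ).symm
    exact VDGraph.CellPath.cons_heq _ _ rfl rfl rfl rfl rfl rfl rfl HEq.rfl HEq.rfl
  · refine A.comp_heq _ _ _ _ (HPath.nil_comp _) rfl rfl rfl rfl rfl rfl HEq.rfl ?_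
    exact VDGraph.CellPath.cons_heq _ _ rfl rfl rfl rfl rfl rfl rfl HEq.rfl HEq.rfl

end VDC

/-! ### Virtual double functors -/

/-- The action of a virtual double functor on objects, vertical and horizontal morphisms. -/
structure VDMap₁ (A B : VDGraph.{w}) where
  V : A.Obj ⥤ B.Obj
  mapH {a b : A.Obj} : A.HMor a b → B.HMor (V.obj a) (V.obj b)

namespace VDMap₁

variable {A B C : VDGraph.{w}}

/-- The action on strings of horizontal morphisms. -/
def mapPath (F : VDMap₁ A B) {a : A.Obj} :
    ∀ {b : A.Obj}, HPath A.HMor a b → HPath B.HMor (F.V.obj a) (F.V.obj b)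
  | _, .nil _ => .nil _
  | _, .cons p Γ => .cons (mapPath F p) (F.mapH Γ)

theorem mapPath_comp (F : VDMap₁ A B) {a b c : A.Obj} (p : HPath A.HMor a b)
    (q : HPath A.HMor b c) : F.mapPath (p.comp q) = (F.mapPath p).comp (F.mapPath q) := by
  induction q with
  | nil => rfl
  | cons q Γ ih => simp [HPath.comp, mapPath, ih]

/-- The identity. -/
@[reducible]
def id (A : VDGraph.{w}) : VDMap₁ A A := ⟨𝟭 A.Obj, fun Γ => Γ⟩

/-- Composition. -/
@[reducible]
def comp (F : VDMap₁ A B) (G : VDMap₁ B C) : VDMap₁ A C :=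
  ⟨F.V ⋙ G.V, fun Γ => G.mapH (F.mapH Γ)⟩

theorem id_mapPath {a b : A.Obj} (p : HPath A.HMor a b) : (id A).mapPath p = p := by
  induction p with
  | nil => rfl
  | cons p Γ ih => simp only [mapPath, ih]

theorem comp_mapPath (F : VDMap₁ A B) (G : VDMap₁ B C) {a b : A.Obj} (p : HPath A.HMor a b) :
    (F.comp G).mapPath p = G.mapPath (F.mapPath p) := by
  induction p with
  | nil => rfl
  | cons p Γ ih => simp only [mapPath, ih]

end VDMap₁

/-- The action of a virtual double functor on objects, vertical and horizontal morphisms and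
multicells. -/
structure VDMap (A B : VDGraph.{w}) extends VDMap₁ A B where
  mapCell {a a' b b' : A.Obj} {p : HPath A.HMor a a'} {u : a ⟶ b} {u' : a' ⟶ b'}
    {Ω : A.HMor b b'} : A.Cell p u u' Ω →
      B.Cell (toVDMap₁.mapPath p) (V.map u) (V.map u') (mapH Ω)

namespace VDMap

variable {A B C : VDGraph.{w}}

/-- The action on strings of multicells. -/
def mapCellPath (F : VDMap A B) {a : A.Obj} : ∀ {a' b b' : A.Obj} {p : HPath A.HMor a a'}
    {u : a ⟶ b} {u' : a' ⟶ b'} {q : HPath A.HMor b b'}, A.CellPath p u u' q →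
      B.CellPath (F.mapPath p) (F.V.map u) (F.V.map u') (F.mapPath q)
  | _, _, _, _, _, _, _, .nil u => .nil (F.V.map u)
  | _, _, _, _, _, _, _, .cons Θ θ h =>
      .cons (mapCellPath F Θ) (F.mapCell θ) (by rw [← h, F.mapPath_comp])

theorem mapCell_heq (F : VDMap A B) {a a' b b' : A.Obj} {p p₁ : HPath A.HMor a a'} {u u₁ : a ⟶ b}
    {u' u₁' : a' ⟶ b'} {Ω : A.HMor b b'} {θ : A.Cell p u u' Ω} {θ₁ : A.Cell p₁ u₁ u₁' Ω}
    (hp : p = p₁) (hu : u = u₁) (hu' : u' = u₁') (h : θ ≍ θ₁) : F.mapCell θ ≍ F.mapCell θ₁ := by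
  subst hp hu hu' h; rfl

/-- The identity. -/
@[reducible]
def id (A : VDGraph.{w}) : VDMap A A :=
  ⟨VDMap₁.id A, fun {_ _ _ _ p _ _ _} θ =>
    VDGraph.castC (VDMap₁.id_mapPath p).symm rfl rfl θ⟩

/-- Composition. -/
@[reducible]
def comp (F : VDMap A B) (G : VDMap B C) : VDMap A C :=
  ⟨F.toVDMap₁.comp G.toVDMap₁, fun {_ _ _ _ p _ _ _} θ =>
    VDGraph.castC (F.toVDMap₁.comp_mapPath G.toVDMap₁ p).symm rfl rfl (G.mapCell (F.mapCell θ))⟩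

theorem id_mapCell {a a' b b' : A.Obj} {p : HPath A.HMor a a'} {u : a ⟶ b} {u' : a' ⟶ b'}
    {Ω : A.HMor b b'} (θ : A.Cell p u u' Ω) : (id A).mapCell θ ≍ θ :=
  VDGraph.castC_heq (VDMap₁.id_mapPath p).symm rfl rfl θ

theorem comp_mapCell (F : VDMap A B) (G : VDMap B C) {a a' b b' : A.Obj} {p : HPath A.HMor a a'}
    {u : a ⟶ b} {u' : a' ⟶ b'} {Ω : A.HMor b b'} (θ : A.Cell p u u' Ω) :
    (F.comp G).mapCell θ ≍ G.mapCell (F.mapCell θ) :=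
  VDGraph.castC_heq (F.toVDMap₁.comp_mapPath G.toVDMap₁ p).symm rfl rfl _

theorem id_mapCellPath {a a' b b' : A.Obj} {p : HPath A.HMor a a'} {u : a ⟶ b} {u' : a' ⟶ b'}
    {q : HPath A.HMor b b'} (Θ : A.CellPath p u u' q) : (id A).mapCellPath Θ ≍ Θ := by
  induction Θ with
  | nil u => rfl
  | cons Θ θ h ih =>
    exact VDGraph.CellPath.cons_heq _ h (VDMap₁.id_mapPath _) rfl rfl (VDMap₁.id_mapPath _)
      (VDMap₁.id_mapPath _) rfl rfl ih (id_mapCell θ)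

theorem comp_mapCellPath (F : VDMap A B) (G : VDMap B C) {a a' b b' : A.Obj}
    {p : HPath A.HMor a a'} {u : a ⟶ b} {u' : a' ⟶ b'} {q : HPath A.HMor b b'}
    (Θ : A.CellPath p u u' q) :
    (F.comp G).mapCellPath Θ ≍ G.mapCellPath (F.mapCellPath Θ) := by
  induction Θ with
  | nil u => rfl
  | cons Θ θ h ih =>
    exact VDGraph.CellPath.cons_heq _ _ (VDMap₁.comp_mapPath _ _ _) rfl rfl
      (VDMap₁.comp_mapPath _ _ _) (VDMap₁.comp_mapPath _ _ _) rfl rfl ih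
      (comp_mapCell F G θ)

end VDMap

/-- A virtual double functor. -/
structure VDFunctor (A B : VDC.{w}) extends VDMap A.toVDGraph B.toVDGraph where
  map_idCell {a b : A.Obj} (Γ : A.HMor a b) :
    mapCell (A.idCell Γ) = B.castC rfl (V.map_id a).symm (V.map_id b).symm (B.idCell (mapH Γ))
  map_comp {a a' b b' c c' : A.Obj} {p : HPath A.HMor a a'} {u : a ⟶ b} {u' : a' ⟶ b'}
    {q : HPath A.HMor b b'} {v : b ⟶ c} {v' : b' ⟶ c'} {Λ : A.HMor c c'} {x : a ⟶ c} {x' : a' ⟶ c'}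
    (κ : A.Cell q v v' Λ) (Θ : A.CellPath p u u' q) (hx : u ≫ v = x) (hx' : u' ≫ v' = x') :
    mapCell (A.comp κ Θ hx hx') =
      B.comp (mapCell κ) (toVDMap.mapCellPath Θ) (by rw [← hx, V.map_comp])
        (by rw [← hx', V.map_comp])

namespace VDFunctor

variable {A B C D : VDC.{w}}

theorem ext' {F G : VDFunctor A B} (h₁ : F.toVDMap₁ = G.toVDMap₁)
    (h : ∀ {a a' b b' : A.Obj} {p : HPath A.HMor a a'} {u : a ⟶ b} {u' : a' ⟶ b'}
      {Ω : A.HMor b b'} (θ : A.Cell p u u' Ω), F.mapCell θ ≍ G.mapCell θ) : F = G := by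
  obtain ⟨⟨F₁, Fc⟩, _, _⟩ := F
  obtain ⟨⟨G₁, Gc⟩, _, _⟩ := G
  obtain rfl : F₁ = G₁ := h₁
  obtain rfl : @Fc = @Gc := by
    funext a a' b b' p u u' Ω θ; exact eq_of_heq (h θ)
  rfl

/-- The identity virtual double functor. -/
@[reducible]
def id (A : VDC.{w}) : VDFunctor A A where
  toVDMap := VDMap.id A.toVDGraph
  map_idCell Γ := rfl
  map_comp κ Θ hx hx' := eq_of_heq <| (VDMap.id_mapCell _).trans <|
    (A.comp_heq _ _ _ _ (VDMap₁.id_mapPath _) rfl rfl (VDMap₁.id_mapPath _) rfl rfl rfl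
      (VDMap.id_mapCell κ) (VDMap.id_mapCellPath Θ)).symm

theorem map_idCell_heq (F : VDFunctor A B) {a b : A.Obj} (Γ : A.HMor a b) :
    F.mapCell (A.idCell Γ) ≍ B.idCell (F.mapH Γ) := by
  rw [F.map_idCell]; apply VDGraph.castC_heq

/-- Composition of virtual double functors. -/
@[reducible]
def comp (F : VDFunctor A B) (G : VDFunctor B C) : VDFunctor A C where
  toVDMap := F.toVDMap.comp G.toVDMap
  map_idCell {a b} Γ := eq_of_heq <| (VDMap.comp_mapCell _ _ _).trans <|
    (G.mapCell_heq rfl (F.V.map_id a) (F.V.map_id b) (F.map_idCell_heq Γ)).trans <|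
    (G.map_idCell_heq _).trans (by symm; apply VDGraph.castC_heq)
  map_comp κ Θ hx hx' := eq_of_heq <| (VDMap.comp_mapCell _ _ _).trans <| by
    rw [F.map_comp, G.map_comp]
    exact (C.comp_heq _ _ _ _ (VDMap₁.comp_mapPath _ _ _) rfl rfl (VDMap₁.comp_mapPath _ _ _)
      rfl rfl rfl (VDMap.comp_mapCell _ _ κ) (VDMap.comp_mapCellPath _ _ Θ)).symm

end VDFunctor

instance : CategoryStruct VDC.{w} where
  Hom := VDFunctor
  id := VDFunctor.id
  comp F G := F.comp G

namespace VDC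

theorem id_comp₁ {A B : VDC.{w}} (F : A ⟶ B) : 𝟙 A ≫ F = F :=
  VDFunctor.ext' rfl fun θ => (VDMap.comp_mapCell _ _ _).trans
    (F.mapCell_heq (VDMap₁.id_mapPath _) rfl rfl (VDMap.id_mapCell θ))

theorem comp_id₁ {A B : VDC.{w}} (F : A ⟶ B) : F ≫ 𝟙 B = F :=
  VDFunctor.ext' rfl fun θ => (VDMap.comp_mapCell _ _ _).trans (VDMap.id_mapCell _)

theorem assoc₁ {A B C D : VDC.{w}} (F : A ⟶ B) (G : B ⟶ C) (H : C ⟶ D) :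
    (F ≫ G) ≫ H = F ≫ G ≫ H :=
  VDFunctor.ext' rfl fun θ => (VDMap.comp_mapCell _ _ θ).trans <|
    (H.mapCell_heq (VDMap₁.comp_mapPath _ _ _) rfl rfl (VDMap.comp_mapCell _ _ θ)).trans <|
    (VDMap.comp_mapCell _ _ _).symm.trans (VDMap.comp_mapCell _ _ θ).symm

end VDC

/-! ### Vertical transformations -/

/-- The components of a vertical transformation. -/
structure VertData {A B : VDC.{w}} (F G : VDFunctor A B) where
  app : F.V ⟶ G.V
  cell {a b : A.Obj} (Γ : A.HMor a b) :
    B.Cell (.single (F.mapH Γ)) (app.app a) (app.app b) (G.mapH Γ)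

/-- The string of components at a string of horizontal morphisms. -/
def VertData.cellPath {A B : VDC.{w}} {F G : VDFunctor A B} (α : VertData F G) {a : A.Obj} :
    ∀ {b : A.Obj} (p : HPath A.HMor a b),
      B.CellPath (F.mapPath p) (α.app.app a) (α.app.app b) (G.mapPath p)
  | _, .nil _ => .nil _
  | _, .cons p Γ => .cons (cellPath α p) (α.cell Γ) rfl

/-- A vertical transformation between virtual double functors. -/
structure VertTrans {A B : VDC.{w}} (F G : VDFunctor A B) extends VertData F G where
  naturality {a a' b b' : A.Obj} {p : HPath A.HMor a a'} {u : a ⟶ b} {u' : a' ⟶ b'}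
    {Ω : A.HMor b b'} (θ : A.Cell p u u' Ω) :
    B.comp (cell Ω) (.single (F.mapCell θ)) rfl rfl =
      B.comp (G.mapCell θ) (toVertData.cellPath p) (app.naturality u).symm (app.naturality u').symm

namespace VertTrans

variable {A B C : VDC.{w}}

theorem ext' {F G : VDFunctor A B} {α β : VertTrans F G} (h : ∀ a, α.app.app a = β.app.app a)
    (hc : ∀ {a b : A.Obj} (Γ : A.HMor a b), α.cell Γ ≍ β.cell Γ) : α = β := by
  obtain ⟨⟨a, ac⟩, _⟩ := α
  obtain ⟨⟨b, bc⟩, _⟩ := β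
  obtain rfl : a = b := by ext x; exact h x
  obtain rfl : @ac = @bc := by funext x y Γ; exact eq_of_heq (hc Γ)
  rfl

theorem heq {F G F' G' : VDFunctor A B} (hF : F = F') (hG : G = G') {α : VertTrans F G}
    {β : VertTrans F' G'} (h : ∀ a, α.app.app a ≍ β.app.app a)
    (hc : ∀ {a b : A.Obj} (Γ : A.HMor a b), α.cell Γ ≍ β.cell Γ) : α ≍ β := by
  subst hF hG
  exact heq_of_eq (ext' (fun a => eq_of_heq (h a)) hc)

/-- The identity vertical transformation. -/
def id (F : VDFunctor A B) : VertTrans F F where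
  app := 𝟙 F.V
  cell Γ := B.idCell (F.mapH Γ)
  naturality {a a' b b' p u u' Ω} θ := by
    have h : ∀ {a' : A.Obj} (p : HPath A.HMor a a'),
        (VertData.mk (𝟙 F.V) (fun Γ => B.idCell (F.mapH Γ)) : VertData F F).cellPath p =
          B.idPath (F.mapPath p) := by
      intro a' p
      induction p with
      | nil => rfl
      | cons p Γ ih => simp only [VertData.cellPath, ih]; rfl
    rw [h]
    refine eq_of_heq (HEq.trans ?_ ((heq_of_eq ((B.id_comp' (F.mapCell θ)).trans
      (B.comp_id' (F.mapCell θ)).symm)).trans ?_))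
    · exact B.comp_heq _ _ _ _ rfl rfl rfl rfl rfl rfl rfl HEq.rfl HEq.rfl
    · exact B.comp_heq _ _ _ _ rfl rfl rfl rfl rfl rfl rfl HEq.rfl HEq.rfl

theorem compRel_cellPath {F G H : VDFunctor A B} (α : VertData F G) (β : VertData G H)
    {a b : A.Obj} (p : HPath A.HMor a b) :
    B.CompRel (β.cellPath p) (α.cellPath p)
      ((VertData.mk (α.app ≫ β.app) fun Γ =>
        B.comp (β.cell Γ) (.single (α.cell Γ)) rfl rfl : VertData F H).cellPath p) := by
  induction p with
  | nil => exact .nil _ _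
  | cons p Γ ih => exact .cons ih (β.cell Γ) (.single (α.cell Γ)) rfl rfl

/-- Vertical composition of vertical transformations. -/
def vcomp {F G H : VDFunctor A B} (α : VertTrans F G) (β : VertTrans G H) : VertTrans F H where
  app := α.app ≫ β.app
  cell Γ := B.comp (β.cell Γ) (.single (α.cell Γ)) rfl rfl
  naturality {a a' b b' p u u' Ω} θ := by
    refine (B.comp_comp_single (β.cell Ω) (α.cell Ω) (.single (F.mapCell θ)) rfl rfl rfl rfl rfl rfl
      (Category.assoc _ _ _) (Category.assoc _ _ _)).trans ?_
    rw [α.naturality]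
    refine (B.comp_comp_single (β.cell Ω) (G.mapCell θ) (α.cellPath p) rfl rfl
      (by simp) (by simp) _ _ _ _).symm.trans ?_
    rw [β.naturality]
    exact B.assoc' _ (compRel_cellPath α.toVertData β.toVertData p) _ _ _ _ _ _

/-- Whiskering with a virtual double functor on the source side. -/
def whiskerL (F : VDFunctor A B) {G H : VDFunctor B C} (α : VertTrans G H) :
    VertTrans (F.comp G) (F.comp H) where
  app := Functor.whiskerLeft F.V α.app
  cell Γ := α.cell (F.mapH Γ)
  naturality {a a' b b' p u u' Ω} θ := by
    have h : ∀ {a' : A.Obj} (p : HPath A.HMor a a'),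
        (VertData.mk (Functor.whiskerLeft F.V α.app) (fun Γ => α.cell (F.mapH Γ)) :
          VertData (F.comp G) (F.comp H)).cellPath p ≍ α.cellPath (F.mapPath p) := by
      intro a' p
      induction p with
      | nil => rfl
      | cons p Γ ih =>
        exact VDGraph.CellPath.cons_heq _ _ (VDMap₁.comp_mapPath _ _ _) rfl rfl
          (VDMap₁.comp_mapPath _ _ _) rfl rfl rfl ih HEq.rfl
    refine eq_of_heq (HEq.trans ?_ ((heq_of_eq (α.naturality (F.mapCell θ))).trans ?_))
    · exact C.comp_heq _ _ _ _ (VDMap₁.comp_mapPath _ _ _) rfl rfl rfl rfl rfl rfl HEq.rfl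
        (VDGraph.CellPath.single_heq (VDMap₁.comp_mapPath _ _ _) rfl rfl rfl
          (VDMap.comp_mapCell _ _ θ))
    · exact C.comp_heq _ _ _ _ (VDMap₁.comp_mapPath _ _ _).symm rfl rfl
        (VDMap₁.comp_mapPath _ _ _).symm rfl rfl rfl (VDMap.comp_mapCell _ _ θ).symm (h p).symm

/-- Whiskering with a virtual double functor on the target side. -/
def whiskerR {F G : VDFunctor A B} (α : VertTrans F G) (H : VDFunctor B C) :
    VertTrans (F.comp H) (G.comp H) where
  app := Functor.whiskerRight α.app H.V
  cell Γ := H.mapCell (α.cell Γ)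
  naturality {a a' b b' p u u' Ω} θ := by
    have h : ∀ {a' : A.Obj} (p : HPath A.HMor a a'),
        (VertData.mk (Functor.whiskerRight α.app H.V) (fun Γ => H.mapCell (α.cell Γ)) :
          VertData (F.comp H) (G.comp H)).cellPath p ≍ H.mapCellPath (α.cellPath p) := by
      intro a' p
      induction p with
      | nil => rfl
      | cons p Γ ih =>
        exact VDGraph.CellPath.cons_heq _ _ (VDMap₁.comp_mapPath _ _ _) rfl rfl
          (VDMap₁.comp_mapPath _ _ _) rfl rfl rfl ih HEq.rfl
    have h' := congrArg H.mapCell (α.naturality θ)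
    rw [H.map_comp, H.map_comp] at h'
    refine eq_of_heq (HEq.trans ?_ ((heq_of_eq h').trans ?_))
    · exact C.comp_heq _ _ _ _ (VDMap₁.comp_mapPath _ _ _) rfl rfl rfl rfl rfl rfl HEq.rfl
        (VDGraph.CellPath.single_heq (VDMap₁.comp_mapPath _ _ _) rfl rfl rfl
          (VDMap.comp_mapCell _ _ θ))
    · exact C.comp_heq _ _ _ _ (VDMap₁.comp_mapPath _ _ _).symm rfl rfl
        (VDMap₁.comp_mapPath _ _ _).symm rfl rfl rfl (VDMap.comp_mapCell _ _ θ).symm (h p).symm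

end VertTrans

namespace VDC

instance (A B : VDC.{w}) : Category (A ⟶ B) where
  Hom F G := VertTrans F G
  id F := VertTrans.id F
  comp α β := VertTrans.vcomp α β
  id_comp {F G} α := VertTrans.ext' (fun a => Category.id_comp _) fun {a b} Γ => by
    refine HEq.trans ?_ (heq_of_eq (B.comp_id' (α.cell Γ)))
    exact B.comp_heq _ _ _ _ rfl rfl rfl rfl rfl rfl rfl HEq.rfl HEq.rfl
  comp_id {F G} α := VertTrans.ext' (fun a => Category.comp_id _) fun {a b} Γ => by
    refine HEq.trans ?_ (heq_of_eq (B.id_comp' (α.cell Γ)))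
    exact B.comp_heq _ _ _ _ rfl rfl rfl rfl rfl rfl rfl HEq.rfl HEq.rfl
  assoc {F G H I} α β γ := VertTrans.ext' (fun a => Category.assoc _ _ _) fun {a b} Γ => by
    refine HEq.symm (HEq.trans (heq_of_eq (B.comp_comp_single (γ.cell Γ) (β.cell Γ)
      (.single (α.cell Γ)) rfl rfl rfl rfl rfl rfl (Category.assoc _ _ _) (Category.assoc _ _ _))) ?_)
    exact B.comp_heq _ _ _ _ rfl rfl rfl rfl rfl rfl rfl HEq.rfl HEq.rfl

/-- The 2-category `VDBL` of virtual double categories, virtual double functors and vertical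
transformations. -/
@[reducible]
def core : TwoCatCore VDC.{w} where
  id_comp := id_comp₁
  comp_id := comp_id₁
  assoc := assoc₁
  wl F _ _ α := VertTrans.whiskerL F α
  wr α H := VertTrans.whiskerR α H
  wl_id _ _ := rfl
  wl_comp _ _ _ _ _ _ := rfl
  id_wr F G := VertTrans.ext' (fun a => G.V.map_id _) fun Γ => G.map_idCell_heq _
  comp_wr {A B C F G H} α β I := VertTrans.ext' (fun a => I.V.map_comp _ _) fun Γ =>
    (heq_of_eq (I.map_comp _ _ _ _)).trans
      (C.comp_heq _ _ _ _ rfl rfl rfl rfl rfl rfl rfl HEq.rfl HEq.rfl)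
  exchange {A B C F G H I} α β := VertTrans.ext' (fun a => (β.app.naturality _).symm) fun Γ => by
    refine HEq.trans ?_ ((heq_of_eq (β.naturality (α.cell Γ)).symm).trans ?_)
    · exact C.comp_heq _ _ _ _ rfl rfl rfl rfl rfl rfl rfl HEq.rfl HEq.rfl
    · exact C.comp_heq _ _ _ _ rfl rfl rfl rfl rfl rfl rfl HEq.rfl HEq.rfl
  id_wl {A B F G} α := VertTrans.heq (id_comp₁ F) (id_comp₁ G) (fun a => HEq.rfl) fun Γ => HEq.rfl
  wr_id {A B F G} α := VertTrans.heq (comp_id₁ F) (comp_id₁ G) (fun a => HEq.rfl)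
    fun Γ => VDMap.id_mapCell (α.cell Γ)
  comp_wl F G _ _ η := VertTrans.heq (assoc₁ F G _) (assoc₁ F G _) (fun a => HEq.rfl)
    fun Γ => HEq.rfl
  wr_comp α G H := VertTrans.heq (assoc₁ _ G H).symm (assoc₁ _ G H).symm (fun a => HEq.rfl)
    fun Γ => VDMap.comp_mapCell G.toVDMap H.toVDMap (α.cell Γ)
  wl_wr F _ _ _ H := VertTrans.heq (assoc₁ F _ H) (assoc₁ F _ H) (fun a => HEq.rfl)
    fun Γ => HEq.rfl

instance : Bicategory.{w, w} VDC.{w} := core.bicategory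

instance : Strict VDC.{w} := core.strict

end VDC

end VDC
end VEnr
namespace VEnr
section Enr
universe u w v
open Bicategory

/-! ### The terminal virtual double category -/

namespace VDC

/-- The terminal virtual double category: one object, one vertical and one horizontal morphism, and
one multicell for each boundary. -/
def one : VDC.{w} where
  Obj := Discrete PUnit.{w + 1}
  HMor _ _ := PUnit
  Cell _ _ _ _ := PUnit
  idCell _ := ⟨⟩
  comp _ _ _ _ := ⟨⟩
  id_comp' _ := rfl
  comp_id' _ := rfl
  assoc' := by intros; rfl

instance : Subsingleton one.{w}.Obj := inferInstanceAs (Subsingleton (Discrete PUnit.{w + 1}))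
instance (a b : one.{w}.Obj) : Subsingleton (a ⟶ b) :=
  inferInstanceAs (Subsingleton (Discrete.mk _ ⟶ Discrete.mk _))
instance (a b : one.{w}.Obj) : Subsingleton (one.{w}.HMor a b) :=
  inferInstanceAs (Subsingleton PUnit)
instance {a a' b b' : one.{w}.Obj} (p : HPath one.{w}.HMor a a') (u : a ⟶ b) (u' : a' ⟶ b')
    (Ω : one.{w}.HMor b b') : Subsingleton (one.{w}.Cell p u u' Ω) :=
  inferInstanceAs (Subsingleton PUnit)

/-- The terminal virtual double category is a terminal object of the 2-category `VDBL`. -/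
def oneIsTerminal : IsTwoTerminal one.{w} where
  from_ A :=
    { V := (Functor.const A.Obj).obj (Discrete.mk PUnit.unit)
      mapH := fun _ => PUnit.unit
      mapCell := fun _ => PUnit.unit
      map_idCell := fun _ => rfl
      map_comp := fun _ _ _ _ => rfl }
  hom_ext {A} F G := by
    obtain ⟨⟨⟨FV, FH⟩, Fc⟩, _, _⟩ := F
    obtain ⟨⟨⟨GV, GH⟩, Gc⟩, _, _⟩ := G
    obtain rfl : FV = GV :=
      CategoryTheory.Functor.ext (fun _ => Subsingleton.elim _ _) fun _ _ _ => Subsingleton.elim _ _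
    obtain rfl : @FH = @GH := by funext _ _ _; exact Subsingleton.elim _ _
    obtain rfl : @Fc = @Gc := by funext _ _ _ _ _ _ _ _ _; exact Subsingleton.elim _ _
    rfl
  hom₂_ext {A F G} α β := by
    refine VertTrans.ext' (fun a => Subsingleton.elim _ _) fun Γ => ?_
    exact HEq.rfl

end VDC

/-! ### Enriched categories -/

/-- A small category enriched over a virtual double category. -/
structure ECat (A : VDC.{w}) : Type (max (u + 1) w) where
  ob : Type u
  extent : ob → A.Obj
  hom (c c' : ob) : A.HMor (extent c) (extent c')
  unit (c : ob) : A.Cell (.nil (extent c)) (𝟙 _) (𝟙 _) (hom c c)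
  mul (c₀ c₁ c₂ : ob) : A.Cell ((HPath.single (hom c₀ c₁)).cons (hom c₁ c₂)) (𝟙 _) (𝟙 _) (hom c₀ c₂)
  unit_mul (c c' : ob) :
    A.comp (mul c c c') (.pair (P := .single (hom c c')) (unit c) (A.idCell (hom c c')) rfl)
      (Category.comp_id _) (Category.comp_id _) = A.idCell (hom c c')
  mul_unit (c c' : ob) :
    A.comp (mul c c' c') (.pair (P := .single (hom c c')) (A.idCell (hom c c')) (unit c') rfl)
      (Category.comp_id _) (Category.comp_id _) = A.idCell (hom c c')
  mul_assoc (c₀ c₁ c₂ c₃ : ob) :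
    A.comp (mul c₀ c₂ c₃)
      (.pair (P := ((HPath.single (hom c₀ c₁)).cons (hom c₁ c₂)).cons (hom c₂ c₃)) (mul c₀ c₁ c₂) (A.idCell (hom c₂ c₃)) rfl)
      (Category.comp_id _) (Category.comp_id _) =
    A.comp (mul c₀ c₁ c₃)
      (.pair (P := ((HPath.single (hom c₀ c₁)).cons (hom c₁ c₂)).cons (hom c₂ c₃)) (A.idCell (hom c₀ c₁)) (mul c₁ c₂ c₃) rfl)
      (Category.comp_id _) (Category.comp_id _)

/-- A functor between enriched categories. -/
structure EFunctor {A : VDC.{w}} (C D : ECat.{u} A) where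
  obj : C.ob → D.ob
  app (c : C.ob) : C.extent c ⟶ D.extent (obj c)
  cell (c c' : C.ob) : A.Cell (.single (C.hom c c')) (app c) (app c') (D.hom (obj c) (obj c'))
  map_unit (c : C.ob) :
    A.comp (cell c c) (.single (C.unit c)) (Category.id_comp _) (Category.id_comp _) =
    A.comp (D.unit (obj c)) (.nil (app c)) (Category.comp_id _) (Category.comp_id _)
  map_mul (c₀ c₁ c₂ : C.ob) :
    A.comp (cell c₀ c₂) (.single (C.mul c₀ c₁ c₂)) (Category.id_comp _) (Category.id_comp _) =
    A.comp (D.mul (obj c₀) (obj c₁) (obj c₂)) (.pair (P := (HPath.single (C.hom c₀ c₁)).cons (C.hom c₁ c₂)) (cell c₀ c₁) (cell c₁ c₂) rfl)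
      (Category.comp_id _) (Category.comp_id _)

/-- A natural transformation between functors of enriched categories. -/
structure ENatTrans {A : VDC.{w}} {C D : ECat.{u} A} (f g : EFunctor C D) where
  app (c : C.ob) : A.Cell (.nil (C.extent c)) (f.app c) (g.app c) (D.hom (f.obj c) (g.obj c))
  naturality (c c' : C.ob) :
    A.comp (D.mul (f.obj c) (g.obj c) (g.obj c')) (.pair (P := .single (C.hom c c')) (app c) (g.cell c c') rfl)
      (Category.comp_id _) (Category.comp_id _) =
    A.comp (D.mul (f.obj c) (f.obj c') (g.obj c')) (.pair (P := .single (C.hom c c')) (f.cell c c') (app c') rfl)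
      (Category.comp_id _) (Category.comp_id _)

namespace VDC

variable (A : VDC.{w})

theorem comp_nil_nil {a b c d d' : A.Obj} {u : a ⟶ b} {v : b ⟶ c} {k : c ⟶ d} {k' : c ⟶ d'}
    {Λ : A.HMor d d'} {x : a ⟶ c} {y : b ⟶ d} {y' : b ⟶ d'} {z : a ⟶ d} {z' : a ⟶ d'}
    (κ : A.Cell (.nil c) k k' Λ) (hy : v ≫ k = y) (hy' : v ≫ k' = y') (hz : u ≫ y = z)
    (hz' : u ≫ y' = z') (hx : u ≫ v = x) (hxk : x ≫ k = z) (hxk' : x ≫ k' = z') :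
    A.comp (A.comp κ (.nil v) hy hy') (.nil u) hz hz' = A.comp κ (.nil x) hxk hxk' := by
  subst hx
  exact A.assoc' κ (.nil u v) hy hy' hz hz' hxk hxk'

/-- Associativity in the case of a string of length two in the middle. -/
theorem comp_comp_pair {a a' a'' b b' b'' c c' c'' d d' : A.Obj}
    {p : HPath A.HMor a a'} {p' : HPath A.HMor a' a''} {P : HPath A.HMor a a''}
    {u : a ⟶ b} {u' : a' ⟶ b'} {u'' : a'' ⟶ b''} {q : HPath A.HMor b b'} {q' : HPath A.HMor b' b''}
    {Q : HPath A.HMor b b''} {v : b ⟶ c} {v' : b' ⟶ c'} {v'' : b'' ⟶ c''}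
    {Ω : A.HMor c c'} {Ω' : A.HMor c' c''} {k : c ⟶ d} {k' : c'' ⟶ d'} {Λ : A.HMor d d'}
    {x : a ⟶ c} {x' : a' ⟶ c'} {x'' : a'' ⟶ c''}
    {y : b ⟶ d} {y' : b'' ⟶ d'} {z : a ⟶ d} {z' : a'' ⟶ d'}
    (κ : A.Cell ((HPath.single Ω).cons Ω') k k' Λ) (θ : A.Cell q v v' Ω) (θ' : A.Cell q' v' v'' Ω')
    (Φ : A.CellPath p u u' q) (Φ' : A.CellPath p' u' u'' q') (Ψ : A.CellPath P u u'' Q)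
    (hp : p.comp p' = P) (hq : q.comp q' = Q) (hΨ : Φ.append Φ' ≍ Ψ)
    (hy : v ≫ k = y) (hy' : v'' ≫ k' = y') (hz : u ≫ y = z) (hz' : u'' ≫ y' = z')
    (hx : u ≫ v = x) (hx' : u' ≫ v' = x') (hx'' : u'' ≫ v'' = x'')
    (hxk : x ≫ k = z) (hxk' : x'' ≫ k' = z') :
    A.comp (A.comp κ (.pair θ θ' hq) hy hy') Ψ hz hz' =
      A.comp κ (.pair (A.comp θ Φ hx hx') (A.comp θ' Φ' hx' hx'') hp) hxk hxk' := by
  subst hx hp hq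
  cases hΨ
  have h := A.assoc' κ (.cons (.cons (.nil u v) θ Φ rfl hx') θ' Φ' hx' hx'') hy hy' hz hz' hxk hxk'
  have e : ∀ {a : A.Obj} {b : A.Obj} (r : HPath A.HMor a b), r = (HPath.nil a).comp r :=
    fun r => (HPath.nil_comp r).symm
  refine eq_of_heq (HEq.trans ?_ ((heq_of_eq h).trans ?_))
  · have ea : ((VDGraph.CellPath.nil u).append Φ).append Φ' ≍ Φ.append Φ' := by
      have : ∀ {p₁ : HPath A.HMor a a'} {q₁ : HPath A.HMor b b'} (hp : p₁ = p) (hq : q₁ = q)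
          (Φ₁ : A.CellPath p₁ u u' q₁) (h : Φ₁ ≍ Φ), Φ₁.append Φ' ≍ Φ.append Φ' := by
        intro p₁ q₁ hp hq Φ₁ h; subst hp hq h; rfl
      exact this (HPath.nil_comp _) (HPath.nil_comp _) _ (VDGraph.CellPath.nil_append u Φ)
    refine A.comp_heq _ _ _ _ (by rw [HPath.nil_comp]) rfl rfl (by rw [HPath.nil_comp]) rfl rfl rfl
      (A.comp_heq _ _ _ _ (by rw [HPath.nil_comp]) rfl rfl rfl rfl rfl rfl HEq.rfl ?_) ea.symm
    exact VDGraph.CellPath.cons_heq _ _ (HPath.nil_comp _).symm rfl rfl rfl rfl rfl rfl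
      (VDGraph.CellPath.cons_heq _ _ rfl rfl rfl rfl rfl rfl rfl HEq.rfl HEq.rfl) HEq.rfl
  · refine A.comp_heq _ _ _ _ (by rw [HPath.nil_comp]) rfl rfl rfl rfl rfl rfl HEq.rfl ?_
    exact VDGraph.CellPath.cons_heq _ _ (HPath.nil_comp _) rfl rfl rfl rfl rfl rfl
      (VDGraph.CellPath.cons_heq _ _ rfl rfl rfl rfl rfl rfl rfl HEq.rfl HEq.rfl) HEq.rfl

end VDC

namespace ECat

variable {A : VDC.{w}} (C : ECat.{u} A)

/-- The composite of the unit of `C` with a vertical morphism. -/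
def e (c : C.ob) {a : A.Obj} (u : a ⟶ C.extent c) : A.Cell (.nil a) u u (C.hom c c) :=
  A.comp (C.unit c) (.nil u) (Category.comp_id _) (Category.comp_id _)

/-- The composite of the multiplication of `C` with two multicells. -/
def m {c₀ c₁ c₂ : C.ob} {a a' a'' : A.Obj} {p : HPath A.HMor a a'} {p' : HPath A.HMor a' a''}
    {P : HPath A.HMor a a''} {u : a ⟶ C.extent c₀} {u' : a' ⟶ C.extent c₁} {u'' : a'' ⟶ C.extent c₂}
    (θ : A.Cell p u u' (C.hom c₀ c₁)) (θ' : A.Cell p' u' u'' (C.hom c₁ c₂)) (h : p.comp p' = P) :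
    A.Cell P u u'' (C.hom c₀ c₂) :=
  A.comp (C.mul c₀ c₁ c₂) (.pair θ θ' h) (Category.comp_id _) (Category.comp_id _)

theorem m_comp {c₀ c₁ c₂ : C.ob} {a a' a'' b b' b'' : A.Obj}
    {p : HPath A.HMor a a'} {p' : HPath A.HMor a' a''} {P : HPath A.HMor a a''}
    {u : a ⟶ C.extent c₀} {u' : a' ⟶ C.extent c₁} {u'' : a'' ⟶ C.extent c₂}
    {q : HPath A.HMor b b'} {q' : HPath A.HMor b' b''} {Q : HPath A.HMor b b''}
    {v : b ⟶ a} {v' : b' ⟶ a'} {v'' : b'' ⟶ a''} {x : b ⟶ C.extent c₀} {x' : b' ⟶ C.extent c₁}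
    {x'' : b'' ⟶ C.extent c₂}
    (θ : A.Cell p u u' (C.hom c₀ c₁)) (θ' : A.Cell p' u' u'' (C.hom c₁ c₂)) (h : p.comp p' = P)
    (Φ : A.CellPath q v v' p) (Φ' : A.CellPath q' v' v'' p') (Ψ : A.CellPath Q v v'' P)
    (hq : q.comp q' = Q) (hΨ : Φ.append Φ' ≍ Ψ)
    (hx : v ≫ u = x) (hx' : v' ≫ u' = x') (hx'' : v'' ≫ u'' = x'') :
    A.comp (C.m θ θ' h) Ψ hx hx'' = C.m (A.comp θ Φ hx hx') (A.comp θ' Φ' hx' hx'') hq :=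
  A.comp_comp_pair _ _ _ _ _ _ _ _ hΨ _ _ _ _ _ _ _ _ _

theorem e_comp (c : C.ob) {a b : A.Obj} (u : a ⟶ C.extent c) (v : b ⟶ a) {x : b ⟶ C.extent c}
    (hx hx' : v ≫ u = x) : A.comp (C.e c u) (.nil v) hx hx' = C.e c x :=
  A.comp_nil_nil _ _ _ _ _ hx _ _

theorem e_m {c c' : C.ob} {a a' : A.Obj} {p : HPath A.HMor a a'} {u : a ⟶ C.extent c}
    {u' : a' ⟶ C.extent c'} (θ : A.Cell p u u' (C.hom c c')) (h : (HPath.nil a).comp p = p) :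
    C.m (C.e c u) θ h = θ := by
  have h₁ := A.comp_comp_pair (Q := .single (C.hom c c')) (C.mul c c c') (C.unit c) (A.idCell (C.hom c c')) (.nil u)
    (.single θ) (.single θ) h rfl
    (VDGraph.CellPath.nil_append _ _) (Category.comp_id _) (Category.comp_id _)
    (Category.comp_id _) (Category.comp_id _) (Category.comp_id _) (Category.comp_id _)
    (Category.comp_id _) (Category.comp_id _) (Category.comp_id _)
  rw [C.unit_mul, A.id_comp'] at h₁
  exact h₁.symm

theorem m_e {c c' : C.ob} {a a' : A.Obj} {p : HPath A.HMor a a'} {u : a ⟶ C.extent c}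
    {u' : a' ⟶ C.extent c'} (θ : A.Cell p u u' (C.hom c c')) :
    C.m θ (C.e c' u') rfl = θ := by
  have h₁ := A.comp_comp_pair (Q := .single (C.hom c c')) (C.mul c c' c') (A.idCell (C.hom c c')) (C.unit c') (.single θ)
    (.nil u') (.single θ) rfl rfl
    HEq.rfl (Category.comp_id _) (Category.comp_id _)
    (Category.comp_id _) (Category.comp_id _) (Category.comp_id _) (Category.comp_id _)
    (Category.comp_id _) (Category.comp_id _) (Category.comp_id _)
  rw [C.mul_unit, A.id_comp'] at h₁
  exact h₁.symm

theorem m_assoc {c₀ c₁ c₂ c₃ : C.ob} {a₀ a₁ a₂ a₃ : A.Obj} {p₁ : HPath A.HMor a₀ a₁}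
    {p₂ : HPath A.HMor a₁ a₂} {p₃ : HPath A.HMor a₂ a₃} {p₁₂ : HPath A.HMor a₀ a₂}
    {p₂₃ : HPath A.HMor a₁ a₃} {P : HPath A.HMor a₀ a₃}
    {u₀ : a₀ ⟶ C.extent c₀} {u₁ : a₁ ⟶ C.extent c₁} {u₂ : a₂ ⟶ C.extent c₂}
    {u₃ : a₃ ⟶ C.extent c₃} (θ₁ : A.Cell p₁ u₀ u₁ (C.hom c₀ c₁))
    (θ₂ : A.Cell p₂ u₁ u₂ (C.hom c₁ c₂)) (θ₃ : A.Cell p₃ u₂ u₃ (C.hom c₂ c₃))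
    (h₁₂ : p₁.comp p₂ = p₁₂) (h₂₃ : p₂.comp p₃ = p₂₃) (h : p₁₂.comp p₃ = P)
    (h' : p₁.comp p₂₃ = P) :
    C.m (C.m θ₁ θ₂ h₁₂) θ₃ h = C.m θ₁ (C.m θ₂ θ₃ h₂₃) h' := by
  subst h₁₂ h₂₃
  have h₁ := A.comp_comp_pair
    (Q := ((HPath.single (C.hom c₀ c₁)).cons (C.hom c₁ c₂)).cons (C.hom c₂ c₃)) (C.mul c₀ c₂ c₃) (C.mul c₀ c₁ c₂) (A.idCell (C.hom c₂ c₃))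
    (.pair θ₁ θ₂ rfl) (.single θ₃) (.cons (.pair θ₁ θ₂ rfl) θ₃ h) h rfl
    (VDGraph.CellPath.cons_heq _ _ rfl rfl rfl rfl rfl rfl rfl HEq.rfl HEq.rfl)
    (Category.comp_id _) (Category.comp_id _)
    (Category.comp_id _) (Category.comp_id _) (Category.comp_id _) (Category.comp_id _)
    (Category.comp_id _) (Category.comp_id _) (Category.comp_id _)
  have h₂ := A.comp_comp_pair
    (Q := ((HPath.single (C.hom c₀ c₁)).cons (C.hom c₁ c₂)).cons (C.hom c₂ c₃)) (C.mul c₀ c₁ c₃) (A.idCell (C.hom c₀ c₁)) (C.mul c₁ c₂ c₃)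
    (.single θ₁) (.pair θ₂ θ₃ rfl) (.cons (.pair θ₁ θ₂ rfl) θ₃ h) h' rfl
    (VDGraph.CellPath.cons_heq _ _ rfl rfl rfl rfl rfl rfl rfl
      (VDGraph.CellPath.cons_heq _ _ rfl rfl rfl rfl rfl rfl rfl HEq.rfl HEq.rfl) HEq.rfl)
    (Category.comp_id _) (Category.comp_id _)
    (Category.comp_id _) (Category.comp_id _) (Category.comp_id _) (Category.comp_id _)
    (Category.comp_id _) (Category.comp_id _) (Category.comp_id _)
  rw [C.mul_assoc] at h₁
  rw [A.id_comp'] at h₁ h₂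
  exact h₁.symm.trans h₂

end ECat

end Enr
end VEnr
namespace VEnr
section Enr2
universe u w v
open Bicategory

/-! ### The 2-category of enriched categories -/

variable {A : VDC.{w}}

namespace EFunctor

theorem ext' {C D : ECat.{u} A} {f g : EFunctor C D} (h₀ : ∀ c, f.obj c = g.obj c)
    (h₁ : ∀ c, f.app c ≍ g.app c) (h₂ : ∀ c c', f.cell c c' ≍ g.cell c c') : f = g := by
  obtain ⟨fo, fa, fc, _, _⟩ := f
  obtain ⟨go, ga, gc, _, _⟩ := g
  obtain rfl : fo = go := funext h₀
  obtain rfl : fa = ga := funext fun c => eq_of_heq (h₁ c)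
  obtain rfl : fc = gc := funext fun c => funext fun c' => eq_of_heq (h₂ c c')
  rfl

theorem cell_m {C D : ECat.{u} A} (g : EFunctor C D) {c₀ c₁ c₂ : C.ob} {a a' a'' : A.Obj}
    {p : HPath A.HMor a a'} {p' : HPath A.HMor a' a''} {P : HPath A.HMor a a''}
    {u : a ⟶ C.extent c₀} {u' : a' ⟶ C.extent c₁} {u'' : a'' ⟶ C.extent c₂}
    {x : a ⟶ D.extent (g.obj c₀)} {x' : a' ⟶ D.extent (g.obj c₁)} {x'' : a'' ⟶ D.extent (g.obj c₂)}
    (θ : A.Cell p u u' (C.hom c₀ c₁)) (θ' : A.Cell p' u' u'' (C.hom c₁ c₂)) (h : p.comp p' = P)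
    (hx : u ≫ g.app c₀ = x) (hx' : u' ≫ g.app c₁ = x') (hx'' : u'' ≫ g.app c₂ = x'') :
    A.comp (g.cell c₀ c₂) (.single (C.m θ θ' h)) hx hx'' =
      D.m (A.comp (g.cell c₀ c₁) (.single θ) hx hx') (A.comp (g.cell c₁ c₂) (.single θ') hx' hx'')
        h := by
  refine (A.comp_comp_single (g.cell c₀ c₂) (C.mul c₀ c₁ c₂) (.pair θ θ' h) (Category.id_comp _)
    (Category.id_comp _) hx hx'' _ _ _ _).symm.trans ?_
  rw [g.map_mul]
  refine A.comp_comp_pair _ _ _ (.single θ) (.single θ') (.pair θ θ' h) _ _ ?_ _ _ _ _ _ _ _ _ _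
  exact VDGraph.CellPath.cons_heq _ _ rfl rfl rfl rfl rfl rfl rfl HEq.rfl HEq.rfl

theorem cell_e {C D : ECat.{u} A} (g : EFunctor C D) {c : C.ob} {a : A.Obj} (u : a ⟶ C.extent c)
    {x : a ⟶ D.extent (g.obj c)} (hx hx' : u ≫ g.app c = x) :
    A.comp (g.cell c c) (.single (C.e c u)) hx hx' = D.e (g.obj c) x := by
  refine (A.comp_comp_single (g.cell c c) (C.unit c) (.nil u) (Category.id_comp _)
    (Category.id_comp _) hx hx' _ _ _ _).symm.trans ?_
  rw [g.map_unit]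
  exact A.comp_nil_nil _ _ _ _ _ hx _ _

/-- The identity functor. -/
@[reducible]
def id (C : ECat.{u} A) : EFunctor C C where
  obj c := c
  app c := 𝟙 _
  cell c c' := A.idCell _
  map_unit c := (A.id_comp' _).trans (A.comp_id' (C.unit c)).symm
  map_mul c₀ c₁ c₂ := (A.id_comp' _).trans (A.comp_id' (C.mul c₀ c₁ c₂)).symm

/-- Composition of functors. -/
@[reducible]
def comp {C D E : ECat.{u} A} (f : EFunctor C D) (g : EFunctor D E) : EFunctor C E where
  obj c := g.obj (f.obj c)
  app c := f.app c ≫ g.app (f.obj c)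
  cell c c' := A.comp (g.cell _ _) (.single (f.cell c c')) rfl rfl
  map_unit c := by
    refine (A.comp_comp_single (g.cell _ _) (f.cell c c) (.single (C.unit c)) rfl rfl _ _
      (Category.id_comp _) (Category.id_comp _) rfl rfl).trans ?_
    rw [f.map_unit]
    exact g.cell_e (f.app c) rfl rfl
  map_mul c₀ c₁ c₂ := by
    refine (A.comp_comp_single (g.cell _ _) (f.cell c₀ c₂) (.single (C.mul c₀ c₁ c₂)) rfl rfl _ _
      (Category.id_comp _) (Category.id_comp _) rfl rfl).trans ?_
    rw [f.map_mul]
    exact g.cell_m (f.cell c₀ c₁) (f.cell c₁ c₂) rfl rfl rfl rfl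

end EFunctor

namespace ENatTrans

variable {C D E : ECat.{u} A}

theorem ext' {f g : EFunctor C D} {α β : ENatTrans f g} (h : ∀ c, α.app c = β.app c) : α = β := by
  obtain ⟨a, _⟩ := α
  obtain ⟨b, _⟩ := β
  obtain rfl : a = b := funext h
  rfl

theorem heq {f g f' g' : EFunctor C D} (hf : f = f') (hg : g = g') {α : ENatTrans f g}
    {β : ENatTrans f' g'} (h : ∀ c, α.app c ≍ β.app c) : α ≍ β := by
  subst hf hg
  exact heq_of_eq (ext' fun c => eq_of_heq (h c))

theorem nat {f g : EFunctor C D} (α : ENatTrans f g) (c c' : C.ob) :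
    D.m (P := .single (C.hom c c')) (α.app c) (g.cell c c') rfl =
      D.m (P := .single (C.hom c c')) (f.cell c c') (α.app c') rfl :=
  α.naturality _ _

/-- The identity natural transformation. -/
def id (f : EFunctor C D) : ENatTrans f f where
  app c := D.e (f.obj c) (f.app c)
  naturality c c' := (D.e_m (f.cell c c') rfl).trans (D.m_e (f.cell c c')).symm

/-- Vertical composition of natural transformations. -/
def vcomp {f g h : EFunctor C D} (α : ENatTrans f g) (β : ENatTrans g h) : ENatTrans f h where
  app c := D.m (α.app c) (β.app c) rfl
  naturality c c' :=
    (D.m_assoc (α.app c) (β.app c) (h.cell c c') rfl rfl rfl rfl).trans <|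
    (congrArg (fun θ => D.m (P := .single (C.hom c c')) (α.app c) θ rfl) (β.nat c c')).trans <|
    (D.m_assoc (α.app c) (g.cell c c') (β.app c') rfl rfl rfl rfl).symm.trans <|
    (congrArg (fun θ => D.m (P := .single (C.hom c c')) θ (β.app c') rfl) (α.nat c c')).trans <|
    D.m_assoc (f.cell c c') (α.app c') (β.app c') rfl rfl rfl rfl

/-- Whiskering with a functor on the source side. -/
def whiskerL (f : EFunctor C D) {g h : EFunctor D E} (α : ENatTrans g h) :
    ENatTrans (f.comp g) (f.comp h) where
  app c := A.comp (α.app (f.obj c)) (.nil (f.app c)) rfl rfl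
  naturality c c' :=
    (E.m_comp (P := .single (D.hom (f.obj c) (f.obj c'))) (α.app (f.obj c)) (h.cell _ _) rfl
      (.nil (f.app c)) (.single (f.cell c c'))
      (.single (f.cell c c')) rfl HEq.rfl rfl rfl rfl).symm.trans <|
    (congrArg (fun θ => A.comp θ (.single (f.cell c c')) rfl rfl)
      (α.nat (f.obj c) (f.obj c'))).trans <|
    E.m_comp (P := .single (D.hom (f.obj c) (f.obj c'))) (g.cell _ _) (α.app (f.obj c')) rfl
      (.single (f.cell c c')) (.nil (f.app c'))
      (.single (f.cell c c')) rfl HEq.rfl rfl rfl rfl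

/-- Whiskering with a functor on the target side. -/
def whiskerR {f g : EFunctor C D} (α : ENatTrans f g) (h : EFunctor D E) :
    ENatTrans (f.comp h) (g.comp h) where
  app c := A.comp (h.cell _ _) (.single (α.app c)) rfl rfl
  naturality c c' :=
    (h.cell_m (P := .single (C.hom c c')) (α.app c) (g.cell c c') rfl rfl rfl rfl).symm.trans <|
    (congrArg (fun θ => A.comp (h.cell _ _) (.single θ) rfl rfl) (α.nat c c')).trans <|
    h.cell_m (P := .single (C.hom c c')) (f.cell c c') (α.app c') rfl rfl rfl rfl

end ENatTrans

namespace ECat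

instance : CategoryStruct (ECat.{u} A) where
  Hom := EFunctor
  id := EFunctor.id
  comp f g := f.comp g

instance (C D : ECat.{u} A) : Category (C ⟶ D) where
  Hom f g := ENatTrans f g
  id f := ENatTrans.id f
  comp α β := ENatTrans.vcomp α β
  id_comp {f g} α := ENatTrans.ext' fun c => D.e_m _ rfl
  comp_id {f g} α := ENatTrans.ext' fun c => D.m_e _
  assoc α β γ := ENatTrans.ext' fun c => D.m_assoc _ _ _ _ _ _ _

theorem id_comp₁ {C D : ECat.{u} A} (f : C ⟶ D) : 𝟙 C ≫ f = f :=
  EFunctor.ext' (fun _ => rfl) (fun _ => heq_of_eq (Category.id_comp _)) fun c c' =>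
    HEq.trans (A.comp_heq _ _ _ _ rfl rfl rfl rfl rfl rfl rfl HEq.rfl HEq.rfl)
      (heq_of_eq (A.comp_id' (f.cell c c')))

theorem comp_id₁ {C D : ECat.{u} A} (f : C ⟶ D) : f ≫ 𝟙 D = f :=
  EFunctor.ext' (fun _ => rfl) (fun _ => heq_of_eq (Category.comp_id _)) fun c c' =>
    HEq.trans (A.comp_heq _ _ _ _ rfl rfl rfl rfl rfl rfl rfl HEq.rfl HEq.rfl)
      (heq_of_eq (A.id_comp' (f.cell c c')))

theorem assoc₁ {C D E F : ECat.{u} A} (f : C ⟶ D) (g : D ⟶ E) (h : E ⟶ F) :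
    (f ≫ g) ≫ h = f ≫ g ≫ h :=
  EFunctor.ext' (fun _ => rfl) (fun _ => heq_of_eq (Category.assoc _ _ _)) fun c c' =>
    HEq.symm (HEq.trans (heq_of_eq (A.comp_comp_single (h.cell _ _) (g.cell _ _)
      (.single (f.cell c c')) rfl rfl rfl rfl rfl rfl (Category.assoc _ _ _)
      (Category.assoc _ _ _)))
      (A.comp_heq _ _ _ _ rfl rfl rfl rfl rfl rfl rfl HEq.rfl HEq.rfl))

/-- The 2-category of small categories, functors and natural transformations enriched over a
virtual double category. -/
@[reducible]
def core : TwoCatCore (ECat.{u} A) where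
  id_comp := id_comp₁
  comp_id := comp_id₁
  assoc := assoc₁
  wl f _ _ α := ENatTrans.whiskerL f α
  wr α h := ENatTrans.whiskerR α h
  wl_id {C D E} f g := ENatTrans.ext' fun c => E.e_comp _ _ _ _ _
  wl_comp {C D E} f {g h i} α β := ENatTrans.ext' fun c =>
    E.m_comp (α.app (f.obj c)) (β.app (f.obj c)) rfl (.nil (f.app c)) (.nil (f.app c))
      (.nil (f.app c)) rfl HEq.rfl rfl rfl rfl
  id_wr {C D E} f g := ENatTrans.ext' fun c => g.cell_e (f.app c) rfl rfl
  comp_wr {C D E} {f g h} α β i := ENatTrans.ext' fun c =>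
    i.cell_m (α.app c) (β.app c) rfl rfl rfl rfl
  exchange {C D E} {f g h i} α β := ENatTrans.ext' fun c =>
    (E.m_comp (P := .single (D.hom (f.obj c) (g.obj c))) (β.app (f.obj c)) (i.cell _ _) rfl
      (.nil (f.app c)) (.single (α.app c)) (.single (α.app c)) rfl HEq.rfl rfl rfl rfl).symm.trans <|
    (congrArg (fun θ => A.comp θ (.single (α.app c)) rfl rfl)
      (β.nat (f.obj c) (g.obj c))).trans <|
    E.m_comp (P := .single (D.hom (f.obj c) (g.obj c))) (h.cell _ _) (β.app (g.obj c)) rfl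
      (.single (α.app c)) (.nil (g.app c)) (.single (α.app c)) rfl HEq.rfl rfl rfl rfl
  id_wl {C D f g} α := ENatTrans.heq (id_comp₁ f) (id_comp₁ g) fun c =>
    HEq.trans (A.comp_heq _ _ _ _ rfl rfl rfl rfl rfl rfl rfl HEq.rfl HEq.rfl)
      (heq_of_eq (A.comp_id' (α.app c)))
  wr_id {C D f g} α := ENatTrans.heq (comp_id₁ f) (comp_id₁ g) fun c =>
    HEq.trans (A.comp_heq _ _ _ _ rfl rfl rfl rfl rfl rfl rfl HEq.rfl HEq.rfl)
      (heq_of_eq (A.id_comp' (α.app c)))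
  comp_wl {C D E F} f g {h h'} α := ENatTrans.heq (assoc₁ f g h) (assoc₁ f g h') fun c =>
    HEq.symm (HEq.trans (heq_of_eq (A.comp_nil_nil (α.app (g.obj (f.obj c))) rfl rfl rfl rfl rfl
      (Category.assoc _ _ _) (Category.assoc _ _ _)))
      (A.comp_heq _ _ _ _ rfl rfl rfl rfl rfl rfl rfl HEq.rfl HEq.rfl))
  wr_comp {C D E F} {f f'} α g h := ENatTrans.heq (assoc₁ f g h).symm (assoc₁ f' g h).symm fun c =>
    HEq.trans (heq_of_eq (A.comp_comp_single (h.cell _ _) (g.cell _ _) (.single (α.app c))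
      rfl rfl rfl rfl rfl rfl (Category.assoc _ _ _) (Category.assoc _ _ _)))
      (A.comp_heq _ _ _ _ rfl rfl rfl rfl rfl rfl rfl HEq.rfl HEq.rfl)
  wl_wr {C D E F} f {g g'} α h := ENatTrans.heq (assoc₁ f g h) (assoc₁ f g' h) fun c =>
    HEq.symm (HEq.trans (heq_of_eq (A.comp_comp_single (h.cell _ _) (α.app (f.obj c))
      (.nil (f.app c)) rfl rfl rfl rfl rfl rfl (Category.assoc _ _ _) (Category.assoc _ _ _)))
      (A.comp_heq _ _ _ _ rfl rfl rfl rfl rfl rfl rfl HEq.rfl HEq.rfl))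

instance : Bicategory (ECat.{u} A) := core.bicategory

instance : Strict (ECat.{u} A) := core.strict

end ECat

end Enr2
end VEnr
namespace VEnr
section Enr3
universe u w v
open Bicategory

/-! ### The 2-functor `Enr` -/

theorem VDGraph.CellPath.pair_heq {A : VDGraph.{w}} {a a' a'' b b' b'' : A.Obj}
    {p p₁ : HPath A.HMor a a'} {u u₁ : a ⟶ b} {u' u₁' : a' ⟶ b'} {Ω Ω₁ : A.HMor b b'}
    {θ : A.Cell p u u' Ω} {θ₁ : A.Cell p₁ u₁ u₁' Ω₁} {r r₁ : HPath A.HMor a' a''}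
    {u'' u₁'' : a'' ⟶ b''} {Ω' Ω₁' : A.HMor b' b''} {θ' : A.Cell r u' u'' Ω'}
    {θ₁' : A.Cell r₁ u₁' u₁'' Ω₁'} {P P₁ : HPath A.HMor a a''} (h : p.comp r = P)
    (h₁ : p₁.comp r₁ = P₁) (ep : p = p₁) (eu : u = u₁) (eu' : u' = u₁') (eΩ : Ω = Ω₁) (er : r = r₁)
    (eu'' : u'' = u₁'') (eΩ' : Ω' = Ω₁') (eθ : θ ≍ θ₁) (eθ' : θ' ≍ θ₁') :
    pair θ θ' h ≍ pair θ₁ θ₁' h₁ := by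
  subst ep eu eu' er eu'' eΩ eΩ' eθ eθ' h h₁; rfl

variable {A B : VDC.{w}}

theorem ECat.ext' {C D : ECat.{u} A} (h₀ : C.ob = D.ob) (h₁ : C.extent ≍ D.extent)
    (h₂ : C.hom ≍ D.hom) (h₃ : C.unit ≍ D.unit) (h₄ : C.mul ≍ D.mul) : C = D := by
  obtain ⟨o, x, h, e, m, _, _, _⟩ := C
  obtain ⟨o', x', h', e', m', _, _, _⟩ := D
  cases h₀; cases h₁; cases h₂; cases h₃; cases h₄
  rfl

theorem EFunctor.heq {C D C' D' : ECat.{u} A} (hC : C = C') (hD : D = D') {f : EFunctor C D}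
    {g : EFunctor C' D'} (h₀ : f.obj ≍ g.obj) (h₁ : f.app ≍ g.app) (h₂ : f.cell ≍ g.cell) :
    f ≍ g := by
  subst hC hD
  obtain ⟨fo, fa, fc, _, _⟩ := f
  obtain ⟨go, ga, gc, _, _⟩ := g
  cases h₀; cases h₁; cases h₂
  rfl

theorem ENatTrans.heq' {C D C' D' : ECat.{u} A} (hC : C = C') (hD : D = D') {f g : EFunctor C D}
    {f' g' : EFunctor C' D'} (hf : f ≍ f') (hg : g ≍ g') {α : ENatTrans f g} {β : ENatTrans f' g'}
    (h : α.app ≍ β.app) : α ≍ β := by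
  subst hC hD hf hg
  exact heq_of_eq (ENatTrans.ext' fun c => congrFun (eq_of_heq h) c)

/-- The image of an enriched category under a virtual double functor. -/
@[reducible]
def ECat.map (F : VDFunctor A B) (C : ECat.{u} A) : ECat.{u} B where
  ob := C.ob
  extent c := F.V.obj (C.extent c)
  hom c c' := F.mapH (C.hom c c')
  unit c := B.castC rfl (F.V.map_id _) (F.V.map_id _) (F.mapCell (C.unit c))
  mul c₀ c₁ c₂ := B.castC rfl (F.V.map_id _) (F.V.map_id _) (F.mapCell (C.mul c₀ c₁ c₂))
  unit_mul c c' := by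
    have h := congrArg F.mapCell (C.unit_mul c c')
    rw [F.map_comp] at h
    refine eq_of_heq (HEq.trans ?_ ((heq_of_eq h).trans (F.map_idCell_heq _)))
    exact B.comp_heq _ _ _ _ rfl (F.V.map_id _).symm (F.V.map_id _).symm rfl (F.V.map_id _).symm
      (F.V.map_id _).symm rfl (B.castC_heq _ _ _ _)
      (VDGraph.CellPath.pair_heq _ _ rfl (F.V.map_id _).symm (F.V.map_id _).symm rfl rfl
        (F.V.map_id _).symm rfl (B.castC_heq _ _ _ _) (F.map_idCell_heq _).symm)
  mul_unit c c' := by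
    have h := congrArg F.mapCell (C.mul_unit c c')
    rw [F.map_comp] at h
    refine eq_of_heq (HEq.trans ?_ ((heq_of_eq h).trans (F.map_idCell_heq _)))
    exact B.comp_heq _ _ _ _ rfl (F.V.map_id _).symm (F.V.map_id _).symm rfl (F.V.map_id _).symm
      (F.V.map_id _).symm rfl (B.castC_heq _ _ _ _)
      (VDGraph.CellPath.pair_heq _ _ rfl (F.V.map_id _).symm (F.V.map_id _).symm rfl rfl
        (F.V.map_id _).symm rfl (F.map_idCell_heq _).symm (B.castC_heq _ _ _ _))
  mul_assoc c₀ c₁ c₂ c₃ := by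
    have h := congrArg F.mapCell (C.mul_assoc c₀ c₁ c₂ c₃)
    rw [F.map_comp, F.map_comp] at h
    refine eq_of_heq (HEq.trans ?_ ((heq_of_eq h).trans ?_))
    · exact B.comp_heq _ _ _ _ rfl (F.V.map_id _).symm (F.V.map_id _).symm rfl (F.V.map_id _).symm
        (F.V.map_id _).symm rfl (B.castC_heq _ _ _ _)
        (VDGraph.CellPath.pair_heq _ _ rfl (F.V.map_id _).symm (F.V.map_id _).symm rfl rfl
          (F.V.map_id _).symm rfl (B.castC_heq _ _ _ _) (F.map_idCell_heq _).symm)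
    · exact B.comp_heq _ _ _ _ rfl (F.V.map_id _) (F.V.map_id _) rfl (F.V.map_id _)
        (F.V.map_id _) rfl (B.castC_heq _ _ _ _).symm
        (VDGraph.CellPath.pair_heq _ _ rfl (F.V.map_id _) (F.V.map_id _) rfl rfl
          (F.V.map_id _) rfl (F.map_idCell_heq _) (B.castC_heq _ _ _ _).symm)

theorem ECat.map_unit_heq (F : VDFunctor A B) (C : ECat.{u} A) (c : C.ob) :
    (C.map F).unit c ≍ F.mapCell (C.unit c) :=
  B.castC_heq rfl (F.V.map_id _) (F.V.map_id _) _

theorem ECat.map_mul_heq (F : VDFunctor A B) (C : ECat.{u} A) (c₀ c₁ c₂ : C.ob) :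
    (C.map F).mul c₀ c₁ c₂ ≍ F.mapCell (C.mul c₀ c₁ c₂) :=
  B.castC_heq rfl (F.V.map_id _) (F.V.map_id _) _

/-- The image of an enriched functor under a virtual double functor. -/
@[reducible]
def EFunctor.map (F : VDFunctor A B) {C D : ECat.{u} A} (f : EFunctor C D) :
    EFunctor (C.map F) (D.map F) where
  obj := f.obj
  app c := F.V.map (f.app c)
  cell c c' := F.mapCell (f.cell c c')
  map_unit c := by
    have h := congrArg F.mapCell (f.map_unit c)
    rw [F.map_comp, F.map_comp] at h
    refine eq_of_heq (HEq.trans ?_ ((heq_of_eq h).trans ?_))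
    · exact B.comp_heq _ _ _ _ rfl (F.V.map_id _).symm (F.V.map_id _).symm rfl rfl rfl rfl HEq.rfl
        (VDGraph.CellPath.single_heq rfl (F.V.map_id _).symm (F.V.map_id _).symm rfl
          (C.map_unit_heq F c))
    · exact B.comp_heq _ _ _ _ rfl rfl rfl rfl (F.V.map_id _) (F.V.map_id _) rfl
        (D.map_unit_heq F _).symm HEq.rfl
  map_mul c₀ c₁ c₂ := by
    have h := congrArg F.mapCell (f.map_mul c₀ c₁ c₂)
    rw [F.map_comp, F.map_comp] at h
    refine eq_of_heq (HEq.trans ?_ ((heq_of_eq h).trans ?_))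
    · exact B.comp_heq _ _ _ _ rfl (F.V.map_id _).symm (F.V.map_id _).symm rfl rfl rfl rfl HEq.rfl
        (VDGraph.CellPath.single_heq rfl (F.V.map_id _).symm (F.V.map_id _).symm rfl
          (C.map_mul_heq F _ _ _))
    · exact B.comp_heq _ _ _ _ rfl rfl rfl rfl (F.V.map_id _) (F.V.map_id _) rfl
        (D.map_mul_heq F _ _ _).symm HEq.rfl

/-- The image of an enriched natural transformation under a virtual double functor. -/
@[reducible]
def ENatTrans.map (F : VDFunctor A B) {C D : ECat.{u} A} {f g : EFunctor C D} (α : ENatTrans f g) :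
    ENatTrans (f.map F) (g.map F) where
  app c := F.mapCell (α.app c)
  naturality c c' := by
    have h := congrArg F.mapCell (α.naturality c c')
    rw [F.map_comp, F.map_comp] at h
    refine eq_of_heq (HEq.trans ?_ ((heq_of_eq h).trans ?_))
    · exact B.comp_heq _ _ _ _ rfl rfl rfl rfl (F.V.map_id _).symm (F.V.map_id _).symm rfl
        (D.map_mul_heq F _ _ _) HEq.rfl
    · exact B.comp_heq _ _ _ _ rfl rfl rfl rfl (F.V.map_id _) (F.V.map_id _) rfl
        (D.map_mul_heq F _ _ _).symm HEq.rfl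

theorem EFunctor.map_id (F : VDFunctor A B) (C : ECat.{u} A) :
    EFunctor.map F (EFunctor.id C) = EFunctor.id (C.map F) :=
  EFunctor.ext' (fun _ => rfl) (fun _ => heq_of_eq (F.V.map_id _)) fun _ _ => F.map_idCell_heq _

theorem EFunctor.map_comp (F : VDFunctor A B) {C D E : ECat.{u} A} (f : EFunctor C D)
    (g : EFunctor D E) : EFunctor.map F (f.comp g) = (f.map F).comp (g.map F) :=
  EFunctor.ext' (fun _ => rfl) (fun _ => heq_of_eq (F.V.map_comp _ _)) fun _ _ =>
    (heq_of_eq (F.map_comp _ _ _ _)).trans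
      (B.comp_heq _ _ _ _ rfl rfl rfl rfl rfl rfl rfl HEq.rfl HEq.rfl)

/-- The 2-functor from categories enriched over `A` to categories enriched over `B` induced by a
virtual double functor. -/
def enrMap (F : VDFunctor A B) : StrictPseudofunctor (ECat.{u} A) (ECat.{u} B) :=
  mkTwoFunctor (fun C => C.map F) (fun f => EFunctor.map F f) (fun α => ENatTrans.map F α)
    (fun C => EFunctor.map_id F C)
    (fun f g => EFunctor.map_comp F f g)
    (fun {C D} f => ENatTrans.ext' fun c => eq_of_heq <|
      (heq_of_eq (F.map_comp _ _ _ _)).trans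
        (B.comp_heq _ _ _ _ rfl rfl rfl rfl (F.V.map_id _) (F.V.map_id _) rfl
          (D.map_unit_heq F _).symm HEq.rfl))
    (fun {C D f g h} α β => ENatTrans.ext' fun c => eq_of_heq <|
      (heq_of_eq (F.map_comp _ _ _ _)).trans
        (B.comp_heq _ _ _ _ rfl rfl rfl rfl (F.V.map_id _) (F.V.map_id _) rfl
          (D.map_mul_heq F _ _ _).symm HEq.rfl))
    (fun {C D E} f g h α => ENatTrans.heq (EFunctor.map_comp F f g) (EFunctor.map_comp F f h) fun c =>
      (heq_of_eq (F.map_comp _ _ _ _)).trans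
        (B.comp_heq _ _ _ _ rfl rfl rfl rfl rfl rfl rfl HEq.rfl HEq.rfl))
    (fun {C D E f g} α h => ENatTrans.heq (EFunctor.map_comp F f h) (EFunctor.map_comp F g h) fun c =>
      (heq_of_eq (F.map_comp _ _ _ _)).trans
        (B.comp_heq _ _ _ _ rfl rfl rfl rfl rfl rfl rfl HEq.rfl HEq.rfl))

/-- The enriched functor `F C → G C` induced by a vertical transformation `F → G`. -/
@[reducible]
def enrApp {F G : VDFunctor A B} (α : VertTrans F G) (C : ECat.{u} A) :
    EFunctor (C.map F) (C.map G) where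
  obj c := c
  app c := α.app.app (C.extent c)
  cell c c' := α.cell (C.hom c c')
  map_unit c := by
    refine eq_of_heq (HEq.trans ?_ ((heq_of_eq (α.naturality (C.unit c))).trans ?_))
    · exact B.comp_heq _ _ _ _ rfl (F.V.map_id _).symm (F.V.map_id _).symm rfl rfl rfl rfl HEq.rfl
        (VDGraph.CellPath.single_heq rfl (F.V.map_id _).symm (F.V.map_id _).symm rfl
          (C.map_unit_heq F c))
    · exact B.comp_heq _ _ _ _ rfl rfl rfl rfl (G.V.map_id _) (G.V.map_id _) rfl
        (C.map_unit_heq G c).symm HEq.rfl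
  map_mul c₀ c₁ c₂ := by
    refine eq_of_heq (HEq.trans ?_ ((heq_of_eq (α.naturality (C.mul c₀ c₁ c₂))).trans ?_))
    · exact B.comp_heq _ _ _ _ rfl (F.V.map_id _).symm (F.V.map_id _).symm rfl rfl rfl rfl HEq.rfl
        (VDGraph.CellPath.single_heq rfl (F.V.map_id _).symm (F.V.map_id _).symm rfl
          (C.map_mul_heq F _ _ _))
    · exact B.comp_heq _ _ _ _ rfl rfl rfl rfl (G.V.map_id _) (G.V.map_id _) rfl
        (C.map_mul_heq G _ _ _).symm HEq.rfl

/-- The 2-natural transformation induced by a vertical transformation. -/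
def enrMap₂ {F G : VDFunctor A B} (α : VertTrans F G) :
    TwoNatTrans (enrMap.{u} F) (enrMap.{u} G) :=
  have nat : ∀ {C D : ECat.{u} A} (f : EFunctor C D),
      (f.map F).comp (enrApp α D) = (enrApp α C).comp (f.map G) := fun f =>
    EFunctor.ext' (fun _ => rfl) (fun _ => heq_of_eq (α.app.naturality _)) fun c c' =>
      HEq.trans (B.comp_heq _ _ _ _ rfl rfl rfl rfl rfl rfl rfl HEq.rfl HEq.rfl)
        ((heq_of_eq (α.naturality (f.cell c c'))).trans
          (B.comp_heq _ _ _ _ rfl rfl rfl rfl rfl rfl rfl HEq.rfl HEq.rfl))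
  TwoNatTrans.mk' (fun C => enrApp α C) (fun f => nat f)
    (fun {C D f g} τ => ENatTrans.heq (nat f) (nat g) fun c =>
      HEq.trans (B.comp_heq _ _ _ _ rfl rfl rfl rfl rfl rfl rfl HEq.rfl HEq.rfl)
        ((heq_of_eq (α.naturality (τ.app c))).trans
          (B.comp_heq _ _ _ _ rfl rfl rfl rfl rfl rfl rfl HEq.rfl HEq.rfl)))

theorem ECat.map_id (C : ECat.{u} A) : C.map (VDFunctor.id A) = C :=
  ECat.ext' rfl HEq.rfl HEq.rfl
    (heq_of_eq (funext fun c => eq_of_heq ((C.map_unit_heq _ c).trans (VDMap.id_mapCell _))))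
    (heq_of_eq (funext fun c₀ => funext fun c₁ => funext fun c₂ =>
      eq_of_heq ((C.map_mul_heq (VDFunctor.id A) c₀ c₁ c₂).trans
        (VDMap.id_mapCell (C.mul c₀ c₁ c₂)))))

theorem ECat.map_comp {B' : VDC.{w}} (F : VDFunctor A B) (G : VDFunctor B B') (C : ECat.{u} A) :
    C.map (F.comp G) = (C.map F).map G :=
  ECat.ext' rfl HEq.rfl HEq.rfl
    (heq_of_eq (funext fun c => eq_of_heq ((C.map_unit_heq _ c).trans <|
      (VDMap.comp_mapCell F.toVDMap G.toVDMap (C.unit c)).trans  <|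
      (G.mapCell_heq rfl (F.V.map_id _).symm (F.V.map_id _).symm (C.map_unit_heq F c)).symm.trans
      ((C.map F).map_unit_heq G c).symm)))
    (heq_of_eq (funext fun c₀ => funext fun c₁ => funext fun c₂ =>
      eq_of_heq ((C.map_mul_heq _ c₀ c₁ c₂).trans <|
      (VDMap.comp_mapCell F.toVDMap G.toVDMap (C.mul c₀ c₁ c₂)).trans  <|
      (G.mapCell_heq rfl (F.V.map_id _).symm (F.V.map_id _).symm (C.map_mul_heq F c₀ c₁ c₂)).symm.trans
      ((C.map F).map_mul_heq G c₀ c₁ c₂).symm)))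

theorem enrMap_id (A : VDC.{w}) : enrMap.{u} (VDFunctor.id A) = StrictPseudofunctor.id (ECat.{u} A) :=
  have h : ∀ {C D : ECat.{u} A} (f : EFunctor C D), f.map (VDFunctor.id A) ≍ f := fun {C D} f =>
    EFunctor.heq (ECat.map_id C) (ECat.map_id D) HEq.rfl HEq.rfl
      (heq_of_eq (funext fun c => funext fun c' => eq_of_heq (VDMap.id_mapCell (f.cell c c'))))
  twoFunctor_ext (fun C => ECat.map_id C) (fun f => h f)
    fun {C D f g} α => ENatTrans.heq' (ECat.map_id C) (ECat.map_id D) (h f) (h g)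
      (heq_of_eq (funext fun c => eq_of_heq (VDMap.id_mapCell (ENatTrans.app α c))))

theorem enrMap_comp {B' : VDC.{w}} (F : VDFunctor A B) (G : VDFunctor B B') :
    enrMap.{u} (F.comp G) = (enrMap.{u} F).comp (enrMap.{u} G) :=
  have h : ∀ {C D : ECat.{u} A} (f : EFunctor C D), f.map (F.comp G) ≍ (f.map F).map G :=
    fun {C D} f =>
    EFunctor.heq (ECat.map_comp F G C) (ECat.map_comp F G D) HEq.rfl HEq.rfl
      (heq_of_eq (funext fun c => funext fun c' => eq_of_heq
        (VDMap.comp_mapCell F.toVDMap G.toVDMap (f.cell c c'))))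
  twoFunctor_ext (fun C => ECat.map_comp F G C) (fun f => h f)
    fun {C D f g} α => ENatTrans.heq' (ECat.map_comp F G C) (ECat.map_comp F G D) (h f) (h g)
      (heq_of_eq (funext fun c => eq_of_heq
        (VDMap.comp_mapCell F.toVDMap G.toVDMap (ENatTrans.app α c))))

/-- The 2-functor `Enr : VDBL → 2-CAT`, sending a virtual double category `A` to the 2-category of
small `A`-categories, `A`-functors and `A`-natural transformations. Small sets are the members of
`Type u`, whereas virtual double categories and 2-categories are large, with all data in
`Type (max (u + 1) v)`. -/
def Enr : StrictPseudofunctor VDC.{max (u + 1) v} TwoCAT.{max (u + 1) v} :=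
  mkTwoFunctor (fun A => ⟨ECat.{u} A⟩) (fun F => enrMap.{u} F) (fun α => enrMap₂.{u} α)
    (fun A => enrMap_id A)
    (fun F G => enrMap_comp F G)
    (fun {A B} F => TwoNatTrans.ext fun C => rfl)
    (fun {A B F G H} α β => TwoNatTrans.ext fun C => rfl)
    (fun {A B B'} F G H α => TwoNatTrans.heq (enrMap_comp F G) (enrMap_comp F H) fun C =>
      EFunctor.heq (ECat.map_comp F G C) (ECat.map_comp F H C) HEq.rfl HEq.rfl HEq.rfl)
    (fun {A B B' F G} α H => TwoNatTrans.heq (enrMap_comp F H) (enrMap_comp G H) fun C =>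
      EFunctor.heq (ECat.map_comp F H C) (ECat.map_comp G H C) HEq.rfl HEq.rfl HEq.rfl)

end Enr3
end VEnr

universe u v

set_option linter.unusedSectionVars false

/-! ### Left 2-adjoints from universal arrows -/

namespace VEnr
section Universal
universe w w₁ v₁ u₁
open Bicategory

/-! A category enriched over the terminal virtual double category is just a set, a functor between
two of them is a function, and there is exactly one transformation between any two functions. An
object of the slice over `Enr 1` is therefore a 2-category `X` with a functor from its underlying
category to sets, and a morphism from it to `Enr A` is a diagram of `A`-categories indexed by `X`
whose sets of objects are prescribed.

Such a diagram assigns an object of `A` to each element `(x, i)`, a vertical morphism to each 1-cell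
acting on an element, a horizontal morphism to each pair of elements of one set, and multicells for
units, multiplications, the actions of 1-cells on homs and the components of 2-cells. This is the
same as a virtual double functor out of the virtual double category of elements `Elt.vdc`. There, a
vertical morphism is a 1-cell carrying one element to another, there is one horizontal morphism
between any two elements over the same `x`, and a multicell with vertical boundaries `f`, `f'` is a
2-cell `f ⟶ f'`, whatever string lies above it. Each multicell has a normal form: the nullary
multicell of the same 2-cell, multiplied by the actions of `f'` on the homs of the string
(`Elt.m_cell`). The normal form proves uniqueness of the classifying functor
(`Elt.universal_hom_ext`). Read as a definition (`Elt.ev`), it gives existence, where the work lies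
in compatibility with composition (`Elt.liftCell_comp`). By the same induction, a 2-natural
transformation that is the identity on objects comes from a vertical transformation
(`Elt.exists_vertTrans`). Hence the diagrams `Elt.universal` are universal on 1-cells and 2-cells,
and `UniversalArrows` assembles the left 2-adjoint from them.

For the split fibrations, an `A`-category `D` can be restricted along a function `ψ` from a set into
its objects, keeping the homs between the `ψ s` (`ECat.pull`). The inclusion is fully faithful, so
it is cartesian over `ψ`. Applied pointwise, this restricts a 2-functor `X ⟶ Enr A` along a natural
family of functions. The lifts are split because restricting along an identity or a composite gives
literally the same data, and they are respected by precomposition and by `Enr F` for the same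
reason. All these strict equalities come from one uniqueness criterion, `ObNatural.restrict_unique`.
-/

theorem comp_heq_comp {C : Type u} [Category.{v} C] {a b c a' b' c' : C} (ha : a = a') (hb : b = b')
    (hc : c = c') {f : a ⟶ b} {g : b ⟶ c} {f' : a' ⟶ b'} {g' : b' ⟶ c'} (hf : f ≍ f')
    (hg : g ≍ g') : f ≫ g ≍ f' ≫ g' := by
  subst ha hb hc hf hg; rfl

theorem id_heq_id {C : Type u} [Category.{v} C] {a b : C} (h : a = b) : 𝟙 a ≍ 𝟙 b := by
  subst h; rfl

variable {K : Type u} [Bicategory.{w, v} K] {L : Type u₁} [Bicategory.{w₁, v₁} L]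

/-- A family of 1-cells `η X : X ⟶ G (F X)` such that `h ↦ η X ≫ G h` is an isomorphism of
categories from `K(F X, A)` to `L(X, G A)` for all `X` and `A`. -/
structure UniversalArrows (G : StrictPseudofunctor K L) where
  obj : L → K
  arrow (X : L) : X ⟶ G.obj (obj X)
  exists_lift {X : L} {A : K} (f : X ⟶ G.obj A) : ∃ h : obj X ⟶ A, arrow X ≫ G.map h = f
  hom_ext {X : L} {A : K} {h h' : obj X ⟶ A} :
    arrow X ≫ G.map h = arrow X ≫ G.map h' → h = h'
  exists_lift₂ {X : L} {A : K} {h h' : obj X ⟶ A} (τ : arrow X ≫ G.map h ⟶ arrow X ≫ G.map h') :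
    ∃ σ : h ⟶ h', arrow X ◁ G.map₂ σ = τ
  hom₂_ext {X : L} {A : K} {h h' : obj X ⟶ A} {σ σ' : h ⟶ h'} :
    arrow X ◁ G.map₂ σ = arrow X ◁ G.map₂ σ' → σ = σ'

namespace UniversalArrows

variable {G : StrictPseudofunctor K L} (U : UniversalArrows G)

/-- The whiskering laws of the left adjoint and the naturality of the counit compare 2-cells whose
boundaries are only propositionally equal; this is `hom₂_ext` in the form which applies there. -/
theorem hom₂_heq {X : L} {A : K} {h h' k k' : U.obj X ⟶ A} (e : h = k) (e' : h' = k') {σ : h ⟶ h'}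
    {σ' : k ⟶ k'} (H : U.arrow X ◁ G.map₂ σ ≍ U.arrow X ◁ G.map₂ σ') : σ ≍ σ' := by
  subst e e'
  exact heq_of_eq (U.hom₂_ext (eq_of_heq H))

/-- The 1-cell out of `U.obj X` which corresponds to a 1-cell out of `X`. -/
noncomputable def lift {X : L} {A : K} (f : X ⟶ G.obj A) : U.obj X ⟶ A :=
  (U.exists_lift f).choose

theorem arrow_lift {X : L} {A : K} (f : X ⟶ G.obj A) : U.arrow X ≫ G.map (U.lift f) = f :=
  (U.exists_lift f).choose_spec

/-- The left adjoint on 1-cells. -/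
noncomputable def map {X Y : L} (f : X ⟶ Y) : U.obj X ⟶ U.obj Y :=
  U.lift (f ≫ U.arrow Y)

theorem arrow_map {X Y : L} (f : X ⟶ Y) :
    U.arrow X ≫ G.map (U.map f) = f ≫ U.arrow Y :=
  U.arrow_lift _

/-- By `arrow_map`, conjugating `α ▷ U.arrow Y` with equalities gives a 2-cell to which
`exists_lift₂` applies. The heterogeneous form forgets the conjugation. -/
theorem exists_map₂ {X Y : L} {f g : X ⟶ Y} (α : f ⟶ g) :
    ∃ σ : U.map f ⟶ U.map g, U.arrow X ◁ G.map₂ σ ≍ α ▷ U.arrow Y := by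
  obtain ⟨σ, hσ⟩ := U.exists_lift₂
    (eqToHom (U.arrow_map f) ≫ α ▷ U.arrow Y ≫ eqToHom (U.arrow_map g).symm)
  exact ⟨σ, by simp [hσ]⟩

/-- The left adjoint on 2-cells. -/
noncomputable def map₂ {X Y : L} {f g : X ⟶ Y} (α : f ⟶ g) : U.map f ⟶ U.map g :=
  (U.exists_map₂ α).choose

theorem arrow_map₂ {X Y : L} {f g : X ⟶ Y} (α : f ⟶ g) :
    U.arrow X ◁ G.map₂ (U.map₂ α) ≍ α ▷ U.arrow Y :=
  (U.exists_map₂ α).choose_spec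

variable [Strict K] [Strict L]

theorem map_id (X : L) : U.map (𝟙 X) = 𝟙 (U.obj X) :=
  U.hom_ext (by rw [arrow_map, G.map_id, Strict.id_comp, Strict.comp_id])

theorem map_comp {X Y Z : L} (f : X ⟶ Y) (g : Y ⟶ Z) : U.map (f ≫ g) = U.map f ≫ U.map g :=
  U.hom_ext (by
    rw [arrow_map, G.map_comp, ← Strict.assoc, arrow_map, Strict.assoc, Strict.assoc, arrow_map])

/-- The left 2-adjoint assembled from universal arrows. -/
noncomputable def leftAdjoint : StrictPseudofunctor L K :=
  mkTwoFunctor U.obj (fun f => U.map f) (fun α => U.map₂ α) U.map_id U.map_comp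
    (fun f => U.hom₂_ext (eq_of_heq ((U.arrow_map₂ (𝟙 f)).trans (by
      rw [G.map₂_id, whiskerLeft_id, id_whiskerRight]
      exact id_heq_id (U.arrow_map f).symm))))
    (fun {X Y f g h} α β => U.hom₂_ext (eq_of_heq ((U.arrow_map₂ (α ≫ β)).trans (by
      rw [G.map₂_comp, whiskerLeft_comp, comp_whiskerRight]
      exact comp_heq_comp (U.arrow_map f).symm (U.arrow_map g).symm (U.arrow_map h).symm
        (U.arrow_map₂ α).symm (U.arrow_map₂ β).symm))))
    -- Restricted along the universal arrow of `X`, both sides become `f ◁ β ▷ U.arrow Z`: the chain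
    -- moves the arrow first past `β` and then past `f`. The next argument does the same for right
    -- whiskering.
    (fun {X Y Z} f {g h} β => U.hom₂_heq (U.map_comp f g) (U.map_comp f h) <|
      (U.arrow_map₂ (f ◁ β)).trans <|
      (wl_wr_heq f β _).trans <|
      (wl_heq rfl (U.arrow_map g).symm (U.arrow_map h).symm (U.arrow_map₂ β).symm).trans <|
      (comp_wl_heq _ _ _).symm.trans <|
      (wl_heq (U.arrow_map f).symm rfl rfl HEq.rfl).trans <|
      (comp_wl_heq _ _ _).trans <|
      wl_heq rfl (G.map_comp _ _).symm (G.map_comp _ _).symm (map₂_wl_heq G _ _).symm)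
    (fun {X Y Z f g} α h => U.hom₂_heq (U.map_comp f h) (U.map_comp g h) <|
      (U.arrow_map₂ (α ▷ h)).trans <|
      (wr_comp_heq α h _).symm.trans <|
      (wr_heq (U.arrow_map h).symm rfl rfl HEq.rfl).trans <|
      (wr_comp_heq _ _ _).trans <|
      (wr_heq rfl (U.arrow_map f).symm (U.arrow_map g).symm (U.arrow_map₂ α).symm).trans <|
      (wl_wr_heq _ _ _).trans <|
      wl_heq rfl (G.map_comp _ _).symm (G.map_comp _ _).symm (map₂_wr_heq G _ _).symm)

/-- The counit. -/
noncomputable def counit (A : K) : U.obj (G.obj A) ⟶ A :=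
  U.lift (𝟙 (G.obj A))

theorem arrow_counit (A : K) : U.arrow (G.obj A) ≫ G.map (U.counit A) = 𝟙 (G.obj A) :=
  U.arrow_lift _

theorem arrow_map_counit {A B : K} (h : A ⟶ B) :
    U.arrow (G.obj A) ≫ G.map (U.map (G.map h) ≫ U.counit B) = G.map h := by
  rw [G.map_comp, ← Strict.assoc, arrow_map, Strict.assoc, arrow_counit, Strict.comp_id]

theorem arrow_counit_comp {A B : K} (h : A ⟶ B) :
    U.arrow (G.obj A) ≫ G.map (U.counit A ≫ h) = G.map h := by
  rw [G.map_comp, ← Strict.assoc, arrow_counit, Strict.id_comp]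

theorem counit_naturality {A B : K} (h : A ⟶ B) :
    U.map (G.map h) ≫ U.counit B = U.counit A ≫ h :=
  U.hom_ext ((U.arrow_map_counit h).trans (U.arrow_counit_comp h).symm)

/-- Both sides restrict along the universal arrow of `X` to that arrow itself. -/
theorem left_triangle (X : L) : U.map (U.arrow X) ≫ U.counit (U.obj X) = 𝟙 (U.obj X) :=
  U.hom_ext (by
    rw [G.map_comp, ← Strict.assoc, arrow_map, Strict.assoc, arrow_counit, G.map_id])

/-- The 2-adjunction assembled from universal arrows. -/
noncomputable def adjunction : TwoAdjunction U.leftAdjoint G where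
  unit := TwoNatTrans.mk' U.arrow (fun f => (U.arrow_map f).symm) (fun α => (U.arrow_map₂ α).symm)
  -- For naturality on 2-cells, both composites restrict along the universal arrow of `G.obj A` to
  -- `G.map₂ σ`.
  counit := TwoNatTrans.mk' U.counit (fun h => U.counit_naturality h) (fun {A B h h'} σ =>
    U.hom₂_heq (U.counit_naturality h) (U.counit_naturality h') <|
      have h₁ : U.arrow (G.obj A) ◁ G.map₂ (U.map₂ (G.map₂ σ) ▷ U.counit B) ≍ G.map₂ σ :=
        (wl_heq rfl (G.map_comp _ _) (G.map_comp _ _) (map₂_wr_heq G _ _)).trans <|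
        (wl_wr_heq _ _ _).symm.trans <|
        (wr_heq rfl (U.arrow_map _) (U.arrow_map _) (U.arrow_map₂ _)).trans <|
        (wr_comp_heq _ _ _).symm.trans <|
        (wr_heq (U.arrow_counit B) rfl rfl HEq.rfl).trans (wr_id_heq _)
      have h₂ : U.arrow (G.obj A) ◁ G.map₂ (U.counit A ◁ σ) ≍ G.map₂ σ :=
        (wl_heq rfl (G.map_comp _ _) (G.map_comp _ _) (map₂_wl_heq G _ _)).trans <|
        (comp_wl_heq _ _ _).symm.trans <|
        (wl_heq (U.arrow_counit A) rfl rfl HEq.rfl).trans (id_wl_heq _)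
      h₁.trans h₂.symm)
  left_triangle X := U.left_triangle X
  right_triangle A := U.arrow_counit A

theorem isRightTwoAdjoint (U : UniversalArrows G) : IsRightTwoAdjoint G :=
  ⟨U.leftAdjoint, ⟨U.adjunction⟩⟩

end UniversalArrows

end Universal
end VEnr

/-! ### The virtual double category of elements -/

namespace VEnr
section Elements
universe w
open Bicategory

/-- A functor from the underlying category of a bicategory to the category of small sets. -/
structure SetDiagram (X : Type (max (u + 1) v))
    [Bicategory.{max (u + 1) v, max (u + 1) v} X] where
  S : X → Type u
  act {x y : X} : (x ⟶ y) → S x → S y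
  act_id (x : X) (i : S x) : act (𝟙 x) i = i
  act_comp {x y z : X} (f : x ⟶ y) (g : y ⟶ z) (i : S x) : act (f ≫ g) i = act g (act f i)

/-- Transport of a 1-cell along equalities of objects. -/
def castHom {X : Type w} [Quiver.{w} X] {x x' y y' : X} (hx : x = x') (hy : y = y')
    (g : x' ⟶ y') : x ⟶ y :=
  cast (by rw [hx, hy]) g

/-- Transport of a 2-cell along equalities of objects. -/
def castHom₂ {X : Type w} [Bicategory.{w, w} X] {x x' x'' y y' y'' : X} (h : x = x') (h' : y = y')
    (k : x' = x'') (k' : y' = y'') {g : x' ⟶ y'} {g' : x'' ⟶ y''} (θ : g ⟶ castHom k k' g') :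
    castHom h h' g ⟶ castHom (h.trans k) (h'.trans k') g' := by
  subst h h' k k'
  exact θ

theorem castHom_comp {X : Type w} [Bicategory.{w, w} X] {x x' y y' z z' : X} (h : x = x')
    (h' : y = y') (h'' : z = z') (f : x' ⟶ y') (g : y' ⟶ z') :
    castHom h h' f ≫ castHom h' h'' g = castHom h h'' (f ≫ g) := by
  subst h h' h''; rfl

section HComp

variable {X : Type w} [Bicategory.{w, w} X]

/-- The horizontal composition of 2-cells. -/
def hcomp {x y z : X} {f f' : x ⟶ y} {g g' : y ⟶ z} (α : f ⟶ f') (β : g ⟶ g') :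
    f ≫ g ⟶ f' ≫ g' :=
  f ◁ β ≫ α ▷ g'

theorem hcomp_heq {x y z : X} {f f' f₁ f₁' : x ⟶ y} {g g' g₁ g₁' : y ⟶ z} {α : f ⟶ f'}
    {α₁ : f₁ ⟶ f₁'} {β : g ⟶ g'} {β₁ : g₁ ⟶ g₁'} (ef : f = f₁) (ef' : f' = f₁') (eg : g = g₁)
    (eg' : g' = g₁') (eα : α ≍ α₁) (eβ : β ≍ β₁) : hcomp α β ≍ hcomp α₁ β₁ := by
  subst ef ef' eg eg' eα eβ; rfl

theorem hcomp_id {x y : X} [Strict X] {f f' : x ⟶ y} (α : f ⟶ f') : hcomp α (𝟙 (𝟙 y)) ≍ α := by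
  rw [hcomp, whiskerLeft_id, Category.id_comp]
  exact wr_id_heq α

theorem id_hcomp {x y : X} [Strict X] {f f' : x ⟶ y} (α : f ⟶ f') : hcomp (𝟙 (𝟙 x)) α ≍ α := by
  rw [hcomp, id_whiskerRight, Category.comp_id]
  exact id_wl_heq α

/-- The interchange law. In `total_compRel` it makes the composition of multicells compatible with
concatenation of strings. -/
theorem comp_hcomp_comp {x y z : X} {f f' f'' : x ⟶ y} {g g' g'' : y ⟶ z} (α : f ⟶ f')
    (α' : f' ⟶ f'') (β : g ⟶ g') (β' : g' ⟶ g'') :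
    hcomp (α ≫ α') (β ≫ β') = hcomp α β ≫ hcomp α' β' := by
  simp [hcomp, whisker_exchange_assoc]

/-- Interchange with an identity as the second factor of the cell below; `liftCell_comp` uses it to
split the last multicell off a string. -/
theorem comp_hcomp {x y z : X} {f f' f'' : x ⟶ y} {g g' : y ⟶ z} (α : f ⟶ f')
    (α' : f' ⟶ f'') (β : g ⟶ g') : hcomp (α ≫ α') β = hcomp α β ≫ α' ▷ g' := by
  simp [hcomp]

theorem id_hcomp_id {x y z : X} (f : x ⟶ y) (g : y ⟶ z) : hcomp (𝟙 f) (𝟙 g) = 𝟙 (f ≫ g) := by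
  simp [hcomp]

theorem hcomp_assoc [Strict X] {x y z t : X} {f f' : x ⟶ y} {g g' : y ⟶ z} {h h' : z ⟶ t}
    (α : f ⟶ f') (β : g ⟶ g') (γ : h ⟶ h') :
    hcomp (hcomp α β) γ ≍ hcomp α (hcomp β γ) := by
  simp only [hcomp, whiskerLeft_comp, comp_whiskerRight, Category.assoc]
  exact comp_heq_comp (Strict.assoc _ _ _) (Strict.assoc _ _ _) (Strict.assoc _ _ _)
    (comp_wl_heq _ _ _) (comp_heq_comp (Strict.assoc _ _ _) (Strict.assoc _ _ _)
      (Strict.assoc _ _ _) (wl_wr_heq _ _ _) (wr_comp_heq _ _ _).symm)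

end HComp

variable {X : Type (max (u + 1) v)} [Bicategory.{max (u + 1) v, max (u + 1) v} X]

/-- The objects of the virtual double category of elements. -/
structure Elt (D : SetDiagram.{u, v} X) : Type (max (u + 1) v) where
  pt : X
  el : D.S pt

namespace Elt

variable {D : SetDiagram.{u, v} X}

/-- The vertical morphisms of the virtual double category of elements. -/
@[ext]
structure Hom (a b : Elt D) : Type (max (u + 1) v) where
  hom : a.pt ⟶ b.pt
  w : D.act hom a.el = b.el

/-- The horizontal morphisms of the virtual double category of elements: there is exactly one
between any two elements of the same set. -/
structure HHom (a b : Elt D) : Type (max (u + 1) v) where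
  eq : a.pt = b.pt

variable [Strict X]

instance : Category.{max (u + 1) v} (Elt D) where
  Hom := Hom
  id a := ⟨𝟙 a.pt, D.act_id _ _⟩
  comp f g := ⟨f.hom ≫ g.hom, by rw [D.act_comp, f.w, g.w]⟩
  id_comp f := Hom.ext (Strict.id_comp _)
  comp_id f := Hom.ext (Strict.comp_id _)
  assoc f g h := Hom.ext (Strict.assoc _ _ _)

/-- Horizontal morphisms stay over one object of `X`, so a whole string does. This is what makes the
two vertical boundaries of a multicell parallel 1-cells, up to transport. -/
theorem pt_eq {a b : Elt D} (p : HPath HHom a b) : a.pt = b.pt := by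
  induction p with
  | nil => rfl
  | cons p Γ ih => exact ih.trans Γ.eq

variable (D) in
/-- The underlying graph of the virtual double category of elements. A multicell is a 2-cell
between the underlying 1-cells of its vertical boundary. -/
@[reducible]
def graph : VDGraph.{max (u + 1) v} where
  Obj := Elt D
  HMor := HHom
  Cell p f g Ω := Hom.hom f ⟶ castHom (pt_eq p) (HHom.eq Ω) (Hom.hom g)

/-- The composite 2-cell of a string of multicells. -/
def total {a : Elt D} : ∀ {a' b b' : Elt D} {p : HPath HHom a a'} {f : a ⟶ b}
    {f' : a' ⟶ b'} {q : HPath HHom b b'}, (graph D).CellPath p f f' q →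
      (f.hom ⟶ castHom (pt_eq p) (pt_eq q) f'.hom)
  | _, _, _, _, _, _, _, .nil f => 𝟙 f.hom
  | _, _, _, _, _, _, _, .cons (p := p) (q := q) (r := r) (Ω := Ω) Θ θ h =>
      total Θ ≫ castHom₂ (pt_eq p) (pt_eq q) (pt_eq r) Ω.eq θ

variable (D) in
/-- The composition of multicells: the horizontal composition of 2-cells. -/
@[reducible]
def pre : VDPre.{max (u + 1) v} where
  toVDGraph := graph D
  idCell {a b} Γ := eqToHom (by
    obtain ⟨x, i⟩ := a
    obtain ⟨y, j⟩ := b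
    obtain ⟨h⟩ := Γ
    cases h
    rfl)
  comp {a a' b b' c c' p f f' q g g' Λ k k'} κ Θ hx hx' :=
    eqToHom (congrArg Hom.hom hx).symm ≫ hcomp (total Θ) κ ≫
      eqToHom (by rw [castHom_comp, ← hx']; rfl)

/-- Discards the transports in the definition of `pre`; the laws of the virtual double category are
checked in this form. -/
theorem pre_comp_heq {a a' b b' c c' : Elt D} {p : HPath HHom a a'} {f : a ⟶ b}
    {f' : a' ⟶ b'} {q : HPath HHom b b'} {g : b ⟶ c} {g' : b' ⟶ c'} {Λ : HHom c c'} {k : a ⟶ c}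
    {k' : a' ⟶ c'} (κ : (graph D).Cell q g g' Λ) (Θ : (graph D).CellPath p f f' q)
    (hx : f ≫ g = k) (hx' : f' ≫ g' = k') :
    (pre D).comp κ Θ hx hx' ≍ hcomp (total Θ) κ := by
  simp [pre]

/-- Once the points are identified through `pt_eq` the transports vanish, and the inductive step is
associativity of vertical composition of 2-cells. -/
theorem total_append {a a' b b' : Elt D} {p : HPath HHom a a'} {f : a ⟶ b} {f' : a' ⟶ b'}
    {q : HPath HHom b b'} (Θ : (graph D).CellPath p f f' q) : ∀ {a'' b'' : Elt D}
    {r : HPath HHom a' a''} {f'' : a'' ⟶ b''} {s : HPath HHom b' b''}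
    (Φ : (graph D).CellPath r f' f'' s),
    total (Θ.append Φ) = total Θ ≫ castHom₂ (pt_eq p) (pt_eq q) (pt_eq r) (pt_eq s) (total Φ)
  | _, _, _, _, _, .nil _ => by
    obtain ⟨x, i⟩ := a
    obtain ⟨y, j⟩ := b
    obtain ⟨x', i'⟩ := a'
    obtain ⟨y', j'⟩ := b'
    cases pt_eq p
    cases pt_eq q
    exact (Category.comp_id _).symm
  | _, _, _, _, _, .cons (a' := a₁) (b' := b₁) (a'' := a₂) (b'' := b₂) (p := r) (q := s)
      (r := t) (Ω := Ω) Φ φ h => by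
    have ih := total_append Θ Φ
    have e₁ := pt_eq p
    have e₂ := pt_eq q
    have e₃ := pt_eq r
    have e₄ := pt_eq s
    have e₅ := pt_eq t
    have e₆ := Ω.eq
    obtain ⟨x, i⟩ := a
    obtain ⟨y, j⟩ := b
    obtain ⟨x', i'⟩ := a'
    obtain ⟨y', j'⟩ := b'
    obtain ⟨x₁, i₁⟩ := a₁
    obtain ⟨y₁, j₁⟩ := b₁
    obtain ⟨x₂, i₂⟩ := a₂
    obtain ⟨y₂, j₂⟩ := b₂
    cases e₁
    cases e₂
    cases e₃
    cases e₄
    cases e₅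
    cases e₆
    change total (Θ.append Φ) ≫ _ = _
    rw [ih]
    exact Category.assoc _ _ _

/-- This reduces associativity of multicell composition to associativity of `hcomp`. The inductive
step is the interchange law. The equations between vertical boundaries are part of the induction
because `CompRel` does not fix the outer boundaries of `Ψ` in its indices. -/
theorem total_compRel {a a' b b' c c' : Elt D} {p : HPath HHom a a'} {f : a ⟶ b}
    {f' : a' ⟶ b'} {q : HPath HHom b b'} {g : b ⟶ c} {g' : b' ⟶ c'} {s : HPath HHom c c'} {k : a ⟶ c}
    {k' : a' ⟶ c'} {Θ : (graph D).CellPath q g g' s} {Φ : (graph D).CellPath p f f' q}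
    {Ψ : (graph D).CellPath p k k' s} (H : (pre D).CompRel Θ Φ Ψ) :
    f ≫ g = k ∧ f' ≫ g' = k' ∧ total Ψ ≍ hcomp (total Φ) (total Θ) := by
  refine VDPre.CompRel.rec (A := pre D)
    (motive := fun {a' b b' c c'} {p} {f f' q g g' s k k'} Θ Φ Ψ _ =>
    f ≫ g = k ∧ f' ≫ g' = k' ∧ total Ψ ≍ hcomp (total Φ) (total Θ)) ?_ ?_ H
  · intro b c f g
    exact ⟨rfl, rfl, heq_of_eq (id_hcomp_id _ _).symm⟩
  · intro a' a'' b b' b'' c c' c'' p f f' q g g' s k k' Θ Φ Ψ H r g'' Ω θ t f'' Φ' k'' hk' hk'' ih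
    refine ⟨ih.1, hk'', ?_⟩
    obtain ⟨hk, -, ih⟩ := ih
    subst hk hk' hk''
    have e₁ := pt_eq p
    have e₂ := pt_eq q
    have e₃ := pt_eq s
    have e₄ := pt_eq r
    have e₅ := HHom.eq Ω
    have e₆ := pt_eq t
    have h := pre_comp_heq θ Φ' rfl rfl
    obtain ⟨x, i⟩ := a
    obtain ⟨y, j⟩ := b
    obtain ⟨z, l⟩ := c
    obtain ⟨x', i'⟩ := a'
    obtain ⟨y', j'⟩ := b'
    obtain ⟨z', l'⟩ := c'
    obtain ⟨x'', i''⟩ := a''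
    obtain ⟨y'', j''⟩ := b''
    obtain ⟨z'', l''⟩ := c''
    cases e₁
    cases e₂
    cases e₃
    cases e₄
    cases e₅
    cases e₆
    rw [total_append]
    refine HEq.trans ?_ (heq_of_eq (comp_hcomp_comp _ _ _ _).symm)
    exact comp_heq_comp rfl rfl rfl ih h

variable (D) in
/-- The virtual double category of elements of a diagram of sets. -/
@[reducible]
def vdc : VDC.{max (u + 1) v} where
  toVDPre := pre D
  id_comp' {a a' b b' p f f' Ω} θ := by
    refine eq_of_heq ((pre_comp_heq _ _ _ _).trans ?_)
    obtain ⟨x, i⟩ := a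
    obtain ⟨y, j⟩ := b
    obtain ⟨x', i'⟩ := a'
    obtain ⟨y', j'⟩ := b'
    cases pt_eq p
    cases HHom.eq Ω
    refine (hcomp_id _).trans (heq_of_eq (Category.id_comp _))
  comp_id' {b b' c c' q g g' Λ} κ := by
    refine eq_of_heq ((pre_comp_heq _ _ _ _).trans ?_)
    have h : ∀ {b b' : Elt D} (q : HPath HHom b b'), total ((pre D).idPath q) ≍ 𝟙 (𝟙 b.pt) := by
      intro b b' q
      induction q with
      | nil => rfl
      | cons p Γ ih =>
        rename_i b₁ b₂
        have e₁ := pt_eq p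
        have e₂ := Γ.eq
        obtain ⟨x, i⟩ := b
        obtain ⟨x₁, i₁⟩ := b₁
        obtain ⟨x₂, i₂⟩ := b₂
        cases e₁
        cases e₂
        exact (comp_heq_comp rfl rfl rfl ih HEq.rfl).trans (heq_of_eq (Category.comp_id _))
    have e₁ := pt_eq q
    have e₂ := HHom.eq Λ
    have e₃ := h q
    obtain ⟨x, i⟩ := b
    obtain ⟨x', i'⟩ := b'
    obtain ⟨y, j⟩ := c
    obtain ⟨y', j'⟩ := c'
    cases e₁
    cases e₂
    exact (hcomp_heq rfl rfl rfl rfl e₃ HEq.rfl).trans (id_hcomp κ)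
  assoc' {a a' b b' c c' d d' p f f' q g g' s k k' l l' Λ y y' z z'} κ {Θ Φ Ψ} H
      hy hy' hz hz' hx hx' := by
    obtain ⟨h₁, h₂, h⟩ := total_compRel H
    subst h₁ h₂ hy hy' hz hz'
    refine eq_of_heq ?_
    refine (pre_comp_heq (D := D) _ _ _ _).trans (HEq.trans ?_ (pre_comp_heq (D := D) _ _ _ _).symm)
    have e₁ := pt_eq p
    have e₂ := pt_eq q
    have e₃ := pt_eq s
    have e₄ := HHom.eq Λ
    have h' := pre_comp_heq κ Θ rfl rfl
    obtain ⟨x, i⟩ := a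
    obtain ⟨y, j⟩ := b
    obtain ⟨z, l⟩ := c
    obtain ⟨t, m⟩ := d
    obtain ⟨x', i'⟩ := a'
    obtain ⟨y', j'⟩ := b'
    obtain ⟨z', l'⟩ := c'
    obtain ⟨t', m'⟩ := d'
    cases e₁
    cases e₂
    cases e₃
    cases e₄
    -- Without transports, the law says that `hcomp (total Φ) (hcomp (total Θ) κ)` equals `hcomp
    -- (hcomp (total Φ) (total Θ)) κ`, and the inner factor on the right is `total Ψ`.
    refine (hcomp_heq rfl rfl rfl rfl HEq.rfl h').trans ?_
    refine (hcomp_assoc _ _ _).symm.trans ?_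
    exact hcomp_heq rfl rfl rfl rfl h.symm HEq.rfl

end Elt
end Elements
end VEnr

/-! ### The universal diagram of enriched categories -/

namespace VEnr
section ElementsUnit
universe w
open Bicategory

variable {X : Type (max (u + 1) v)} [Bicategory.{max (u + 1) v, max (u + 1) v} X]

/-- The sets of objects of a diagram of enriched categories. -/
@[reducible]
def SetDiagram.of {A : VDC.{w}} (M : StrictPseudofunctor X (ECat.{u} A)) : SetDiagram.{u, v} X where
  S x := (M.obj x).ob
  act f := EFunctor.obj (M.map f)
  act_id x i := by rw [M.map_id]; rfl
  act_comp f g i := by rw [M.map_comp]; rfl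

namespace Elt

variable [Strict X] (D : SetDiagram.{u, v} X)

theorem vdc_comp_heq {D : SetDiagram.{u, v} X} {a a' b b' c c' : Elt D} {p : HPath HHom a a'}
    {f : a ⟶ b} {f' : a' ⟶ b'} {q : HPath HHom b b'} {g : b ⟶ c} {g' : b' ⟶ c'} {Λ : HHom c c'} {k : a ⟶ c}
    {k' : a' ⟶ c'} (κ : (vdc D).Cell q g g' Λ) (Θ : (vdc D).CellPath p f f' q)
    (hx : f ≫ g = k) (hx' : f' ≫ g' = k') :
    (vdc D).comp κ Θ hx hx' ≍ hcomp (total Θ) κ := pre_comp_heq _ _ _ _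

theorem total_single {D : SetDiagram.{u, v} X} {x y : X} {i i' : D.S x} {f f' : x ⟶ y}
    {j j' : D.S y} {w : D.act f i = j} {w' : D.act f' i' = j'}
    {p : HPath HHom (⟨x, i⟩ : Elt D) ⟨x, i'⟩} {Γ : HHom (⟨y, j⟩ : Elt D) ⟨y, j'⟩} (θ : f ⟶ f') :
    total (VDGraph.CellPath.single (A := graph D) (p := p) (u := (⟨f, w⟩ : Hom ⟨x, i⟩ ⟨y, j⟩))
      (u' := (⟨f', w'⟩ : Hom ⟨x, i'⟩ ⟨y, j'⟩)) (Ω := Γ) θ) = θ :=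
  Category.id_comp _

theorem total_pair {D : SetDiagram.{u, v} X} {x y : X} {i i' i'' : D.S x} {f f' f'' : x ⟶ y}
    {j j' j'' : D.S y} {w : D.act f i = j} {w' : D.act f' i' = j'} {w'' : D.act f'' i'' = j''}
    {p : HPath HHom (⟨x, i⟩ : Elt D) ⟨x, i'⟩} {p' : HPath HHom (⟨x, i'⟩ : Elt D) ⟨x, i''⟩}
    {P : HPath HHom (⟨x, i⟩ : Elt D) ⟨x, i''⟩}
    {Γ : HHom (⟨y, j⟩ : Elt D) ⟨y, j'⟩} {Γ' : HHom (⟨y, j'⟩ : Elt D) ⟨y, j''⟩}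
    (θ : f ⟶ f') (θ' : f' ⟶ f'') (h : p.comp p' = P) :
    total (VDGraph.CellPath.pair (A := graph D) (p := p) (u := (⟨f, w⟩ : Hom ⟨x, i⟩ ⟨y, j⟩))
      (u' := (⟨f', w'⟩ : Hom ⟨x, i'⟩ ⟨y, j'⟩)) (Ω := Γ) θ
      (u'' := (⟨f'', w''⟩ : Hom ⟨x, i''⟩ ⟨y, j''⟩)) (Ω' := Γ') θ' h) = θ ≫ θ' :=
  congrArg (fun t : f ⟶ f' => t ≫ θ') (Category.id_comp θ)

/-- The enriched category on the set `D.S x`. -/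
@[reducible]
def cat (x : X) : ECat.{u} (vdc D) where
  ob := D.S x
  extent i := ⟨x, i⟩
  hom _ _ := ⟨rfl⟩
  unit i := 𝟙 (𝟙 x)
  mul _ _ _ := 𝟙 (𝟙 x)
  -- All structure cells are the identity 2-cell of `𝟙 x`, merely placed above strings of different
  -- lengths, so both sides of each law are identities.
  unit_mul i i' := eq_of_heq ((vdc_comp_heq _ _ _ _).trans <|
    (hcomp_id _).trans (heq_of_eq ((total_pair (D := D) _ _ _).trans (Category.comp_id _))))
  mul_unit i i' := eq_of_heq ((vdc_comp_heq _ _ _ _).trans <|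
    (hcomp_id _).trans (heq_of_eq ((total_pair (D := D) _ _ _).trans (Category.comp_id _))))
  mul_assoc i₀ i₁ i₂ i₃ := eq_of_heq <|
    ((vdc_comp_heq _ _ _ _).trans <| (hcomp_id _).trans <| heq_of_eq <|
      (total_pair (D := D) _ _ _).trans (Category.comp_id _)).trans
    ((vdc_comp_heq _ _ _ _).trans <| (hcomp_id _).trans <| heq_of_eq <|
      (total_pair (D := D) _ _ _).trans (Category.comp_id _)).symm

variable {D}

/-- The enriched functor given by a 1-cell. -/
@[reducible]
def functor {x y : X} (f : x ⟶ y) : EFunctor (cat D x) (cat D y) where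
  obj i := D.act f i
  app i := ⟨f, rfl⟩
  cell i i' := 𝟙 f
  map_unit i := eq_of_heq <|
    ((vdc_comp_heq _ _ _ _).trans <|
      (hcomp_heq rfl rfl rfl rfl (heq_of_eq (total_single (D := D) _)) HEq.rfl).trans
        (id_hcomp _)).trans
    ((vdc_comp_heq _ _ _ _).trans (hcomp_id _)).symm
  map_mul i₀ i₁ i₂ := eq_of_heq <|
    ((vdc_comp_heq _ _ _ _).trans <|
      (hcomp_heq rfl rfl rfl rfl (heq_of_eq (total_single (D := D) _)) HEq.rfl).trans
        (id_hcomp _)).trans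
    ((vdc_comp_heq _ _ _ _).trans <| (hcomp_id _).trans <| heq_of_eq <|
      (total_pair (D := D) _ _ _).trans (Category.comp_id _)).symm

/-- The enriched natural transformation given by a 2-cell. -/
@[reducible]
def natTrans {x y : X} {f g : x ⟶ y} (α : f ⟶ g) : ENatTrans (functor (D := D) f) (functor g) where
  app i := α
  naturality i i' := eq_of_heq <|
    ((vdc_comp_heq _ _ _ _).trans <| (hcomp_id _).trans <| heq_of_eq <|
      (total_pair (D := D) _ _ _).trans (Category.comp_id _)).trans
    ((vdc_comp_heq _ _ _ _).trans <| (hcomp_id _).trans <| heq_of_eq <|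
      (total_pair (D := D) _ _ _).trans (Category.id_comp _)).symm

theorem hom_heq {x y y' : X} {i : D.S x} {j : D.S y} {j' : D.S y'} (hy : y = y') (hj : j ≍ j')
    {f : (⟨x, i⟩ : Elt D) ⟶ ⟨y, j⟩} {f' : (⟨x, i⟩ : Elt D) ⟶ ⟨y', j'⟩}
    (h : Hom.hom f ≍ Hom.hom f') : f ≍ f' := by
  subst hy hj
  exact heq_of_eq (Hom.ext (eq_of_heq h))

theorem functor_id (x : X) : functor (D := D) (𝟙 x) = EFunctor.id (cat D x) :=
  EFunctor.ext' (fun i => D.act_id x i)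
    (fun i => hom_heq rfl (heq_of_eq (D.act_id x i)) HEq.rfl)
    (fun i i' => HEq.rfl)

theorem functor_comp {x y z : X} (f : x ⟶ y) (g : y ⟶ z) :
    functor (D := D) (f ≫ g) = (functor f).comp (functor g) :=
  EFunctor.ext' (fun i => D.act_comp f g i)
    (fun i => hom_heq rfl (heq_of_eq (D.act_comp f g i)) HEq.rfl)
    (fun i i' => by
      refine HEq.symm ((vdc_comp_heq _ _ rfl rfl).trans ?_)
      exact (hcomp_heq rfl rfl rfl rfl (heq_of_eq (total_single (D := D) _)) HEq.rfl).trans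
        (heq_of_eq (id_hcomp_id f g)))

variable (D) in
/-- The universal diagram of enriched categories with a given diagram of sets of objects. -/
def universal : StrictPseudofunctor X (ECat.{u} (vdc D)) :=
  mkTwoFunctor (fun x => cat D x) (fun f => functor f) (fun α => natTrans α)
    functor_id functor_comp
    (fun f => ENatTrans.ext' fun i => eq_of_heq
      ((vdc_comp_heq _ _ (Category.comp_id _) (Category.comp_id _)).trans (hcomp_id _)).symm)
    (fun α β => ENatTrans.ext' fun i => eq_of_heq
      ((vdc_comp_heq _ _ (Category.comp_id _) (Category.comp_id _)).trans
        ((hcomp_id _).trans (heq_of_eq (total_pair (D := D) _ _ _)))).symm)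
    (fun f g h β => ENatTrans.heq (functor_comp f g) (functor_comp f h) fun i =>
      ((vdc_comp_heq _ _ rfl rfl).trans (by
        simp only [hcomp]
        erw [id_whiskerRight, Category.comp_id]
        rfl)).symm)
    (fun {x y z f g} α h => ENatTrans.heq (functor_comp f h) (functor_comp g h) fun i =>
      ((vdc_comp_heq _ _ rfl rfl).trans <|
      (hcomp_heq rfl rfl rfl rfl (heq_of_eq (total_single (D := D) _)) HEq.rfl).trans (by
        simp only [hcomp]
        erw [whiskerLeft_id, Category.id_comp]
        rfl)).symm)

end Elt
end ElementsUnit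
end VEnr

/-! ### Existence of the classifying virtual double functor -/

namespace VEnr
section ElementsLift
universe w
open Bicategory

section congr

variable {A : VDC.{w}}

/-- The values of a 2-functor at identities and composites are only propositionally the expected
ones, and the types of vertical morphisms and cells depend on them. Hence components are compared
heterogeneously here and in the following lemmas. -/
theorem EFunctor.app_congr {C D : ECat.{u} A} {f g : EFunctor C D} (h : f = g) (c : C.ob) :
    f.app c ≍ g.app c := by subst h; rfl

theorem EFunctor.cell_congr {C D : ECat.{u} A} {f g : EFunctor C D} (h : f = g) (c c' : C.ob) :
    f.cell c c' ≍ g.cell c c' := by subst h; rfl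

theorem ENatTrans.app_congr {C D : ECat.{u} A} {f g f' g' : EFunctor C D} (hf : f = f')
    (hg : g = g') {α : ENatTrans f g} {β : ENatTrans f' g'} (h : α ≍ β) (c : C.ob) :
    α.app c ≍ β.app c := by subst hf hg h; rfl

theorem ECat.m_heq (E : ECat.{u} A) {c₀ c₁ c₂ d₀ d₁ d₂ : E.ob} (e₀ : c₀ = d₀) (e₁ : c₁ = d₁)
    (e₂ : c₂ = d₂) {a a' a'' : A.Obj} {p r : HPath A.HMor a a'} {p' r' : HPath A.HMor a' a''}
    {P R : HPath A.HMor a a''} (ep : p = r) (ep' : p' = r') (eP : P = R)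
    {u : a ⟶ E.extent c₀} {u' : a' ⟶ E.extent c₁} {u'' : a'' ⟶ E.extent c₂}
    {v : a ⟶ E.extent d₀} {v' : a' ⟶ E.extent d₁} {v'' : a'' ⟶ E.extent d₂}
    (eu : u ≍ v) (eu' : u' ≍ v') (eu'' : u'' ≍ v'')
    {θ : A.Cell p u u' (E.hom c₀ c₁)} {θ' : A.Cell p' u' u'' (E.hom c₁ c₂)}
    {ϑ : A.Cell r v v' (E.hom d₀ d₁)} {ϑ' : A.Cell r' v' v'' (E.hom d₁ d₂)} (eθ : θ ≍ ϑ)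
    (eθ' : θ' ≍ ϑ') (h : p.comp p' = P) (h' : r.comp r' = R) :
    E.m θ θ' h ≍ E.m ϑ ϑ' h' := by
  subst e₀ e₁ e₂ ep ep' eP eu eu' eu'' eθ eθ'; rfl

/-- With `f` the value of a diagram at an identity 1-cell, this lemma and `m_cell_heq` recover the
unit and the multiplication of the diagram's value from the images of the universal ones. -/
theorem ECat.e_app_heq {E : ECat.{u} A} {f : EFunctor E E} (h : f = EFunctor.id E) (i : E.ob) :
    E.e (f.obj i) (f.app i) ≍ E.unit i := by
  subst h
  exact heq_of_eq (A.comp_id' (E.unit i))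

theorem ECat.m_cell_heq {E : ECat.{u} A} {f : EFunctor E E} (h : f = EFunctor.id E)
    (i₀ i₁ i₂ : E.ob) :
    E.m (P := (HPath.single (E.hom i₀ i₁)).cons (E.hom i₁ i₂)) (f.cell i₀ i₁) (f.cell i₁ i₂) rfl ≍
      E.mul i₀ i₁ i₂ := by
  subst h
  exact heq_of_eq (A.comp_id' (E.mul i₀ i₁ i₂))

/-- Transport of a vertical morphism along an equality of objects of an enriched category. -/
def ECat.castV (E : ECat.{u} A) {a : A.Obj} {j j' : E.ob} (h : j = j') (t : a ⟶ E.extent j) :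
    a ⟶ E.extent j' :=
  cast (by rw [h]) t

theorem ECat.castV_heq (E : ECat.{u} A) {a : A.Obj} {j j' : E.ob} (h : j = j')
    (t : a ⟶ E.extent j) : E.castV h t ≍ t := cast_heq _ _

end congr

variable {X : Type (max (u + 1) v)} [Bicategory.{max (u + 1) v, max (u + 1) v} X]
  [Strict X] {A : VDC.{max (u + 1) v}}

namespace Elt

variable (M : StrictPseudofunctor X (ECat.{u} A))

/-- The action on objects and vertical morphisms of the virtual double functor classifying a
diagram of enriched categories. -/
@[reducible]
def liftV : Elt (SetDiagram.of M) ⥤ A.Obj where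
  obj a := (M.obj a.pt).extent a.el
  map {a b} f := (M.obj b.pt).castV (Hom.w f) (EFunctor.app (M.map (Hom.hom f)) a.el)
  map_id a := eq_of_heq <| (ECat.castV_heq _ _ _).trans (EFunctor.app_congr (M.map_id a.pt) a.el)
  map_comp {a b c} f g := by
    obtain ⟨x, i⟩ := a
    obtain ⟨y, j⟩ := b
    obtain ⟨z, k⟩ := c
    obtain ⟨f, hf⟩ := f
    obtain ⟨g, hg⟩ := g
    dsimp only at f g hf hg
    subst hf hg
    exact eq_of_heq ((ECat.castV_heq _ _ _).trans (EFunctor.app_congr (M.map_comp f g) i))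

/-- The action on horizontal morphisms. -/
def liftH {x y : X} (h : x = y) (i : (M.obj x).ob) (j : (M.obj y).ob) :
    A.HMor ((M.obj x).extent i) ((M.obj y).extent j) := by
  subst h
  exact (M.obj x).hom i j

/-- The action on objects, vertical and horizontal morphisms. -/
@[reducible]
def liftMap₁ : VDMap₁ (vdc (SetDiagram.of M)).toVDGraph A.toVDGraph where
  V := liftV M
  mapH {a b} Γ := liftH M (HHom.eq Γ) a.el b.el

variable {M}

/-- The image of a multicell whose vertical boundaries are given by 1-cells with codomain `y`. -/
def ev {x y : X} {i : (M.obj x).ob} (f : x ⟶ y) : ∀ {a : Elt (SetDiagram.of M)}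
    (p : HPath HHom (⟨x, i⟩ : Elt (SetDiagram.of M)) a) (g : a.pt ⟶ y)
    (α : f ⟶ castHom (pt_eq p) rfl g),
    A.Cell ((liftMap₁ M).mapPath p) (EFunctor.app (M.map f) i) (EFunctor.app (M.map g) a.el)
      ((M.obj y).hom (EFunctor.obj (M.map f) i) (EFunctor.obj (M.map g) a.el))
  -- The normal form: the component of `M.map₂ α` at the first element of the string, multiplied on
  -- the right by the actions of `M.map g` on the successive homs. By naturality the component could
  -- be inserted at any other place, with `M.map f` acting before it.
  | _, .nil _, g, α => ENatTrans.app (M.map₂ α) i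
  | _, .cons (b := ⟨x₁, i₁⟩) (c := ⟨_, i₂⟩) p ⟨rfl⟩, g, α =>
      (M.obj y).m (ev f p g α) (EFunctor.cell (M.map g) i₁ i₂) rfl

theorem ev_cons {x y : X} {i i₁ i₂ : (M.obj x).ob} (f g : x ⟶ y)
    (p : HPath HHom (⟨x, i⟩ : Elt (SetDiagram.of M)) ⟨x, i₁⟩)
    (Γ : HHom (⟨x, i₁⟩ : Elt (SetDiagram.of M)) ⟨x, i₂⟩) (α : f ⟶ g) :
    ev f (a := ⟨x, i₂⟩) (p.cons Γ) g α =
      (M.obj y).m (ev f (a := ⟨x, i₁⟩) p g α) (EFunctor.cell (M.map g) i₁ i₂) rfl := by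
  rfl

/-- The component of `M.map₂ (𝟙 f)` is a unit, which the unit law of `M.obj y` removes. -/
theorem ev_id_single {x y : X} {i i' : (M.obj x).ob} (f : x ⟶ y)
    (Γ : HHom (⟨x, i⟩ : Elt (SetDiagram.of M)) ⟨x, i'⟩) :
    ev f (a := ⟨x, i'⟩) (.single Γ) f (𝟙 f) = EFunctor.cell (M.map f) i i' := by
  have h : ENatTrans.app (M.map₂ (𝟙 f)) i =
      (M.obj y).e (EFunctor.obj (M.map f) i) (EFunctor.app (M.map f) i) := by
    rw [M.map₂_id]; rfl
  refine (ev_cons f f _ Γ (𝟙 f)).trans ?_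
  refine Eq.trans ?_ ((M.obj y).e_m (EFunctor.cell (M.map f) i i') rfl)
  exact congrArg (fun t => (M.obj y).m t (EFunctor.cell (M.map f) i i') rfl) h

/-- An enriched functor distributes over multiplication (`EFunctor.cell_m`), so the claim propagates
along the string. For the empty string it is the preservation of right whiskering by `M`. -/
theorem cell_ev {x y z : X} {i : (M.obj x).ob} (f : x ⟶ y) (g : y ⟶ z) :
    ∀ {a : Elt (SetDiagram.of M)} (p : HPath HHom (⟨x, i⟩ : Elt (SetDiagram.of M)) a)
    (f' : a.pt ⟶ y) (α : f ⟶ castHom (pt_eq p) rfl f')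
    (β : f ≫ g ⟶ castHom (pt_eq p) rfl (f' ≫ g)) (h : β ≍ α ▷ g),
    A.comp (EFunctor.cell (M.map g) _ _) (.single (ev f p f' α)) rfl rfl ≍ ev (f ≫ g) p (f' ≫ g) β
  | _, .nil _, f', α, β, h => by
    obtain rfl := eq_of_heq h
    exact ENatTrans.app_congr (M.map_comp f g).symm (M.map_comp f' g).symm
      (map₂_wr_heq M α g).symm i
  | _, .cons (b := ⟨x₁, i₁⟩) (c := ⟨_, i₂⟩) p ⟨rfl⟩, f', α, β, h => by
    have ih := cell_ev f g p f' α β h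
    cases pt_eq p
    refine (heq_of_eq (EFunctor.cell_m (M.map g) (ev f p f' α) (EFunctor.cell (M.map f') i₁ i₂) rfl
      rfl rfl rfl)).trans ?_
    exact ECat.m_heq _ (congrFun (congrArg EFunctor.obj (M.map_comp f g)) i).symm
      (congrFun (congrArg EFunctor.obj (M.map_comp f' g)) i₁).symm
      (congrFun (congrArg EFunctor.obj (M.map_comp f' g)) i₂).symm rfl rfl rfl
      (EFunctor.app_congr (M.map_comp f g).symm i) (EFunctor.app_congr (M.map_comp f' g).symm i₁)
      (EFunctor.app_congr (M.map_comp f' g).symm i₂) ih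
      (EFunctor.cell_congr (M.map_comp f' g).symm i₁ i₂) _ _

/-- Naturality of `M.map₂ β` moves its component leftwards past the action on the last hom. When the
string is exhausted, the claim is that `M` preserves vertical composition. -/
theorem ev_m_app {x y : X} {i : (M.obj x).ob} (f : x ⟶ y) :
    ∀ {a : Elt (SetDiagram.of M)} (p : HPath HHom (⟨x, i⟩ : Elt (SetDiagram.of M)) a)
    (f' f'' : a.pt ⟶ y) (α : f ⟶ castHom (pt_eq p) rfl f') (β : f' ⟶ f''),
    (M.obj y).m (ev f p f' α) (ENatTrans.app (M.map₂ β) a.el) rfl =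
      ev f p f'' (α ≫ castHom₂ (pt_eq p) rfl rfl rfl β)
  | _, .nil _, f', f'', α, β => by
    exact (congrArg (fun t : M.map f ⟶ M.map f'' => ENatTrans.app t i)
      (M.map₂_comp (show f ⟶ f' from α) β)).symm
  | _, .cons (b := ⟨x₁, i₁⟩) (c := ⟨_, i₂⟩) p ⟨rfl⟩, f', f'', α, β => by
    have ih := ev_m_app f p f' f'' α β
    cases pt_eq p
    refine ((M.obj y).m_assoc (ev f p f' α) (EFunctor.cell (M.map f') i₁ i₂)
      (ENatTrans.app (M.map₂ β) i₂) rfl rfl rfl rfl).trans ?_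
    refine (congrArg (fun t => (M.obj y).m (P := ((liftMap₁ M).mapPath p).cons ((M.obj x).hom i₁ i₂))
      (ev f p f' α) t rfl) (ENatTrans.nat (M.map₂ β) i₁ i₂).symm).trans ?_
    refine ((M.obj y).m_assoc (ev f p f' α) (ENatTrans.app (M.map₂ β) i₁)
      (EFunctor.cell (M.map f'') i₁ i₂) rfl rfl rfl rfl).symm.trans ?_
    exact congrArg (fun t => (M.obj y).m (P := ((liftMap₁ M).mapPath p).cons ((M.obj x).hom i₁ i₂))
      t (EFunctor.cell (M.map f'') i₁ i₂) rfl) ih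

/-- Multicells placed side by side multiply: the normal form of `β` is peeled off hom by hom through
associativity of the multiplication, and `ev_m_app` handles the component that remains. -/
theorem ev_m_ev {x y : X} {i i' : (M.obj x).ob} (f f' : x ⟶ y)
    (p : HPath HHom (⟨x, i⟩ : Elt (SetDiagram.of M)) ⟨x, i'⟩) (α : f ⟶ f') :
    ∀ {a : Elt (SetDiagram.of M)} (r : HPath HHom (⟨x, i'⟩ : Elt (SetDiagram.of M)) a)
    (f'' : a.pt ⟶ y) (β : f' ⟶ castHom (pt_eq r) rfl f''),
    (M.obj y).m (ev f (a := ⟨x, i'⟩) p f' α) (ev f' r f'' β)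
      ((liftMap₁ M).mapPath_comp p r).symm = ev f (p.comp r) f'' (α ≫ β)
  | _, .nil _, f'', β => ev_m_app f p f' f'' α β
  | _, .cons (b := ⟨x₁, i₁⟩) (c := ⟨_, i₂⟩) r ⟨rfl⟩, f'', β => by
    have ih := ev_m_ev f f' p α r f'' β
    cases pt_eq r
    refine ((M.obj y).m_assoc (ev f (a := ⟨x, i'⟩) p f' α) (ev f' r f'' β)
      (EFunctor.cell (M.map f'') i₁ i₂) ((liftMap₁ M).mapPath_comp p r).symm rfl rfl
      (congrArg (fun t => HPath.cons t ((M.obj x).hom i₁ i₂))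
        ((liftMap₁ M).mapPath_comp p r).symm)).symm.trans ?_
    exact congrArg (fun t => (M.obj y).m
      (P := ((liftMap₁ M).mapPath (p.comp r)).cons ((M.obj x).hom i₁ i₂))
      t (EFunctor.cell (M.map f'') i₁ i₂) rfl) ih

/-- The action on multicells. -/
def liftCell {a a' b b' : Elt (SetDiagram.of M)} {p : HPath HHom a a'} {f : a ⟶ b} {f' : a' ⟶ b'}
    {Ω : HHom b b'} (θ : (vdc (SetDiagram.of M)).Cell p f f' Ω) :
    A.Cell ((liftMap₁ M).mapPath p) ((liftMap₁ M).V.map f) ((liftMap₁ M).V.map f')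
      ((liftMap₁ M).mapH Ω) := by
  obtain ⟨x, i⟩ := a
  obtain ⟨y, j⟩ := b
  obtain ⟨y', j'⟩ := b'
  obtain ⟨h⟩ := Ω
  obtain ⟨f, w⟩ := f
  obtain ⟨f', w'⟩ := f'
  dsimp only at h f w
  subst h
  dsimp only at f' w'
  subst w w'
  exact ev f p f' θ

/-- The cell `liftCell` is `ev` transported along the equations carried by the vertical morphisms;
here the transport is dropped. -/
theorem liftCell_heq {x y : X} {i i' : (M.obj x).ob}
    (p : HPath HHom (⟨x, i⟩ : Elt (SetDiagram.of M)) ⟨x, i'⟩) {j j' : (M.obj y).ob} {f f' : x ⟶ y}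
    (w : (SetDiagram.of M).act f i = j) (w' : (SetDiagram.of M).act f' i' = j')
    (Ω : HHom (⟨y, j⟩ : Elt (SetDiagram.of M)) ⟨y, j'⟩) (θ : f ⟶ f') :
    liftCell (p := p) (b := ⟨y, j⟩) (b' := ⟨y, j'⟩)
      (f := (⟨f, w⟩ : Hom (⟨x, i⟩ : Elt (SetDiagram.of M)) ⟨y, j⟩))
      (f' := (⟨f', w'⟩ : Hom (⟨x, i'⟩ : Elt (SetDiagram.of M)) ⟨y, j'⟩)) (Ω := Ω) θ ≍
      ev f (a := ⟨x, i'⟩) p f' θ := by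
  subst w w'
  rfl

variable (M) in
/-- The action on objects, vertical and horizontal morphisms and multicells. -/
@[reducible]
def liftMap : VDMap (vdc (SetDiagram.of M)).toVDGraph A.toVDGraph where
  toVDMap₁ := liftMap₁ M
  mapCell θ := liftCell θ

/-- The heart of the existence proof, by induction on the string `Θ`. For the empty string it says
that `M` preserves left whiskering. Otherwise interchange writes the composite 2-cell as a part from
`κ` and the shorter string, followed by a part from the last multicell `θ`. The images of the two
parts are given by induction and by `cell_ev`, and they are multiplied by `ev_m_ev`. -/
theorem liftCell_comp {a : Elt (SetDiagram.of M)} : ∀ {a' b b' : Elt (SetDiagram.of M)}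
    {p : HPath HHom a a'} {f : a ⟶ b} {f' : a' ⟶ b'} {q : HPath HHom b b'}
    (Θ : (vdc (SetDiagram.of M)).CellPath p f f' q) {c c' : Elt (SetDiagram.of M)} {g : b ⟶ c}
    {g' : b' ⟶ c'} {Λ : HHom c c'} {k : a ⟶ c} {k' : a' ⟶ c'}
    (κ : (vdc (SetDiagram.of M)).Cell q g g' Λ) (hx : f ≫ g = k) (hx' : f' ≫ g' = k'),
    liftCell ((vdc (SetDiagram.of M)).comp κ Θ hx hx') =
      A.comp (liftCell κ) ((liftMap M).mapCellPath Θ) (by rw [← hx, (liftV M).map_comp])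
        (by rw [← hx', (liftV M).map_comp])
  | _, b, _, _, _, _, _, .nil f, c, c', g, g', Λ, k, k', κ, hx, hx' => by
    subst hx hx'
    have e := HHom.eq Λ
    have h := vdc_comp_heq κ (.nil f) rfl rfl
    obtain ⟨x, i⟩ := a
    obtain ⟨y, j⟩ := b
    obtain ⟨z, l⟩ := c
    obtain ⟨z', l'⟩ := c'
    obtain ⟨f, hf⟩ := f
    obtain ⟨g, hg⟩ := g
    obtain ⟨g', hg'⟩ := g'
    dsimp only at e f g g' hf hg hg'
    subst e hf
    subst hg hg'
    refine eq_of_heq ((liftCell_heq (M := M) _ _ _ _ _).trans ?_)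
    -- The total of an empty string is an identity 2-cell, so only left whiskering with `f` remains.
    have h' : (vdc (SetDiagram.of M)).comp κ (.nil _) rfl rfl = f ◁ (show g ⟶ g' from κ) :=
      (eq_of_heq h).trans ((congrArg _ (id_whiskerRight f g')).trans (Category.comp_id _))
    refine (heq_of_eq (congrArg (fun t => ev (f ≫ g) (a := ⟨x, i⟩) (.nil _) (f ≫ g') t) h')).trans ?_
    refine (ENatTrans.app_congr (M.map_comp f g) (M.map_comp f g')
      (map₂_wl_heq M f (show g ⟶ g' from κ)) i).trans ?_
    exact A.comp_heq _ _ _ _ rfl rfl rfl rfl rfl rfl rfl HEq.rfl HEq.rfl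
  | _, _, _, _, _, _, _, .cons (a' := a') (a'' := a'') (b := b) (b' := b') (b'' := b'') (u := f)
      (u' := f') (u'' := f'') (p := p) (q := q) (r := r) (Ω := Ω) Θ θ h,
      c, c', g, g', Λ, k, k', κ, hx, hx' => by
    subst hx hx' h
    have ih := @liftCell_comp a _ _ _ _ _ _ _ Θ
    have e₁ := pt_eq p
    have e₂ := pt_eq q
    have e₃ := pt_eq r
    have e₄ := HHom.eq Ω
    have e₅ := HHom.eq Λ
    have h := vdc_comp_heq κ (.cons Θ θ rfl) rfl rfl
    obtain ⟨x, i⟩ := a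
    obtain ⟨x', i'⟩ := a'
    obtain ⟨x'', i''⟩ := a''
    obtain ⟨y, j⟩ := b
    obtain ⟨y', j'⟩ := b'
    obtain ⟨y'', j''⟩ := b''
    obtain ⟨z, l⟩ := c
    obtain ⟨z', l'⟩ := c'
    dsimp only at e₁ e₂ e₃ e₄ e₅
    subst e₁ e₂ e₃ e₄ e₅
    obtain ⟨f, hf⟩ := f
    obtain ⟨f', hf'⟩ := f'
    obtain ⟨f'', hf''⟩ := f''
    obtain ⟨g, hg⟩ := g
    obtain ⟨g', hg'⟩ := g'
    dsimp only at f f' f'' g g' hf hf' hf'' hg hg'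
    subst hf hf' hf''
    subst hg hg'
    refine eq_of_heq ((liftCell_heq (M := M) _ _ _ _ _).trans ?_)
    -- A 2-cell may be placed above any string over the same point, so `κ` is reused as a multicell
    -- on the shorter string `q`, with its lower right corner moved to the image of `i'`.
    specialize ih (c := ⟨z, EFunctor.obj (M.map g) (EFunctor.obj (M.map f) i)⟩)
      (c' := ⟨z, EFunctor.obj (M.map g') (EFunctor.obj (M.map f') i')⟩)
      (g := ⟨g, rfl⟩) (g' := ⟨g', rfl⟩) (Λ := ⟨rfl⟩) κ rfl rfl
    have h₁ := vdc_comp_heq (Λ := ⟨rfl⟩) (c := ⟨z, EFunctor.obj (M.map g) (EFunctor.obj (M.map f) i)⟩)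
      (c' := ⟨z, EFunctor.obj (M.map g') (EFunctor.obj (M.map f') i')⟩)
      (g := ⟨g, rfl⟩) (g' := ⟨g', rfl⟩) κ Θ rfl rfl
    have h₂ := (liftCell_heq (M := M) _ _ _ _ _).symm.trans (heq_of_eq ih)
    let γ : f ≫ g ⟶ f' ≫ g' := hcomp (total Θ) κ
    let δ : f' ≫ g' ⟶ f'' ≫ g' := whiskerRight (f := f') (g := f'') θ g'
    have h' : (vdc (SetDiagram.of M)).comp κ (.cons Θ θ rfl) rfl rfl =
        γ ≫ δ := by
      exact (eq_of_heq h).trans (comp_hcomp _ _ _)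
    have h₃ := ev_m_ev (M := M) (f ≫ g) (f' ≫ g') p γ (a := ⟨x, i''⟩) r (f'' ≫ g')
      (show f' ≫ g' ⟶ castHom (pt_eq r) rfl (f'' ≫ g') from δ)
    -- The image of `κ` is a product whose last factor is the action of `M.map g'` on the last hom.
    -- Composing it with the image of the whole string thus composes the first factor with the image
    -- of `Θ` and the last factor with the image of `θ`.
    have h₄ := ECat.m_comp (M.obj z)
      (ev (i := EFunctor.obj (M.map f) i) g (a := ⟨y, EFunctor.obj (M.map f') i'⟩) q g' κ)
      (EFunctor.cell (M.map g') (EFunctor.obj (M.map f') i') (EFunctor.obj (M.map f'') i'')) rfl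
      ((liftMap M).mapCellPath Θ) (.single (liftCell θ)) ((liftMap M).mapCellPath (.cons Θ θ rfl))
      ((liftMap₁ M).mapPath_comp p r).symm
      (VDGraph.CellPath.cons_heq _ _ rfl rfl rfl rfl rfl rfl rfl HEq.rfl HEq.rfl) rfl rfl rfl
    have h₅ := cell_ev (M := M) f' g' (a := ⟨x, i''⟩) r f'' θ δ HEq.rfl
    refine (heq_of_eq (congrArg (fun t => ev (f ≫ g) (a := ⟨x, i''⟩) (p.comp r) (f'' ≫ g') t)
      h')).trans ?_
    refine (heq_of_eq h₃.symm).trans (HEq.trans ?_ ((heq_of_eq h₄.symm).trans ?_))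
    · refine ECat.m_heq _ (congrFun (congrArg EFunctor.obj (M.map_comp f g)) i)
        (congrFun (congrArg EFunctor.obj (M.map_comp f' g')) i')
        (congrFun (congrArg EFunctor.obj (M.map_comp f'' g')) i'') rfl rfl rfl
        (EFunctor.app_congr (M.map_comp f g) i) (EFunctor.app_congr (M.map_comp f' g') i')
        (EFunctor.app_congr (M.map_comp f'' g') i'') ?_ h₅.symm _ _
      refine (heq_of_eq (congrArg (fun t => ev (f ≫ g) (a := ⟨x, i'⟩) p (f' ≫ g') t)
        (eq_of_heq h₁).symm)).trans (h₂.trans ?_)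
      exact A.comp_heq _ _ _ _ rfl rfl rfl rfl rfl rfl rfl HEq.rfl HEq.rfl
    · exact A.comp_heq _ _ _ _ rfl rfl rfl rfl rfl rfl rfl HEq.rfl HEq.rfl

variable (M) in
/-- The virtual double functor classifying a diagram of enriched categories. -/
@[reducible]
def liftFunctor : VDFunctor (vdc (SetDiagram.of M)) A where
  toVDMap := liftMap M
  map_idCell {a b} Γ := by
    have e := HHom.eq Γ
    obtain ⟨x, i⟩ := a
    obtain ⟨y, j⟩ := b
    dsimp only at e
    subst e
    refine eq_of_heq (HEq.trans ?_ (A.castC_heq _ _ _ _).symm)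
    refine (liftCell_heq (M := M) (.single Γ) (f := 𝟙 x) (f' := 𝟙 x)
      ((SetDiagram.of M).act_id x i) ((SetDiagram.of M).act_id x j) Γ (𝟙 (𝟙 x))).trans ?_
    refine (heq_of_eq (ev_id_single (M := M) (𝟙 x) Γ)).trans ?_
    exact EFunctor.cell_congr (M.map_id x) i j
  map_comp κ Θ hx hx' := liftCell_comp Θ κ hx hx'

/-- Extents and homs agree by definition. The images of the universal unit and multiplication are
normal forms of the identity 2-cell of `𝟙 x` above strings of length zero and two, and `M.map (𝟙 x)`
is the identity functor. -/
theorem universal_liftFunctor_obj (x : X) :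
    (cat (SetDiagram.of M) x).map (liftFunctor M) = M.obj x := by
  refine ECat.ext' rfl HEq.rfl HEq.rfl (heq_of_eq ?_) (heq_of_eq ?_)
  · funext i
    refine eq_of_heq ((ECat.map_unit_heq (liftFunctor M) (cat (SetDiagram.of M) x) i).trans ?_)
    refine (liftCell_heq (M := M) (i' := i) (.nil _) (f := 𝟙 x) (f' := 𝟙 x)
      ((SetDiagram.of M).act_id x i) ((SetDiagram.of M).act_id x i) ⟨rfl⟩ (𝟙 (𝟙 x))).trans ?_
    refine (heq_of_eq (congrArg (fun t : M.map (𝟙 x) ⟶ M.map (𝟙 x) => ENatTrans.app t i)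
      (M.map₂_id (𝟙 x)))).trans ?_
    exact ECat.e_app_heq (M.map_id x) i
  · funext i₀ i₁ i₂
    refine eq_of_heq ((ECat.map_mul_heq (liftFunctor M) (cat (SetDiagram.of M) x) i₀ i₁ i₂).trans ?_)
    refine (liftCell_heq (M := M) (i := i₀) (i' := i₂)
      ((HPath.single ⟨rfl⟩).cons (b := ⟨x, i₁⟩) ⟨rfl⟩) (f := 𝟙 x)
      (f' := 𝟙 x) ((SetDiagram.of M).act_id x i₀) ((SetDiagram.of M).act_id x i₂) ⟨rfl⟩
      (𝟙 (𝟙 x))).trans ?_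
    refine (heq_of_eq (congrArg (fun t => (M.obj x).m
      (P := (HPath.single ((M.obj x).hom i₀ i₁)).cons ((M.obj x).hom i₁ i₂)) t
      (EFunctor.cell (M.map (𝟙 x)) i₁ i₂) rfl) (ev_id_single (i := i₀) (i' := i₁) (𝟙 x) ⟨rfl⟩))).trans ?_
    exact ECat.m_cell_heq (M.map_id x) i₀ i₁ i₂

/-- The action of a 1-cell on homs is the normal form of an identity 2-cell above a string of length
one. The components of 2-cells are nullary multicells, where `ev` returns the components of `M.map₂`
by definition. -/
theorem universal_liftFunctor : (universal (SetDiagram.of M)).comp (enrMap (liftFunctor M)) = M := by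
  have h₁ : ∀ {x y : X} (f : x ⟶ y),
      (functor (D := SetDiagram.of M) f).map (liftFunctor M) ≍ M.map f := by
    intro x y f
    refine EFunctor.heq (universal_liftFunctor_obj x) (universal_liftFunctor_obj y) HEq.rfl HEq.rfl
      (heq_of_eq ?_)
    funext i i'
    exact ev_id_single f _
  refine twoFunctor_ext universal_liftFunctor_obj h₁ ?_
  intro x y f g α
  exact ENatTrans.heq' (universal_liftFunctor_obj x) (universal_liftFunctor_obj y) (h₁ f) (h₁ g)
    HEq.rfl

end Elt
end ElementsLift
end VEnr

/-! ### Uniqueness of the classifying functor, and its 2-cells -/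

namespace VEnr
section ElementsUnique
universe w
open Bicategory

section congr

variable {A B : VDC.{w}}

theorem VDMap₁.ext' {A B : VDGraph.{w}} {F G : VDMap₁ A B} (h₀ : ∀ a, F.V.obj a = G.V.obj a)
    (h₁ : ∀ {a b : A.Obj} (f : a ⟶ b), F.V.map f ≍ G.V.map f)
    (h₂ : ∀ {a b : A.Obj} (Γ : A.HMor a b), F.mapH Γ ≍ G.mapH Γ) : F = G := by
  obtain ⟨⟨Fo, Fm, _, _⟩, Fh⟩ := F
  obtain ⟨⟨Go, Gm, _, _⟩, Gh⟩ := G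
  obtain rfl : Fo = Go := funext h₀
  obtain rfl : @Fm = @Gm := by funext a b f; exact eq_of_heq (h₁ f)
  obtain rfl : @Fh = @Gh := by funext a b Γ; exact eq_of_heq (h₂ Γ)
  rfl

theorem ECat.extent_heq {C D : ECat.{u} A} (h : C = D) {c : C.ob} {d : D.ob} (hc : c ≍ d) :
    C.extent c = D.extent d := by
  subst h; cases hc; rfl

theorem ECat.hom_heq {C D : ECat.{u} A} (h : C = D) {c c' : C.ob} {d d' : D.ob} (hc : c ≍ d)
    (hc' : c' ≍ d') : C.hom c c' ≍ D.hom d d' := by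
  subst h; cases hc; cases hc'; rfl

theorem ECat.mul_heq {C D : ECat.{u} A} (h : C = D) {c c' c'' : C.ob} {d d' d'' : D.ob}
    (hc : c ≍ d) (hc' : c' ≍ d') (hc'' : c'' ≍ d'') : C.mul c c' c'' ≍ D.mul d d' d'' := by
  subst h; cases hc; cases hc'; cases hc''; rfl

theorem EFunctor.app_heq {C D C' D' : ECat.{u} A} (hC : C = C') (hD : D = D') {f : EFunctor C D}
    {f' : EFunctor C' D'} (h : f ≍ f') {c : C.ob} {c' : C'.ob} (hc : c ≍ c') :
    f.app c ≍ f'.app c' := by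
  subst hC hD h; cases hc; rfl

theorem EFunctor.cell_heq {C D C' D' : ECat.{u} A} (hC : C = C') (hD : D = D') {f : EFunctor C D}
    {f' : EFunctor C' D'} (h : f ≍ f') {c d : C.ob} {c' d' : C'.ob} (hc : c ≍ c') (hd : d ≍ d') :
    f.cell c d ≍ f'.cell c' d' := by
  subst hC hD h; cases hc; cases hd; rfl

theorem ENatTrans.app_heq {C D C' D' : ECat.{u} A} (hC : C = C') (hD : D = D') {f g : EFunctor C D}
    {f' g' : EFunctor C' D'} (hf : f ≍ f') (hg : g ≍ g') {α : ENatTrans f g} {β : ENatTrans f' g'}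
    (h : α ≍ β) {c : C.ob} {c' : C'.ob} (hc : c ≍ c') : α.app c ≍ β.app c' := by
  subst hC hD hf hg h; cases hc; rfl

/-- Makes a pointwise equality of functions on objects definitional by repackaging the functor, so
that its vertical morphisms and cells need no transport. -/
theorem EFunctor.exists_eq_mk {C D : ECat.{u} A} (f : EFunctor C D) (o : C.ob → D.ob)
    (h : ∀ c, f.obj c = o c) : ∃ app cell h₁ h₂, f = ⟨o, app, cell, h₁, h₂⟩ := by
  obtain rfl : f.obj = o := funext h
  exact ⟨f.app, f.cell, f.map_unit, f.map_mul, rfl⟩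

theorem ECat.map_m (F : VDFunctor A B) (E : ECat.{u} A) {c₀ c₁ c₂ : E.ob} {a a' a'' : A.Obj}
    {p : HPath A.HMor a a'} {p' : HPath A.HMor a' a''} {P : HPath A.HMor a a''}
    {u : a ⟶ E.extent c₀} {u' : a' ⟶ E.extent c₁} {u'' : a'' ⟶ E.extent c₂}
    (θ : A.Cell p u u' (E.hom c₀ c₁)) (θ' : A.Cell p' u' u'' (E.hom c₁ c₂)) (h : p.comp p' = P)
    (h' : (F.mapPath p).comp (F.mapPath p') = F.mapPath P) :
    F.mapCell (E.m θ θ' h) = (E.map F).m (F.mapCell θ) (F.mapCell θ') h' := by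
  refine (F.map_comp _ _ _ _).trans (eq_of_heq ?_)
  exact B.comp_heq _ _ _ _ rfl rfl rfl rfl (F.V.map_id _) (F.V.map_id _) rfl
    (E.map_mul_heq F _ _ _).symm HEq.rfl

variable {X : Type w} [Bicategory.{w, w} X] {Y : Type*} [Bicategory Y]

theorem twoFunctor_obj {F G : StrictPseudofunctor X Y} (h : F = G) (x : X) : F.obj x = G.obj x := by
  rw [h]

theorem twoFunctor_map {F G : StrictPseudofunctor X Y} (h : F = G) {x y : X} (f : x ⟶ y) :
    F.map f ≍ G.map f := by
  rw [h]

theorem twoFunctor_map₂ {F G : StrictPseudofunctor X Y} (h : F = G) {x y : X} {f g : x ⟶ y}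
    (α : f ⟶ g) : F.map₂ α ≍ G.map₂ α := by
  rw [h]

end congr

variable {X : Type (max (u + 1) v)} [Bicategory.{max (u + 1) v, max (u + 1) v} X]
  [Strict X] {A : VDC.{max (u + 1) v}}

namespace Elt

variable {D : SetDiagram.{u, v} X}

/-- The multiplication and the action on homs are both identity 2-cells, so multiplying with them
changes only the string. Every multicell on a nonempty string thus factors through the same 2-cell
on the string without its last member. -/
theorem m_cell {x y : X} {i i' i'' : D.S x} {f f' : x ⟶ y}
    (p : HPath HHom (⟨x, i⟩ : Elt D) ⟨x, i'⟩) (Γ : HHom (⟨x, i'⟩ : Elt D) ⟨x, i''⟩)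
    (θ : f ⟶ f') :
    (cat D y).m (p := p) (p' := .single Γ) (P := p.cons Γ) (c₀ := D.act f i) (c₁ := D.act f' i')
      (c₂ := D.act f' i'') (u := (⟨f, rfl⟩ : Hom ⟨x, i⟩ _)) (u' := (⟨f', rfl⟩ : Hom ⟨x, i'⟩ _))
      (u'' := (⟨f', rfl⟩ : Hom ⟨x, i''⟩ _)) θ ((functor f').cell i' i'') rfl = θ :=
  eq_of_heq ((vdc_comp_heq _ _ _ _).trans <| (hcomp_id _).trans <| heq_of_eq <|
    (total_pair (D := D) _ _ _).trans (Category.comp_id θ))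

/-- By `m_cell` and induction on the string, multiplications, actions on homs and nullary multicells
generate all multicells. Units need no separate hypothesis, being nullary multicells. -/
theorem mapCell_ext {F G : VDFunctor (vdc D) A} (h : F.toVDMap₁ = G.toVDMap₁)
    (hm : ∀ (x : X) (i i' i'' : D.S x),
      F.mapCell ((cat D x).mul i i' i'') ≍ G.mapCell ((cat D x).mul i i' i''))
    (hc : ∀ {x y : X} (f : x ⟶ y) (i i' : D.S x),
      F.mapCell ((functor f).cell i i') ≍ G.mapCell ((functor f).cell i i'))
    (ha : ∀ {x y : X} {f g : x ⟶ y} (α : f ⟶ g) (i : D.S x),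
      F.mapCell ((natTrans α).app i) ≍ G.mapCell ((natTrans α).app i)) : F = G := by
  obtain ⟨⟨F₁, Fc⟩, hF, hF'⟩ := F
  obtain ⟨⟨G₁, Gc⟩, hG, hG'⟩ := G
  dsimp only at h
  subst h
  have key : ∀ {x y : X} {f : x ⟶ y} {i : D.S x} {a : Elt D} (p : HPath HHom ⟨x, i⟩ a)
      (f' : a.pt ⟶ y) (θ : f ⟶ castHom (pt_eq p) rfl f'),
      Fc (p := p) (Ω := ⟨rfl⟩) (u := (⟨f, rfl⟩ : Hom ⟨x, i⟩ ⟨y, D.act f i⟩))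
        (u' := (⟨f', rfl⟩ : Hom a ⟨y, D.act f' a.el⟩)) θ =
      Gc (p := p) (Ω := ⟨rfl⟩) (u := (⟨f, rfl⟩ : Hom ⟨x, i⟩ ⟨y, D.act f i⟩))
        (u' := (⟨f', rfl⟩ : Hom a ⟨y, D.act f' a.el⟩)) θ := by
    intro x y f i a p
    induction p with
    | nil => intro f' θ; exact eq_of_heq (ha θ i)
    | cons p Γ ih =>
      rename_i a₁ a₂
      intro f' θ
      have e := pt_eq p
      have e' := Γ.eq
      obtain ⟨x₁, i₁⟩ := a₁
      obtain ⟨x₂, i₂⟩ := a₂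
      dsimp only at e e'
      subst e e'
      have h₁ := m_cell p Γ (show f ⟶ f' from θ)
      refine (congrArg Fc h₁).symm.trans (Eq.trans ?_ (congrArg Gc h₁))
      refine (hF' _ _ _ _).trans (Eq.trans ?_ (hG' _ _ _ _).symm)
      refine eq_of_heq (A.comp_heq _ _ _ _ rfl rfl rfl rfl rfl rfl rfl (hm _ _ _ _) ?_)
      exact VDGraph.CellPath.pair_heq _ _ rfl rfl rfl rfl rfl rfl rfl (heq_of_eq (ih f' θ))
        (hc f' i₁ i₂)
  refine VDFunctor.ext' rfl ?_
  intro a a' b b' p f f' Ω θ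
  have e := pt_eq p
  have e' := HHom.eq Ω
  obtain ⟨x, i⟩ := a
  obtain ⟨x', i'⟩ := a'
  obtain ⟨y, j⟩ := b
  obtain ⟨y', j'⟩ := b'
  dsimp only at e e'
  subst e e'
  obtain ⟨f, hf⟩ := f
  obtain ⟨f', hf'⟩ := f'
  dsimp only at f f' hf hf'
  subst hf hf'
  exact heq_of_eq (key p f' θ)

/-- All generators of `vdc D` occur in the universal diagram: objects are extents, vertical
morphisms are the components of the functors, horizontal morphisms are homs, and the generating
multicells of `mapCell_ext` are its structure cells. -/
theorem universal_hom_ext {F G : VDFunctor (vdc D) A}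
    (h : (universal D).comp (enrMap F) = (universal D).comp (enrMap G)) : F = G := by
  have h₀ : ∀ x, (cat D x).map F = (cat D x).map G := fun x => twoFunctor_obj h x
  have h₁ : ∀ {x y : X} (f : x ⟶ y), (functor (D := D) f).map F ≍ (functor (D := D) f).map G :=
    fun f => twoFunctor_map h f
  have h₂ : ∀ {x y : X} {f g : x ⟶ y} (α : f ⟶ g),
      (natTrans (D := D) α).map F ≍ (natTrans (D := D) α).map G :=
    fun α => twoFunctor_map₂ h α
  refine mapCell_ext (VDMap₁.ext' (fun a => ECat.extent_heq (h₀ a.pt) (HEq.refl a.el)) ?_ ?_) ?_ ?_ ?_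
  · intro a b f
    obtain ⟨x, i⟩ := a
    obtain ⟨y, j⟩ := b
    obtain ⟨f, hf⟩ := f
    dsimp only at f hf
    subst hf
    exact EFunctor.app_heq (h₀ x) (h₀ y) (h₁ f) (HEq.refl i)
  · intro a b Γ
    have e := HHom.eq Γ
    obtain ⟨x, i⟩ := a
    obtain ⟨y, j⟩ := b
    dsimp only at e
    subst e
    exact ECat.hom_heq (h₀ x) (HEq.refl i) (HEq.refl j)
  · intro x i i' i''
    exact (ECat.map_mul_heq F (cat D x) i i' i'').symm.trans <|
      (ECat.mul_heq (h₀ x) (HEq.refl i) (HEq.refl i') (HEq.refl i'')).trans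
        (ECat.map_mul_heq G (cat D x) i i' i'')
  · intro x y f i i'
    exact EFunctor.cell_heq (h₀ x) (h₀ y) (h₁ f) (HEq.refl i) (HEq.refl i')
  · intro x y f g α i
    exact ENatTrans.app_heq (h₀ x) (h₀ y) (h₁ f) (h₁ g) (h₂ α) (HEq.refl i)

theorem universal_hom₂_ext {F G : VDFunctor (vdc D) A} {σ σ' : VertTrans F G}
    (h : ∀ x, enrApp σ (cat D x) = enrApp σ' (cat D x)) : σ = σ' := by
  refine VertTrans.ext' (fun a => ?_) ?_
  · exact eq_of_heq (EFunctor.app_congr (h a.pt) a.el)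
  · intro a b Γ
    have e := HHom.eq Γ
    obtain ⟨x, i⟩ := a
    obtain ⟨y, j⟩ := b
    dsimp only at e
    subst e
    exact EFunctor.cell_congr (h x) i j

/-- The components at objects and at horizontal morphisms are read off from `τ`. Naturality against
a multicell follows by induction along `m_cell`: nullary multicells are covered by naturality of `τ`
on 2-cells, actions on homs by naturality on 1-cells, and products by the compatibility of the
functors `τ.app x` with multiplication. -/
theorem exists_vertTrans {F G : VDFunctor (vdc D) A}
    (τ : TwoNatTrans ((universal D).comp (enrMap F)) ((universal D).comp (enrMap G)))
    (hτ : ∀ (x : X) (i : D.S x), EFunctor.obj (τ.app x) i = i) :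
    ∃ σ : VertTrans F G, ∀ x, enrApp σ (cat D x) = τ.app x := by
  -- The components of `τ` are repackaged so as to be the identity on objects by definition; `t x i`
  -- and `c x i j` then have exactly the boundaries required of a vertical transformation.
  have h := fun x => EFunctor.exists_eq_mk (C := (cat D x).map F) (D := (cat D x).map G) (τ.app x)
    (fun i => i) (hτ x)
  choose t c h₁ h₂ ht using h
  let T : ∀ x, EFunctor ((cat D x).map F) ((cat D x).map G) :=
    fun x => ⟨fun i => i, t x, c x, h₁ x, h₂ x⟩
  have hn : ∀ {x y : X} (f : x ⟶ y),
      ((functor (D := D) f).map F).comp (T y) = (T x).comp ((functor (D := D) f).map G) := by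
    intro x y f
    have := τ.naturality f
    rw [ht x, ht y] at this
    exact this
  have hn₂ : ∀ {x y : X} {f g : x ⟶ y} (α : f ⟶ g),
      ENatTrans.whiskerR ((natTrans (D := D) α).map F) (T y) ≍
        ENatTrans.whiskerL (T x) ((natTrans (D := D) α).map G) := by
    intro x y f g α
    have := τ.naturality₂_heq α
    rw [ht x, ht y] at this
    exact this
  let app : F.V ⟶ G.V :=
    { app := fun a => t a.pt a.el
      naturality := by
        intro a b f
        obtain ⟨x, i⟩ := a
        obtain ⟨y, j⟩ := b
        obtain ⟨f, hf⟩ := f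
        dsimp only at f hf
        subst hf
        exact eq_of_heq (EFunctor.app_congr (hn f) i) }
  let cell : ∀ {a b : Elt D} (Γ : HHom a b),
      A.Cell (.single (F.mapH Γ)) (app.app a) (app.app b) (G.mapH Γ) := by
    intro a b Γ
    obtain ⟨x, i⟩ := a
    obtain ⟨y, j⟩ := b
    obtain ⟨h⟩ := Γ
    dsimp only at h
    subst h
    exact c x i j
  let σ₀ : VertData F G := ⟨app, cell⟩
  have key : ∀ {x y : X} {f : x ⟶ y} {i : D.S x} {a : Elt D} (p : HPath HHom ⟨x, i⟩ a)
      (f' : a.pt ⟶ y) (θ : f ⟶ castHom (pt_eq p) rfl f'),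
      A.comp (c y (D.act f i) (D.act f' a.el)) (.single (F.mapCell (p := p) (Ω := ⟨rfl⟩)
        (u := (⟨f, rfl⟩ : Hom ⟨x, i⟩ ⟨y, D.act f i⟩))
        (u' := (⟨f', rfl⟩ : Hom a ⟨y, D.act f' a.el⟩)) θ)) rfl rfl =
      A.comp (G.mapCell (p := p) (Ω := ⟨rfl⟩) (u := (⟨f, rfl⟩ : Hom ⟨x, i⟩ ⟨y, D.act f i⟩))
        (u' := (⟨f', rfl⟩ : Hom a ⟨y, D.act f' a.el⟩)) θ) (σ₀.cellPath p)
        (app.naturality (X := (⟨x, i⟩ : Elt D)) (⟨f, rfl⟩ : Hom ⟨x, i⟩ ⟨y, D.act f i⟩)).symm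
        (app.naturality (⟨f', rfl⟩ : Hom a ⟨y, D.act f' a.el⟩)).symm := by
    intro x y f i a p
    induction p with
    | nil =>
      intro f' θ
      refine eq_of_heq ((ENatTrans.app_congr (hn f) (hn f') (hn₂ θ) i).trans ?_)
      exact A.comp_heq _ _ _ _ rfl rfl rfl rfl rfl rfl rfl HEq.rfl HEq.rfl
    | cons p Γ ih =>
      rename_i a₁ a₂
      intro f' θ
      have e := pt_eq p
      have e' := Γ.eq
      obtain ⟨x₁, i₁⟩ := a₁
      obtain ⟨x₂, i₂⟩ := a₂
      dsimp only at e e'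
      subst e e'
      have h₁ := m_cell p Γ (show f ⟶ f' from θ)
      have hF := (congrArg F.mapCell h₁).symm.trans (ECat.map_m F (cat D y) _ _ _ rfl)
      have hG := (congrArg G.mapCell h₁).symm.trans (ECat.map_m G (cat D y) _ _ _ rfl)
      have n := fun i => (app.naturality (X := (⟨x, i⟩ : Elt D))
        (⟨f', rfl⟩ : Hom ⟨x, i⟩ ⟨y, D.act f' i⟩)).symm
      -- Naturality of `τ` on the 1-cell `f'`, read on the last hom of the string; this and the
      -- inductive hypothesis are the two factors of the product.
      have hc : A.comp (c y _ _) (.single (F.mapCell ((functor (D := D) f').cell i₁ i₂))) rfl rfl =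
          A.comp (G.mapCell ((functor (D := D) f').cell i₁ i₂)) (.single (c x i₁ i₂)) (n i₁) (n i₂) :=
        eq_of_heq ((EFunctor.cell_congr (hn f') i₁ i₂).trans
          (A.comp_heq _ _ _ _ rfl rfl rfl rfl rfl rfl rfl HEq.rfl HEq.rfl))
      have h₃ := EFunctor.cell_m (T y) (P := F.mapPath (p.cons Γ)) (F.mapCell (p := p) (Ω := ⟨rfl⟩)
        (u := (⟨f, rfl⟩ : Hom ⟨x, i⟩ ⟨y, D.act f i⟩))
        (u' := (⟨f', rfl⟩ : Hom ⟨x, i₁⟩ ⟨y, D.act f' i₁⟩)) θ)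
        (F.mapCell ((functor (D := D) f').cell i₁ i₂)) rfl rfl rfl rfl
      have h₄ := ECat.m_comp ((cat D y).map G) (P := G.mapPath (p.cons Γ))
        (G.mapCell (p := p) (Ω := ⟨rfl⟩) (u := (⟨f, rfl⟩ : Hom ⟨x, i⟩ ⟨y, D.act f i⟩))
        (u' := (⟨f', rfl⟩ : Hom ⟨x, i₁⟩ ⟨y, D.act f' i₁⟩)) θ)
        (G.mapCell ((functor (D := D) f').cell i₁ i₂)) rfl (σ₀.cellPath p) (.single (c x i₁ i₂))
        (σ₀.cellPath (p.cons Γ)) rfl HEq.rfl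
        (app.naturality (X := (⟨x, i⟩ : Elt D)) (⟨f, rfl⟩ : Hom ⟨x, i⟩ ⟨y, D.act f i⟩)).symm
        (n i₁) (n i₂)
      refine (congrArg (fun t => A.comp (c y _ _) (.single t) rfl rfl) hF).trans (h₃.trans ?_)
      refine Eq.trans ?_ (h₄.symm.trans (congrArg (fun t => A.comp t (σ₀.cellPath (p.cons Γ))
        (app.naturality (X := (⟨x, i⟩ : Elt D)) (⟨f, rfl⟩ : Hom ⟨x, i⟩ ⟨y, D.act f i⟩)).symm (n i₂))
        hG).symm)
      exact congrArg₂ (fun t t' => ((cat D y).map G).m (P := F.mapPath (p.cons Γ)) t t' rfl)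
        (ih f' θ) hc
  refine ⟨⟨σ₀, ?_⟩, ?_⟩
  · intro a a' b b' p f f' Ω θ
    have e := pt_eq p
    have e' := HHom.eq Ω
    obtain ⟨x, i⟩ := a
    obtain ⟨x', i'⟩ := a'
    obtain ⟨y, j⟩ := b
    obtain ⟨y', j'⟩ := b'
    dsimp only at e e'
    subst e e'
    obtain ⟨f, hf⟩ := f
    obtain ⟨f', hf'⟩ := f'
    dsimp only at f f' hf hf'
    subst hf hf'
    exact key p f' θ
  · intro x
    exact (ht x).symm

end Elt
end ElementsUnique
end VEnr

/-! ### The slice over `Enr 1` and the parametric right 2-adjoint -/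

namespace VEnr
section OverOne
universe w
open Bicategory

/-- Everything but the set of objects lives in a subsingleton. Together with `EFunctor.one_ext` and
the instance on transformations, this identifies `Enr 1` with sets, functions and at most one 2-cell
between any two functions. -/
theorem ECat.one_ext {C D : ECat.{u} VDC.one.{w}} (h : C.ob = D.ob) : C = D := by
  obtain ⟨o, x, h₁, e, m, _, _, _⟩ := C
  obtain ⟨o', x', h₁', e', m', _, _, _⟩ := D
  cases h
  obtain rfl : x = x' := Subsingleton.elim _ _
  obtain rfl : h₁ = h₁' := Subsingleton.elim _ _
  obtain rfl : e = e' := Subsingleton.elim _ _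
  obtain rfl : m = m' := Subsingleton.elim _ _
  rfl

theorem EFunctor.one_ext {C D : ECat.{u} VDC.one.{w}} {f g : EFunctor C D}
    (h : ∀ c, f.obj c = g.obj c) : f = g := by
  obtain ⟨o, a, c, _, _⟩ := f
  obtain ⟨o', a', c', _, _⟩ := g
  obtain rfl : o = o' := funext h
  obtain rfl : a = a' := Subsingleton.elim _ _
  obtain rfl : c = c' := Subsingleton.elim _ _
  rfl

theorem EFunctor.one_heq {C C' D D' : ECat.{u} VDC.one.{w}} (hC : C = C') (hD : D = D')
    {f : EFunctor C D} {g : EFunctor C' D'} (h : f.obj ≍ g.obj) : f ≍ g := by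
  subst hC hD
  exact heq_of_eq (EFunctor.one_ext fun c => congrFun (eq_of_heq h) c)

instance {C D : ECat.{u} VDC.one.{w}} (f g : EFunctor C D) : Subsingleton (ENatTrans f g) :=
  ⟨fun _ _ => ENatTrans.ext' fun _ => Subsingleton.elim _ _⟩

theorem ENatTrans.one_heq {C C' D D' : ECat.{u} VDC.one.{w}} (hC : C = C') (hD : D = D')
    {f g : EFunctor C D} {f' g' : EFunctor C' D'} (hf : f ≍ f') (hg : g ≍ g') (α : ENatTrans f g)
    (β : ENatTrans f' g') : α ≍ β := by
  subst hC hD hf hg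
  exact heq_of_eq (Subsingleton.elim _ _)

theorem EFunctor.obj_eqToHom {A : VDC.{w}} {C D : ECat.{u} A} (h : C = D) (c : C.ob) :
    EFunctor.obj (eqToHom h) c ≍ c := by
  subst h; rfl

/-- 2-functors into sets with the chaotic 2-cells are determined by their underlying functors. -/
theorem twoFunctor_one_ext {X : Type*} [Bicategory X]
    {F G : StrictPseudofunctor X (ECat.{u} VDC.one.{w})} (h₀ : ∀ x, (F.obj x).ob = (G.obj x).ob)
    (h₁ : ∀ {x y : X} (f : x ⟶ y), EFunctor.obj (F.map f) ≍ EFunctor.obj (G.map f)) : F = G :=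
  have e₀ : ∀ x, F.obj x = G.obj x := fun x => ECat.one_ext (h₀ x)
  have e₁ : ∀ {x y : X} (f : x ⟶ y), F.map f ≍ G.map f := fun {x y} f =>
    EFunctor.one_heq (e₀ x) (e₀ y) (h₁ f)
  twoFunctor_ext e₀ e₁ fun {x y f g} α =>
    ENatTrans.one_heq (e₀ x) (e₀ y) (e₁ f) (e₁ g) (F.map₂ α) (G.map₂ α)

theorem TwoCAT.eqToHom_app {K L : TwoCAT.{w}} {F G : K ⟶ L} (h : F = G) (x : K) :
    TwoNatTrans.app (eqToHom h) x = eqToHom (by rw [h]) := by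
  subst h; rfl

-- Enriched functors induced by `F` do not change sets of objects, so over the terminal virtual
-- double category nothing but the diagram of sets remains. This places the universal arrow in the
-- slice.
open Elt in
theorem universal_comp_enrMap_one {K : Type (max (u + 1) v)}
    [Bicategory.{max (u + 1) v, max (u + 1) v} K] [Strict K]
    (P : StrictPseudofunctor K (ECat.{u} VDC.one.{max (u + 1) v}))
    (F : VDFunctor (vdc (SetDiagram.of.{u, v} P)) VDC.one) :
    (universal (SetDiagram.of.{u, v} P)).comp (enrMap F) = P :=
  twoFunctor_one_ext (fun _ => rfl) (fun _ => HEq.rfl)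

open Elt in
/-- The universal arrows exhibiting `Enr` as a parametric right 2-adjoint. -/
noncomputable def enrUniversalArrows :
    UniversalArrows (toSlice VDC.oneIsTerminal.{max (u + 1) v} Enr.{u, v}) where
  obj P := vdc (SetDiagram.of.{u, v} (X := P.obj) P.hom)
  arrow P := ⟨universal (SetDiagram.of.{u, v} (X := P.obj) P.hom),
    universal_comp_enrMap_one (K := P.obj) P.hom _⟩
  exists_lift {P A} f := by
    obtain ⟨K, P⟩ := P
    obtain ⟨M, w⟩ := f
    dsimp only at M w
    -- The triangle over `Enr 1` commutes strictly, so `P` is the diagram of sets of objects of `M`,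
    -- and the classifying functor of `M` starts at the right virtual double category.
    subst w
    exact ⟨liftFunctor (X := K) (A := A) M,
      Slice.hom_ext (universal_liftFunctor.{u, v} (X := K) (A := A) (M := M))⟩
  hom_ext {P A h h'} e := universal_hom_ext (X := P.obj) (congrArg Slice.Hom.left e)
  exists_lift₂ {P A h h'} τ := by
    -- A 2-cell of the slice becomes an identity over `Enr 1`, which means that its components are
    -- the identity on objects, as `exists_vertTrans` requires.
    have hw := Slice.Hom₂.w τ
    obtain ⟨σ, hσ⟩ := exists_vertTrans (X := P.obj) (D := SetDiagram.of.{u, v} (X := P.obj) P.hom)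
      (Slice.Hom₂.left τ) (fun x i => by
        have h₁ := congrArg (fun t => TwoNatTrans.app t x) hw
        have h₂ := congrArg (fun t => EFunctor.obj t i) (h₁.trans (TwoCAT.eqToHom_app _ x))
        exact h₂.trans (eq_of_heq (EFunctor.obj_eqToHom _ _)))
    exact ⟨σ, Slice.hom₂_ext (TwoNatTrans.ext hσ)⟩
  hom₂_ext {P A h h' σ σ'} e := universal_hom₂_ext (X := P.obj) fun x =>
    congrArg (fun t => TwoNatTrans.app (Slice.Hom₂.left t) x) e

theorem isParametricRightTwoAdjoint_enr :
    IsParametricRightTwoAdjoint VDC.oneIsTerminal.{max (u + 1) v} Enr.{u, v} :=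
  enrUniversalArrows.isRightTwoAdjoint

end OverOne
end VEnr

/-! ### Restriction of enriched categories along functions -/

namespace VEnr
section Pull
universe w
open Bicategory

variable {A B : VDC.{w}}

namespace ECat

/-- The restriction of an enriched category along a function into its set of objects. -/
@[reducible]
def pull (D : ECat.{u} A) {S : Type u} (ψ : S → D.ob) : ECat.{u} A where
  ob := S
  extent s := D.extent (ψ s)
  hom s s' := D.hom (ψ s) (ψ s')
  unit s := D.unit (ψ s)
  mul s₀ s₁ s₂ := D.mul (ψ s₀) (ψ s₁) (ψ s₂)
  unit_mul _ _ := D.unit_mul _ _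
  mul_unit _ _ := D.mul_unit _ _
  mul_assoc _ _ _ _ := D.mul_assoc _ _ _ _

variable {C D : ECat.{u} A} {S : Type u} {ψ : S → D.ob}

/-- The fully faithful functor from a restriction of `D` to `D`. -/
@[reducible]
def incl (D : ECat.{u} A) {S : Type u} (ψ : S → D.ob) : EFunctor (D.pull ψ) D where
  obj := ψ
  app s := 𝟙 _
  cell s s' := A.idCell _
  map_unit s := (EFunctor.id D).map_unit (ψ s)
  map_mul _ _ _ := (EFunctor.id D).map_mul _ _ _

/-- The functor underlying a functor into a restriction. -/
@[reducible]
def underlying (G : EFunctor C (D.pull ψ)) : EFunctor C D where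
  obj c := ψ (G.obj c)
  app := G.app
  cell := G.cell
  map_unit := G.map_unit
  map_mul := G.map_mul

/-- Composition with `incl` composes all data with identities of `D`, so this is the right unit law
for the underlying functor. It is not definitional, which is why lifts below are obtained from
existence statements. -/
theorem comp_incl (G : EFunctor C (D.pull ψ)) : G.comp (D.incl ψ) = underlying G :=
  comp_id₁ (underlying G)

theorem incl_comp_incl (D : ECat.{u} A) {S T : Type u} (ψ : S → D.ob) (χ : T → S) :
    ((D.pull ψ).incl χ).comp (D.incl ψ) = D.incl (fun t => ψ (χ t)) :=
  comp_incl _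

/-- The function on objects must be compared separately because `ψ` need not be injective. -/
theorem pull_hom_ext {G G' : EFunctor C (D.pull ψ)} (h₀ : ∀ c, G.obj c = G'.obj c)
    (h : G.comp (D.incl ψ) = G'.comp (D.incl ψ)) : G = G' := by
  rw [comp_incl, comp_incl] at h
  obtain ⟨o, a, k, _, _⟩ := G
  obtain ⟨o', a', k', _, _⟩ := G'
  obtain rfl : o = o' := funext h₀
  injection h with _ h₁ h₂
  cases h₁; cases h₂
  rfl

/-- Full faithfulness: the homs of the restriction are homs of `D`, so the data of `F` serve
unchanged once its function on objects is written as `ψ` after `k`. -/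
theorem exists_pullLift (F : EFunctor C D) (k : C.ob → S) (h : ∀ c, F.obj c = ψ (k c)) :
    ∃ app cell h₁ h₂, (⟨k, app, cell, h₁, h₂⟩ : EFunctor C (D.pull ψ)).comp (D.incl ψ) = F := by
  obtain ⟨a, k', h₁, h₂, rfl⟩ := F.exists_eq_mk _ h
  exact ⟨a, k', h₁, h₂, comp_incl _⟩

/-- The functor into a restriction of `D` with a given underlying functor and a given function on
objects. -/
noncomputable def pullLift (F : EFunctor C D) (k : C.ob → S) (h : ∀ c, F.obj c = ψ (k c)) :
    EFunctor C (D.pull ψ) where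
  obj := k
  app := (exists_pullLift F k h).choose
  cell := (exists_pullLift F k h).choose_spec.choose
  map_unit := (exists_pullLift F k h).choose_spec.choose_spec.choose
  map_mul := (exists_pullLift F k h).choose_spec.choose_spec.choose_spec.choose

theorem pullLift_comp_incl (F : EFunctor C D) (k : C.ob → S) (h : ∀ c, F.obj c = ψ (k c)) :
    (pullLift F k h).comp (D.incl ψ) = F :=
  (exists_pullLift F k h).choose_spec.choose_spec.choose_spec.choose_spec

theorem whiskerR_incl_heq {G G' : EFunctor C (D.pull ψ)} (α : ENatTrans G G') (c : C.ob) :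
    (ENatTrans.whiskerR α (D.incl ψ)).app c ≍ α.app c :=
  HEq.trans (A.comp_heq _ _ _ _ rfl rfl rfl rfl rfl rfl rfl HEq.rfl HEq.rfl)
    (heq_of_eq (A.id_comp' (α.app c)))

theorem pull_hom₂_ext {G G' : EFunctor C (D.pull ψ)} {α β : ENatTrans G G'}
    (h : ENatTrans.whiskerR α (D.incl ψ) = ENatTrans.whiskerR β (D.incl ψ)) : α = β :=
  ENatTrans.ext' fun c => eq_of_heq ((whiskerR_incl_heq α c).symm.trans
    ((heq_of_eq (congrArg (fun t => ENatTrans.app t c) h)).trans (whiskerR_incl_heq β c)))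

theorem exists_pullLift₂ {G G' : EFunctor C (D.pull ψ)}
    (τ : ENatTrans (G.comp (D.incl ψ)) (G'.comp (D.incl ψ))) :
    ∃ α : ENatTrans G G', ENatTrans.whiskerR α (D.incl ψ) = τ := by
  -- The boundaries are generalized so that the propositional equalities `comp_incl` can be
  -- eliminated; the components then carry over as they are.
  have key : ∀ {H H' : EFunctor C D} (h : H = underlying G) (h' : H' = underlying G')
      (τ : ENatTrans H H'), ∃ α : ENatTrans G G', ∀ c, α.app c ≍ τ.app c := by
    intro H H' h h' τ
    subst h h'
    exact ⟨⟨τ.app, τ.naturality⟩, fun c => HEq.rfl⟩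
  obtain ⟨α, hα⟩ := key (comp_incl G) (comp_incl G') τ
  exact ⟨α, ENatTrans.ext' fun c => eq_of_heq ((whiskerR_incl_heq α c).trans (hα c))⟩

/-- A form of `pull_hom_ext` for categories that are only propositionally equal to restrictions, as
in `restrict_unique`. -/
theorem pull_hom_heq {C C' D' : ECat.{u} A} (hC : C = C') (hD : D' = D.pull ψ) {G : C ⟶ D'}
    {i : D' ⟶ D} (hi : i ≍ D.incl ψ) {G' : C' ⟶ D.pull ψ}
    (h₀ : EFunctor.obj G ≍ EFunctor.obj G') (h : G ≫ i ≍ (show C' ⟶ D from G' ≫ D.incl ψ)) :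
    G ≍ G' := by
  subst hC hD hi
  exact heq_of_eq (pull_hom_ext (fun c => congrFun (eq_of_heq h₀) c) (eq_of_heq h))

theorem pull_hom₂_heq {C C' D' : ECat.{u} A} (hC : C = C') (hD : D' = D.pull ψ) {G H : C ⟶ D'}
    {i : D' ⟶ D} (hi : i ≍ D.incl ψ) {G' H' : C' ⟶ D.pull ψ} (hG : G ≍ G') (hH : H ≍ H')
    {α : G ⟶ H} {α' : G' ⟶ H'}
    (h : α ▷ i ≍ whiskerRight (B := ECat.{u} A) α' (D.incl ψ)) : α ≍ α' := by
  subst hC hD hi hG hH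
  exact heq_of_eq (pull_hom₂_ext (eq_of_heq h))

end ECat

theorem comp_heq_of_heq {X : Type*} [Bicategory X] {a a' b c : X} (h : a = a') {i : a ⟶ b}
    {i' : a' ⟶ b} (hi : i ≍ i') (g : b ⟶ c) : i ≫ g ≍ i' ≫ g := by
  subst h hi; rfl

theorem whiskerLeft_heq_of_heq {X : Type*} [Bicategory X] {a a' b c : X} (h : a = a') {i : a ⟶ b}
    {i' : a' ⟶ b} (hi : i ≍ i') {g g' : b ⟶ c} (α : g ⟶ g') : i ◁ α ≍ i' ◁ α := by
  subst h hi; rfl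

section restrict

variable {X : Type*} [Bicategory X] (M : StrictPseudofunctor X (ECat.{u} A))
  (N : StrictPseudofunctor X (ECat.{u} B)) (φ : ∀ x, (N.obj x).ob → (M.obj x).ob)

/-- Compatibility of functions `φ x : (N x).ob → (M x).ob` with 1-cells. -/
structure ObNatural : Prop where
  naturality : ∀ {x y : X} (f : x ⟶ y) (s : (N.obj x).ob),
    EFunctor.obj (M.map f) (φ x s) = φ y (EFunctor.obj (N.map f) s)

variable {M N φ} (hφ : ObNatural M N φ)

namespace ObNatural

/-- The restriction along `φ` on 1-cells. -/
noncomputable def map {x y : X} (f : x ⟶ y) : (M.obj x).pull (φ x) ⟶ (M.obj y).pull (φ y) :=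
  -- Since `φ y` need not be injective, `M.map f` does not determine the action on objects; it is
  -- taken from `N`.
  ECat.pullLift (((M.obj x).incl (φ x)).comp (M.map f)) (EFunctor.obj (N.map f)) (hφ.naturality f)

/-- The inclusion of the restriction along `φ`. -/
@[reducible]
def ι (hφ : ObNatural M N φ) (x : X) : (M.obj x).pull (φ x) ⟶ M.obj x :=
  (M.obj x).incl (φ x)

theorem map_ι {x y : X} (f : x ⟶ y) : hφ.map f ≫ hφ.ι y = hφ.ι x ≫ M.map f :=
  ECat.pullLift_comp_incl _ _ _

theorem hom_ext {C : ECat.{u} A} {x : X} {G G' : C ⟶ (M.obj x).pull (φ x)}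
    (h₀ : ∀ c, EFunctor.obj G c = EFunctor.obj G' c) (h : G ≫ hφ.ι x = G' ≫ hφ.ι x) : G = G' :=
  ECat.pull_hom_ext h₀ h

theorem hom₂_ext {C : ECat.{u} A} {x : X} {G G' : C ⟶ (M.obj x).pull (φ x)} {α β : G ⟶ G'}
    (h : α ▷ hφ.ι x = β ▷ hφ.ι x) : α = β :=
  ECat.pull_hom₂_ext h

theorem hom₂_heq {C : ECat.{u} A} {x : X} {G G' H H' : C ⟶ (M.obj x).pull (φ x)} (hG : G = H)
    (hG' : G' = H') {α : G ⟶ G'} {β : H ⟶ H'} (h : α ▷ hφ.ι x ≍ β ▷ hφ.ι x) : α ≍ β := by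
  subst hG hG'
  exact heq_of_eq (hφ.hom₂_ext (eq_of_heq h))

theorem exists_map₂ {x y : X} {f g : x ⟶ y} (α : f ⟶ g) :
    ∃ τ : hφ.map f ⟶ hφ.map g, τ ▷ hφ.ι y ≍ hφ.ι x ◁ M.map₂ α := by
  obtain ⟨τ, hτ⟩ := ECat.exists_pullLift₂ (G := hφ.map f) (G' := hφ.map g)
    (eqToHom (hφ.map_ι f) ≫ hφ.ι x ◁ M.map₂ α ≫ eqToHom (hφ.map_ι g).symm)
  exact ⟨τ, (heq_of_eq hτ).trans
    ((eqToHom_comp_heq _ _).trans (comp_eqToHom_heq _ _))⟩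

/-- The restriction along `φ` on 2-cells. -/
noncomputable def map₂ {x y : X} {f g : x ⟶ y} (α : f ⟶ g) : hφ.map f ⟶ hφ.map g :=
  (hφ.exists_map₂ α).choose

theorem map₂_ι {x y : X} {f g : x ⟶ y} (α : f ⟶ g) :
    hφ.map₂ α ▷ hφ.ι y ≍ hφ.ι x ◁ M.map₂ α :=
  (hφ.exists_map₂ α).choose_spec

/-- Functoriality of `N` gives agreement on objects and functoriality of `M` gives agreement after
the inclusion; `map_comp` holds for the same reason. -/
theorem map_id (x : X) : hφ.map (𝟙 x) = 𝟙 ((M.obj x).pull (φ x)) :=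
  hφ.hom_ext (fun s => by
    change EFunctor.obj (N.map (𝟙 x)) s = s
    rw [N.map_id]; rfl) (by rw [map_ι, M.map_id, Strict.id_comp, Strict.comp_id])

theorem map_comp {x y z : X} (f : x ⟶ y) (g : y ⟶ z) : hφ.map (f ≫ g) = hφ.map f ≫ hφ.map g :=
  hφ.hom_ext (fun s => by
    change EFunctor.obj (N.map (f ≫ g)) s = EFunctor.obj (N.map g) (EFunctor.obj (N.map f) s)
    rw [N.map_comp]; rfl)
    (by rw [map_ι, M.map_comp, Strict.assoc, map_ι, ← Strict.assoc, ← Strict.assoc, map_ι])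

/-- The restriction of a 2-functor into enriched categories along functions on objects. -/
noncomputable def restrict [Strict X] : StrictPseudofunctor X (ECat.{u} A) :=
  mkTwoFunctor (fun x => (M.obj x).pull (φ x)) (fun f => hφ.map f) (fun α => hφ.map₂ α)
    hφ.map_id hφ.map_comp
    (fun f => hφ.hom₂_ext (eq_of_heq ((hφ.map₂_ι (𝟙 f)).trans (by
      rw [M.map₂_id, whiskerLeft_id, id_whiskerRight]
      exact id_heq_id (hφ.map_ι f).symm))))
    (fun {x y f g h} α β => hφ.hom₂_ext (eq_of_heq ((hφ.map₂_ι (α ≫ β)).trans (by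
      rw [M.map₂_comp, whiskerLeft_comp, comp_whiskerRight]
      exact comp_heq_comp (hφ.map_ι f).symm (hφ.map_ι g).symm (hφ.map_ι h).symm
        (hφ.map₂_ι α).symm (hφ.map₂_ι β).symm))))
    (fun {x y z} f {g h} β => hφ.hom₂_heq (hφ.map_comp f g) (hφ.map_comp f h) <|
      (hφ.map₂_ι (f ◁ β)).trans <|
      (wl_heq rfl (M.map_comp _ _) (M.map_comp _ _) (map₂_wl_heq M _ _)).trans <|
      (comp_wl_heq _ _ _).symm.trans <|
      (wl_heq (hφ.map_ι f).symm rfl rfl HEq.rfl).trans <|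
      (comp_wl_heq _ _ _).trans <|
      (wl_heq rfl (hφ.map_ι g).symm (hφ.map_ι h).symm (hφ.map₂_ι β).symm).trans
      (wl_wr_heq _ _ _).symm)
    (fun {x y z f g} α h => hφ.hom₂_heq (hφ.map_comp f h) (hφ.map_comp g h) <|
      (hφ.map₂_ι (α ▷ h)).trans <|
      (wl_heq rfl (M.map_comp _ _) (M.map_comp _ _) (map₂_wr_heq M _ _)).trans <|
      (wl_wr_heq _ _ _).symm.trans <|
      (wr_heq rfl (hφ.map_ι f).symm (hφ.map_ι g).symm (hφ.map₂_ι α).symm).trans <|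
      (wr_comp_heq _ _ _).symm.trans <|
      (wr_heq (hφ.map_ι h).symm rfl rfl HEq.rfl).trans (wr_comp_heq _ _ _))

variable [Strict X]

/-- The inclusion of a restriction as a 2-natural transformation. -/
noncomputable def inclusion : TwoNatTrans hφ.restrict M :=
  TwoNatTrans.mk' (fun x => hφ.ι x) (fun f => hφ.map_ι f) (fun α => hφ.map₂_ι α)

/-- Since the inclusions are fully faithful, the action of a 2-functor on 1-cells and 2-cells is
forced by pointwise restriction, 2-naturality of the inclusions and the action on objects.
Identities, composites, precomposition and change of base are all handled by recognizing their
candidates through this criterion. -/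
theorem restrict_unique {M'' : StrictPseudofunctor X (ECat.{u} A)} (γ : TwoNatTrans M'' M)
    (h₀ : ∀ x, M''.obj x = (M.obj x).pull (φ x)) (h₁ : ∀ x, γ.app x ≍ (M.obj x).incl (φ x))
    (h₂ : ∀ {x y : X} (f : x ⟶ y), EFunctor.obj (M''.map f) ≍ EFunctor.obj (N.map f)) :
    hφ.restrict = M'' ∧ hφ.inclusion ≍ γ := by
  have e₁ : ∀ {x y : X} (f : x ⟶ y), M''.map f ≍ hφ.map f := fun {x y} f =>
    ECat.pull_hom_heq (h₀ x) (h₀ y) (h₁ y) (h₂ f)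
      ((heq_of_eq (γ.naturality f)).trans
        ((comp_heq_of_heq (h₀ x) (h₁ x) (M.map f)).trans (heq_of_eq (hφ.map_ι f).symm)))
  have e : hφ.restrict = M'' := (twoFunctor_ext h₀ e₁ fun {x y f g} α =>
    ECat.pull_hom₂_heq (h₀ x) (h₀ y) (h₁ y) (e₁ f) (e₁ g)
      ((γ.naturality₂_heq α).trans
        ((whiskerLeft_heq_of_heq (h₀ x) (h₁ x) (M.map₂ α)).trans (hφ.map₂_ι α).symm))).symm
  exact ⟨e, TwoNatTrans.heq e rfl fun x => (h₁ x).symm⟩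

end ObNatural

end restrict
end Pull
end VEnr

/-! ### The split fibrations over `Enr 1` -/

namespace VEnr
section Split
universe w
open Bicategory

namespace ObNatural

variable {A B : VDC.{w}} {X : Type*} [Bicategory X] [Strict X]
  {M M' : StrictPseudofunctor X (ECat.{u} A)} {N : StrictPseudofunctor X (ECat.{u} B)}
  {φ : ∀ x, (N.obj x).ob → (M.obj x).ob} (hφ : ObNatural M N φ)

/-- The existence half of the cartesian property: each component factors through the inclusion by
`pullLift`. Naturality is checked after the inclusion, where it is that of `θ`, and on objects,
where it is `hk`. -/
theorem exists_lift (θ : TwoNatTrans M' M) (k : ∀ x, (M'.obj x).ob → (N.obj x).ob)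
    (hk : ∀ {x y : X} (f : x ⟶ y) (c : (M'.obj x).ob),
      k y (EFunctor.obj (M'.map f) c) = EFunctor.obj (N.map f) (k x c))
    (h : ∀ x c, EFunctor.obj (θ.app x) c = φ x (k x c)) :
    ∃ χ : TwoNatTrans M' hφ.restrict,
      (∀ x c, EFunctor.obj (χ.app x) c = k x c) ∧ χ.vcomp hφ.inclusion = θ := by
  let G : ∀ x, M'.obj x ⟶ (M.obj x).pull (φ x) := fun x => ECat.pullLift (θ.app x) (k x) (h x)
  have hG : ∀ x, G x ≫ hφ.ι x = θ.app x := fun x => ECat.pullLift_comp_incl _ _ _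
  have nat : ∀ {x y : X} (f : x ⟶ y), M'.map f ≫ G y = G x ≫ hφ.map f := fun {x y} f =>
    hφ.hom_ext (fun c => hk f c) (by
      rw [Strict.assoc, hG, θ.naturality, Strict.assoc, map_ι, ← Strict.assoc, hG])
  refine ⟨TwoNatTrans.mk' G nat fun {x y f g} α => hφ.hom₂_heq (nat f) (nat g) ?_,
    fun x c => rfl, TwoNatTrans.ext hG⟩
  exact (wr_comp_heq _ _ _).symm.trans <|
    (wr_heq (hG y) rfl rfl HEq.rfl).trans <|
    (θ.naturality₂_heq α).trans <|
    (wl_heq (hG x).symm rfl rfl HEq.rfl).trans <|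
    (comp_wl_heq _ _ _).trans <|
    (wl_heq rfl (hφ.map_ι f).symm (hφ.map_ι g).symm (hφ.map₂_ι α).symm).trans
    (wl_wr_heq _ _ _).symm

theorem lift_unique {χ χ' : TwoNatTrans M' hφ.restrict}
    (h₀ : ∀ x c, EFunctor.obj (χ.app x) c = EFunctor.obj (χ'.app x) c)
    (h : χ.vcomp hφ.inclusion = χ'.vcomp hφ.inclusion) : χ = χ' :=
  TwoNatTrans.ext fun x => hφ.hom_ext (h₀ x) (congrArg (fun t => TwoNatTrans.app t x) h)

end ObNatural

theorem EFunctor.obj_naturality {A : VDC.{w}} {X : Type*} [Bicategory X]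
    {M N : StrictPseudofunctor X (ECat.{u} A)} (g : TwoNatTrans M N) {x y : X} (f : x ⟶ y)
    (c : (M.obj x).ob) : EFunctor.obj (g.app y) (EFunctor.obj (M.map f) c) =
      EFunctor.obj (N.map f) (EFunctor.obj (g.app x) c) :=
  congrArg (fun t : M.obj x ⟶ N.obj y => EFunctor.obj t c) (g.naturality f)

variable {A : VDC.{max (u + 1) v}} {X : TwoCAT.{max (u + 1) v}}

/-- The axioms of a split fibration insert `eqToHom` into the morphism being lifted; such a factor
does not affect the functions along which one restricts. -/
theorem EFunctor.obj_comp_eqToHom_app {M : X ⟶ Enr.{u, v}.obj A} {P Q : X ⟶ Enr.{u, v}.obj A}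
    (β : M ⟶ P) (h : P = Q) (x : X) (c : ECat.ob (M.obj x)) :
    EFunctor.obj (TwoNatTrans.app (β ≫ eqToHom h) x) c ≍ EFunctor.obj (TwoNatTrans.app β x) c := by
  subst h
  rw [eqToHom_refl, Category.comp_id]

/-- A 2-natural transformation between diagrams in `Enr 1` is determined by its functions on
objects, so lying over `f` is a condition on these alone. Elements are related heterogeneously
because `ha` and `hb` are mere propositional equalities. -/
theorem isHomLift_enrMap_iff (F : A ⟶ VDC.one) {a b : X ⟶ Enr.{u, v}.obj A}
    {R S : X ⟶ Enr.{u, v}.obj VDC.one} (f : R ⟶ S) (φ : a ⟶ b)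
    (ha : (postcomp X (Enr.{u, v}.map F)).obj a = R)
    (hb : (postcomp X (Enr.{u, v}.map F)).obj b = S) :
    (postcomp X (Enr.{u, v}.map F)).IsHomLift f φ ↔
      ∀ (x : X) (s : ECat.ob (a.obj x)) (s' : ECat.ob (R.obj x)), s ≍ s' →
        EFunctor.obj (TwoNatTrans.app φ x) s ≍ EFunctor.obj (TwoNatTrans.app f x) s' := by
  subst ha hb
  constructor
  · intro h x s s' hs
    cases hs
    rw [IsHomLift.eq_of_isHomLift _ f φ]
    rfl
  · intro h
    obtain rfl : f = (postcomp X (Enr.{u, v}.map F)).map φ :=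
      TwoNatTrans.ext fun x => EFunctor.one_ext fun s => (eq_of_heq (h x s s HEq.rfl)).symm
    infer_instance

/-- The functions on objects underlying a 2-natural transformation. -/
@[reducible]
def obFun {F : A ⟶ VDC.one} {M : X ⟶ Enr.{u, v}.obj A} {N : X ⟶ Enr.{u, v}.obj VDC.one}
    (β : N ⟶ M ≫ Enr.{u, v}.map F) (x : X) : ECat.ob (N.obj x) → ECat.ob (M.obj x) :=
  EFunctor.obj (D := ECat.map F (M.obj x)) (TwoNatTrans.app β x)

theorem obNatural_obFun {F : A ⟶ VDC.one} {M : X ⟶ Enr.{u, v}.obj A}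
    {N : X ⟶ Enr.{u, v}.obj VDC.one} (β : N ⟶ M ≫ Enr.{u, v}.map F) :
    ObNatural (A := A) (X := X) M N (obFun.{u, v} β) :=
  ⟨fun f s => (EFunctor.obj_naturality (X := X) (A := VDC.one) β f s).symm⟩

section fib

variable {F : A ⟶ VDC.one} {M : X ⟶ Enr.{u, v}.obj A} {N : X ⟶ Enr.{u, v}.obj VDC.one}
  (β : N ⟶ M ≫ Enr.{u, v}.map F)

/-- The domain of the chosen cartesian lift of `β`. -/
noncomputable def cartesianObj : X ⟶ Enr.{u, v}.obj A :=
  (obNatural_obFun.{u, v} β).restrict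

/-- The chosen cartesian lift of `β`. -/
noncomputable def cartesianHom : cartesianObj.{u, v} β ⟶ M :=
  (obNatural_obFun.{u, v} β).inclusion

theorem cartesianObj_comp : cartesianObj.{u, v} β ≫ Enr.{u, v}.map F = N :=
  twoFunctor_one_ext (X := X) (fun _ => rfl) (fun _ => HEq.rfl)

/-- Lying over `g ≫ β` says that `θ` acts on objects by `g` followed by the functions of `β`. Hence
`g` supplies the functions needed for `exists_lift`, and any competing factorization has the same
functions, so `lift_unique` applies. -/
theorem isStronglyCartesian_cartesianHom :
    (postcomp X (Enr.{u, v}.map F)).IsStronglyCartesian β (cartesianHom.{u, v} β) where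
  toIsHomLift := (isHomLift_enrMap_iff.{u, v} F _ _ (cartesianObj_comp.{u, v} β) rfl).2
    fun x s s' hs => by cases hs; rfl
  universal_property' {M'} g θ hθ := by
    have hθ' := (isHomLift_enrMap_iff.{u, v} F _ _ rfl rfl).1 hθ
    obtain ⟨χ, hχ, hχ'⟩ := (obNatural_obFun.{u, v} β).exists_lift (M' := M') θ
      (fun x => EFunctor.obj (TwoNatTrans.app g x))
      (fun f c => EFunctor.obj_naturality (X := X) (A := VDC.one) g f c)
      (fun x c => eq_of_heq (hθ' x c c HEq.rfl))
    refine ⟨χ, ⟨(isHomLift_enrMap_iff.{u, v} F _ _ rfl (cartesianObj_comp.{u, v} β)).2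
      fun x s s' hs => ?_, hχ'⟩,
      fun χ₁ ⟨h₁, h₂⟩ => (obNatural_obFun.{u, v} β).lift_unique (fun x c => ?_) (h₂.trans hχ'.symm)⟩
    · cases hs
      exact heq_of_eq (hχ x s)
    · exact (eq_of_heq ((isHomLift_enrMap_iff.{u, v} F _ _ rfl (cartesianObj_comp.{u, v} β)).1 h₁ x c c
        HEq.rfl)).trans (hχ x c).symm

theorem cartesian_unique {M'' : X ⟶ Enr.{u, v}.obj A} (γ : M'' ⟶ M)
    (h₀ : ∀ x, M''.obj x = ECat.pull (M.obj x) (obFun.{u, v} β x))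
    (h₁ : ∀ x, TwoNatTrans.app γ x ≍ ECat.incl (M.obj x) (obFun.{u, v} β x))
    (h₂ : ∀ {x y : X} (f : x ⟶ y), EFunctor.obj (M''.map f) ≍ EFunctor.obj (N.map f)) :
    cartesianObj.{u, v} β = M'' ∧ cartesianHom.{u, v} β ≍ γ :=
  (obNatural_obFun.{u, v} β).restrict_unique γ h₀ h₁ h₂

end fib

theorem eq_eqToHom_of_heq {C : Type*} [Category C] {a b : C} (h : a = b) {f : a ⟶ b}
    (hf : f ≍ 𝟙 b) : f = eqToHom h := by
  subst h
  exact eq_of_heq hf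

theorem eq_eqToHom_comp_of_heq {C : Type*} [Category C] {a b c : C} (h : a = b) {f : a ⟶ c}
    {g : b ⟶ c} (hf : f ≍ g) : f = eqToHom h ≫ g := by
  subst h
  simpa using hf

/-- Restricting along identity functions changes none of the data, so the required equalities hold
by definition. -/
theorem cartesian_id {F : A ⟶ VDC.one} (M : X ⟶ Enr.{u, v}.obj A) :
    cartesianObj.{u, v} (𝟙 (M ≫ Enr.{u, v}.map F)) = M ∧
      cartesianHom.{u, v} (𝟙 (M ≫ Enr.{u, v}.map F)) ≍ 𝟙 M :=
  cartesian_unique.{u, v} _ (𝟙 M) (fun x => rfl) (fun x => HEq.rfl) (fun f => HEq.rfl)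

theorem ECat.pull_incl_heq {A : VDC.{w}} {D : ECat.{u} A} {S : Type u} {ψ ψ' : S → D.ob}
    (h : ∀ s, ψ s = ψ' s) : D.pull ψ = D.pull ψ' ∧ D.incl ψ ≍ D.incl ψ' := by
  obtain rfl : ψ = ψ' := funext h
  exact ⟨rfl, HEq.rfl⟩

/-- Restricting twice picks the same extents, homs and structure cells as restricting once along the
composite function, and the inclusions compose by `incl_comp_incl`. -/
theorem cartesian_comp {F : A ⟶ VDC.one} {M : X ⟶ Enr.{u, v}.obj A}
    {N N' : X ⟶ Enr.{u, v}.obj VDC.one} (β : N ⟶ M ≫ Enr.{u, v}.map F) (γ : N' ⟶ N)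
    (h : N = cartesianObj.{u, v} β ≫ Enr.{u, v}.map F) :
    cartesianObj.{u, v} (γ ≫ β) = cartesianObj.{u, v} (γ ≫ eqToHom h) ∧
      cartesianHom.{u, v} (γ ≫ β) ≍
        cartesianHom.{u, v} (γ ≫ eqToHom h) ≫ cartesianHom.{u, v} β := by
  have e : ∀ (x : X) (s : ECat.ob (N'.obj x)),
      obFun.{u, v} β x (obFun.{u, v} (M := cartesianObj.{u, v} β) (γ ≫ eqToHom h) x s) =
      obFun.{u, v} (γ ≫ β) x s := fun x s => by
    have h' := eq_of_heq (EFunctor.obj_comp_eqToHom_app.{u, v} γ h x s)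
    exact congrArg (obFun.{u, v} β x) h'
  exact cartesian_unique.{u, v} _ (cartesianHom.{u, v} (γ ≫ eqToHom h) ≫ cartesianHom.{u, v} β)
    (fun x => (ECat.pull_incl_heq (D := M.obj x) (e x)).1)
    (fun x => (heq_of_eq (ECat.incl_comp_incl _ _ _)).trans
      (ECat.pull_incl_heq (D := M.obj x) (e x)).2)
    (fun f => HEq.rfl)

/-- The split fibration structure on postcomposition with `Enr A → Enr 1`. -/
noncomputable def enrSplitFibration (F : A ⟶ VDC.one) (X : TwoCAT.{max (u + 1) v}) :
    SplitFibration (postcomp X (Enr.{u, v}.map F)) where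
  obj {M N} β := cartesianObj.{u, v} (M := M) β
  hom {M N} β := cartesianHom.{u, v} (M := M) β
  cartesian {M N} β := isStronglyCartesian_cartesianHom.{u, v} (M := M) β
  obj_id M := (cartesian_id.{u, v} M).1
  hom_id M := eq_eqToHom_of_heq _ (cartesian_id.{u, v} M).2
  obj_comp {M N N'} β γ := (cartesian_comp.{u, v} (M := M) β γ _).1
  hom_comp {M N N'} β γ := eq_eqToHom_comp_of_heq _ (cartesian_comp.{u, v} (M := M) β γ _).2

/-- The split fibration `Enr A → Enr 1`. -/
noncomputable def enrSplitFib (F : A ⟶ VDC.one) : SplitFib (Enr.{u, v}.map F) where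
  fib X := enrSplitFibration F X
  stable {X Y} f M N β := by
    have e : ∀ (y : Y) (s : ECat.ob (N.obj (f.obj y))),
        obFun.{u, v} (M := M) β (f.obj y) s =
        obFun.{u, v} (M := f ≫ M) ((precomp _ f).map β ≫
          eqToHom (Strict.assoc f M (Enr.{u, v}.map F)).symm) y s := fun y s =>
      (eq_of_heq (EFunctor.obj_comp_eqToHom_app.{u, v} ((precomp _ f).map β)
        (Strict.assoc f M (Enr.{u, v}.map F)).symm y s)).symm
    -- Restriction is pointwise, so precomposing the chosen lift with `f` gives a pointwise
    -- restriction again, along the functions at the objects `f.obj y`.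
    exact cartesian_unique.{u, v} _ (f ◁ cartesianHom.{u, v} (M := M) β)
      (fun y => (ECat.pull_incl_heq (D := M.obj (f.obj y)) (e y)).1)
      (fun y => (ECat.pull_incl_heq (D := M.obj (f.obj y)) (e y)).2)
      (fun g => HEq.rfl)

/-- An inclusion is built from identity vertical morphisms and identity multicells, which virtual
double functors preserve. -/
theorem ECat.incl_map {A B : VDC.{w}} (F : VDFunctor A B) (D : ECat.{u} A) {S : Type u}
    (ψ : S → D.ob) : (D.incl ψ).map F = (D.map F).incl ψ :=
  EFunctor.ext' (fun _ => rfl) (fun _ => heq_of_eq (F.V.map_id _)) fun _ _ => F.map_idCell_heq _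

/-- A virtual double functor acts on each extent, hom and structure cell separately, so applying it
commutes with selecting some of them by restriction. The functions on objects are untouched, and
`cartesian_unique` identifies the two lifts. -/
theorem preserves_enr {A B : VDC.{max (u + 1) v}} (F : A ⟶ B) :
    Spl.Preserves (B := Enr.{u, v}.obj VDC.one)
      ⟨(toSlice VDC.oneIsTerminal Enr.{u, v}).obj A, enrSplitFib _⟩
      ⟨(toSlice VDC.oneIsTerminal Enr.{u, v}).obj B, enrSplitFib _⟩
      ((toSlice VDC.oneIsTerminal Enr.{u, v}).map F) := by
  intro X M N β
  have hM : M ≫ Enr.{u, v}.map (VDC.oneIsTerminal.from_ A) =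
      (M ≫ Enr.{u, v}.map F) ≫ Enr.{u, v}.map (VDC.oneIsTerminal.from_ B) :=
    (congrArg (M ≫ ·) ((toSlice VDC.oneIsTerminal Enr.{u, v}).map F).w.symm).trans
      (Strict.assoc _ _ _).symm
  have e : ∀ (x : X) (s : ECat.ob (N.obj x)),
      obFun.{u, v} (M := M) β x s =
      obFun.{u, v} (M := M ≫ Enr.{u, v}.map F) ((𝟭 _).map β ≫ eqToHom hM) x s := fun x s =>
    (eq_of_heq (EFunctor.obj_comp_eqToHom_app.{u, v} ((𝟭 _).map β) hM x s)).symm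
  exact cartesian_unique.{u, v} (M := M ≫ Enr.{u, v}.map F) _
    (cartesianHom.{u, v} (M := M) β ▷ Enr.{u, v}.map F)
    (fun x => (ECat.pull_incl_heq (D := ECat.map F (M.obj x)) (e x)).1)
    (fun x => (heq_of_eq (ECat.incl_map F (M.obj x) (obFun.{u, v} (M := M) β x))).trans
      (ECat.pull_incl_heq (D := ECat.map F (M.obj x)) (e x)).2)
    (fun g => HEq.rfl)

/-- The factorization of `Enr₁` through split fibrations. -/
noncomputable def enrSpl : StrictPseudofunctor VDC.{max (u + 1) v} (Spl (Enr.{u, v}.obj VDC.one)) :=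
  let R := toSlice VDC.oneIsTerminal Enr.{u, v}
  mkTwoFunctor (fun A => ⟨R.obj A, enrSplitFib _⟩) (fun F => ⟨R.map F, preserves_enr F⟩)
    (fun α => R.map₂ α)
    (fun A => Spl.Hom.ext (R.map_id A))
    (fun F G => Spl.Hom.ext (R.map_comp F G))
    (fun F => R.map₂_id F)
    (fun α β => R.map₂_comp α β)
    (fun F _ _ α => map₂_wl_heq R F α)
    (fun α F => map₂_wr_heq R α F)

theorem isFamilial_enr : IsFamilial VDC.oneIsTerminal.{max (u + 1) v} Enr.{u, v} :=
  ⟨isParametricRightTwoAdjoint_enr, enrSpl,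
    twoFunctor_ext (fun _ => rfl) (fun _ => HEq.rfl) (fun _ => HEq.rfl)⟩

end Split
end VEnr

theorem mainTheorem1 :
    VEnr.IsFamilial VEnr.VDC.oneIsTerminal.{max (u + 1) v} VEnr.Enr.{u, v} ∧
      VEnr.IsParametricRightTwoAdjoint VEnr.VDC.oneIsTerminal.{max (u + 1) v} VEnr.Enr.{u, v} :=
  ⟨VEnr.isFamilial_enr, VEnr.isParametricRightTwoAdjoint_enr⟩
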